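/- Let $K$ be a field of characteristic zero, $A$ a ($\mathbb Z$-)graded, associative, graded commutative, unital $K$-algebra, and $L$, $P$ graded $A$-modules. Signs follow the Koszul rule; an element (or map) written in an exponent of $(-1)$ stands for its degree, and $\alpha(\sigma,\boldsymbol\xi)$ is the Koszul sign, $\xi_{\sigma(1)}\odot\cdots\odot\xi_{\sigma(n)}=\alpha(\sigma,\boldsymbol\xi)\,\xi_1\odot\cdots\odot\xi_n$. $S_{p,q}$ is the set of $(p,q)$-unshuffles (empty if $p$ or $q$ is negative). A *multiderivation of $L$ with $k$ entries*, of degree $1$, is a pair $(X_k,\sigma_k)$ of degree $1$ maps, $X_k:L^{\times k}\to L$ being $K$-multilinear and graded symmetric, and $\sigma_k$ (the *anchor*) being a graded symmetric, graded $A$-multilinear map from $L^{\times(k-1)}$ to the graded derivations of $A$, such that $X_k(\xi_1,\dots,\xi_{k-1},a\xi_k)=\sigma_k(\xi_1,\dots,\xi_{k-1}|a)\,\xi_k+(-1)^{(1+\xi_1+\cdots+\xi_{k-1})a}\,a\,X_k(\xi_1,\dots,\xi_k)$. Let $(A,L)$ be an $LR_\infty[1]$ algebra: there are given multiderivations $\mathbb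 X_k=(X_k,\sigma_k)$, $k\ge 1$, of degree $1$, such that $\mathbb X=\mathbb X_1+\mathbb X_2+\cdots$ satisfies $\tfrac12[\mathbb X,\mathbb X]=0$; i.e. for all $N\ge1$ $$\sum_{i+j=N}\sum_{\sigma\in S_{i,j}}\alpha(\sigma,\boldsymbol\xi)X_{j+1}(X_i(\xi_{\sigma(1)},\dots,\xi_{\sigma(i)}),\xi_{\sigma(i+1)},\dots,\xi_{\sigma(N)})=0\qquad(i\ge 1,\ j\ge0)$$ and, for all $N\ge0$, $$\sum_{i+j=N,\ i\ge0}\sum_{\sigma\in S_{i,j}}(-1)^{\xi_{\sigma(1)}+\cdots+\xi_{\sigma(i)}}\alpha(\sigma,\boldsymbol\xi)\,\sigma_{i+1}(\xi_{\sigma(1)},\dots,\xi_{\sigma(i)}|\sigma_{j+1}(\xi_{\sigma(i+1)},\dots,\xi_{\sigma(N)}|a))+\sum_{i+j=N,\ i\ge1}\sum_{\sigma\in S_{i,j}}\alpha(\sigma,\boldsymbol\xi)\,\sigma_{j+2}(X_i(\xi_{\sigma(1)},\dots,\xi_{\sigma(i)}),\xi_{\sigma(i+1)},\dots,\xi_{\sigma(N)}|a)=0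 .$$ Let $\nabla$ be a left $(A,L)$-connection in $P$: a family, $k\ge1$, of degree $1$, graded symmetric, graded $A$-multilinear maps $\nabla_k:L^{\times(k-1)}\to\mathrm{End}_K P$, written $(\xi_1,\dots,\xi_{k-1},p)\mapsto\nabla_k(\xi_1,\dots,\xi_{k-1}|p)$, with $\nabla_k(\boldsymbol\xi|ap)=(-1)^{(1+\xi_1+\cdots+\xi_{k-1})a}\,a\nabla_k(\boldsymbol\xi|p)+\sigma_k(\boldsymbol\xi|a)\,p$. (No flatness is assumed.) Let $S_A^\bullet L$ be the graded symmetric algebra of $L$ over $A$, with the degree for which $a\zeta_1\cdots\zeta_\ell$ has degree $\bar a+\bar\zeta_1+\cdots+\bar\zeta_\ell$. Let $\mathrm{Sym}_A(L,P)=\bigoplus_{\ell\ge0}\mathrm{Sym}_A^\ell(L,P)$, where $\mathrm{Sym}_A^\ell(L,P)$ is spanned by the homogeneous, graded symmetric, graded $A$-multilinear maps $L^{\times\ell}\to P$. It is an $S_A^\bullet L$-module, $(u,\Omega)\mapsto i_u\Omega$, with $i_a\Omega=a\Omega$ for $a\in A$ and, for $u=\zeta_1\cdots\zeta_r$ and $\Omega$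 an $\ell$-form, $(i_u\Omega)(\xi_1,\dots,\xi_{\ell-r})=(-1)^{u\Omega}\Omega(\zeta_1,\dots,\zeta_r,\xi_1,\dots,\xi_{\ell-r})$ (and $i_u\Omega=0$ if $r>\ell$). **Proposition.** Let $k\ge1$. (0) There are a unique $k$-entry, degree $1$, graded symmetric $K$-multilinear bracket $\{u_1,\dots,u_k\}$ on $S_A^\bullet L$ and a unique $K$-linear operator $D_k^\nabla$ on $\mathrm{Sym}_A(L,P)$ with the following properties. The bracket is a multiderivation, $\{u_1,\dots,u_{k-1},vw\}=(-1)^{(1+u_1+\cdots+u_{k-1})v}\,v\{u_1,\dots,u_{k-1},w\}+\{u_1,\dots,u_{k-1},v\}w$, it extends $\mathbb X_k$, i.e. $\{\xi_1,\dots,\xi_k\}=X_k(\xi_1,\dots,\xi_k)$ and $\{\xi_1,\dots,\xi_{k-1},a\}=\sigma_k(\xi_1,\dots,\xi_{k-1}|a)$ for $\xi_i\in L$, $a\in A$, and it vanishes when two of its entries are in $A$. The operator $D^\nabla_k$ maps an $\ell$-form $\Omega$ of degree $d$ to an $(\ell+k-1)$-form of degree $d+1$, and $$(D_k^\nabla\Omega)(\xi_1,\dots,\xi_{\ell+k-1})=\sum_{\sigma\in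 S_{k-1,\ell}}(-1)^{\Omega(\xi_{\sigma(1)}+\cdots+\xi_{\sigma(k-1)})}\alpha(\sigma,\boldsymbol\xi)\nabla_k(\xi_{\sigma(1)},\dots,\xi_{\sigma(k-1)}|\Omega(\xi_{\sigma(k)},\dots,\xi_{\sigma(\ell+k-1)}))-\sum_{\tau\in S_{k,\ell-1}}(-1)^{\Omega}\alpha(\tau,\boldsymbol\xi)\,\Omega(X_k(\xi_{\tau(1)},\dots,\xi_{\tau(k)}),\xi_{\tau(k+1)},\dots,\xi_{\tau(\ell+k-1)}).$$ (1) For all homogeneous $u_1,\dots,u_k\in S_A^\bullet L$, with $[\cdot,\cdot]$ the graded commutator of operators on $\mathrm{Sym}_A(L,P)$, $$[\cdots[[D_k^\nabla,i_{u_1}],i_{u_2}]\cdots,i_{u_k}]=-(-1)^k\,i_{\{u_1,\dots,u_k\}} .$$ (2) In particular, $D_k^\nabla$ is a differential operator of order $k$ in the $S_A^\bullet L$-module $\mathrm{Sym}_A(L,P)$: $[\cdots[[D_k^\nabla,i_{u_1}],i_{u_2}]\cdots,i_{u_{k+1}}]=0$ for all homogeneous $u_1,\dots,u_{k+1}\in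 S_A^\bullet L$. -/

import Mathlib

namespace SHLR

open Equiv DirectSum

set_option linter.unusedSectionVars false

/-! ### Koszul signs, unshuffles, graded multilinear maps -/

/-- The Koszul sign `α(σ, v)` of a permutation `σ` of homogeneous elements of degrees `n`:
`v_{σ 0} ⊙ ⋯ ⊙ v_{σ (m-1)} = α(σ, v) v_0 ⊙ ⋯ ⊙ v_{m-1}`. It is the product of the signs
`(-1)^{|v_{σ i}| |v_{σ j}|}` over the inversions of `σ`. -/
def koszulSign {m : ℕ} (σ : Perm (Fin m)) (n : Fin m → ℤ) : ℤˣ :=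
  ∏ i, ∏ j, if i < j ∧ σ j < σ i then (n (σ i) * n (σ j)).negOnePow else 1

/-- The `(p, q)`-unshuffles: permutations increasing on the first `p` and on the last `q`
places. -/
def unshuffles (p q : ℕ) : Finset (Perm (Fin (p + q))) :=
  {σ | (∀ i j : Fin p, i < j → σ (Fin.castAdd q i) < σ (Fin.castAdd q j)) ∧
    (∀ i j : Fin q, i < j → σ (Fin.natAdd p i) < σ (Fin.natAdd p j))}

/-- The sum over all `(p, q)`-unshuffles `σ` of `α(σ, ξ) F(ξ_{σ 0}, …, ξ_{σ (p-1)};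
ξ_{σ p}, …, ξ_{σ (p+q-1)})`, for `ξ` homogeneous of degrees `n`. The first argument of `F` is the
tuple of degrees of the first block. -/
def unshuffleSum {L M : Type*} [AddCommGroup M] (p q : ℕ) (n : Fin (p + q) → ℤ)
    (ξ : Fin (p + q) → L) (F : (Fin p → ℤ) → (Fin p → L) → (Fin q → L) → M) : M :=
  ∑ σ ∈ unshuffles p q, koszulSign σ n •
    F (fun i => n (σ (Fin.castAdd q i))) (fun i => ξ (σ (Fin.castAdd q i)))
      (fun j => ξ (σ (Fin.natAdd p j)))

section GradedMaps

variable {K A L M : Type*} [Field K] [Ring A] [Algebra K A] [AddCommGroup L] [Module K L]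
  [Module A L] [AddCommGroup M] [Module K M] [Module A M]

/-- A `ℤ`-graded algebra is graded commutative if `a b = (-1)^{|a||b|} b a`. -/
class GradedCommutative (𝒜 : ℤ → Submodule K A) : Prop where
  comm : ∀ {i j : ℤ} {a b : A}, a ∈ 𝒜 i → b ∈ 𝒜 j → a * b = (i * j).negOnePow • (b * a)

/-- The map `Ω : L × ⋯ × L → M` has degree `d`. -/
def HasDegree (ℒ : ℤ → Submodule K L) (ℳ : ℤ → Submodule K M) {ℓ : ℕ} (d : ℤ)
    (Ω : MultilinearMap K (fun _ : Fin ℓ => L) M) : Prop :=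
  ∀ (n : Fin ℓ → ℤ) (ξ : Fin ℓ → L), (∀ i, ξ i ∈ ℒ (n i)) → Ω ξ ∈ ℳ (d + ∑ i, n i)

/-- The degree `d` map `Ω : L × ⋯ × L → End_K M` takes values in graded operators:
`|Ω(ξ_1, …, ξ_ℓ | x)| = d + |ξ_1| + ⋯ + |ξ_ℓ| + |x|`. -/
def HasOpDegree (ℒ : ℤ → Submodule K L) (ℳ : ℤ → Submodule K M) {ℓ : ℕ} (d : ℤ)
    (Ω : MultilinearMap K (fun _ : Fin ℓ => L) (M →ₗ[K] M)) : Prop :=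
  ∀ (n : Fin ℓ → ℤ) (ξ : Fin ℓ → L), (∀ i, ξ i ∈ ℒ (n i)) →
    ∀ (j : ℤ) (x : M), x ∈ ℳ j → Ω ξ x ∈ ℳ (d + ∑ i, n i + j)

/-- Graded symmetry: `Ω(ξ_{σ 0}, ξ_{σ 1}, …) = α(σ, ξ) Ω(ξ_0, ξ_1, …)` for homogeneous `ξ`. -/
def IsGradedSymm (ℒ : ℤ → Submodule K L) {ℓ : ℕ}
    (Ω : MultilinearMap K (fun _ : Fin ℓ => L) M) : Prop :=
  ∀ (n : Fin ℓ → ℤ) (ξ : Fin ℓ → L), (∀ i, ξ i ∈ ℒ (n i)) →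
    ∀ σ : Perm (Fin ℓ), Ω (fun i => ξ (σ i)) = koszulSign σ n • Ω ξ

/-- Graded `A`-multilinearity of a map `Ω` of degree `d`:
`Ω(ξ_0, …, a ξ_i, …) = (-1)^{|a| (d + |ξ_0| + ⋯ + |ξ_{i-1}|)} a Ω(ξ_0, …, ξ_i, …)`. -/
def IsGradedMultilinear (𝒜 : ℤ → Submodule K A) (ℒ : ℤ → Submodule K L) {ℓ : ℕ} (d : ℤ)
    (Ω : MultilinearMap K (fun _ : Fin ℓ => L) M) : Prop :=
  ∀ (n : Fin ℓ → ℤ) (ξ : Fin ℓ → L), (∀ i, ξ i ∈ ℒ (n i)) →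
    ∀ (e : ℤ) (a : A), a ∈ 𝒜 e → ∀ i : Fin ℓ,
      Ω (Function.update ξ i (a • ξ i)) =
        (e * (d + ∑ j ∈ Finset.univ.filter (· < i), n j)).negOnePow • (a • Ω ξ)

end GradedMaps

/-! ### `LR_∞[1]` algebras and left connections -/

section Structures

variable {K A L P : Type*} [Field K] [Ring A] [Algebra K A] [AddCommGroup L] [Module K L]
  [Module A L] [AddCommGroup P] [Module K P] [Module A P] [IsScalarTower K A P]

/-- A degree `1` multiderivation `𝕏 = 𝕏_1 + 𝕏_2 + ⋯` of the graded `A`-module `L` without `0`-entry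
component. `X m` and `σ m` are the bracket and the symbol (anchor) of the component `𝕏_{m+1}` with
`m + 1` entries. -/
structure Multiderivation (𝒜 : ℤ → Submodule K A) (ℒ : ℤ → Submodule K L) where
  X : ∀ m : ℕ, MultilinearMap K (fun _ : Fin (m + 1) => L) L
  σ : ∀ m : ℕ, MultilinearMap K (fun _ : Fin m => L) (A →ₗ[K] A)
  X_degree : ∀ m, HasDegree ℒ ℒ 1 (X m)
  X_symm : ∀ m, IsGradedSymm ℒ (X m)
  σ_degree : ∀ m, HasOpDegree ℒ 𝒜 1 (σ m)
  σ_symm : ∀ m, IsGradedSymm ℒ (σ m)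
  σ_linear : ∀ m, IsGradedMultilinear 𝒜 ℒ 1 (σ m)
  σ_derivation : ∀ (m : ℕ) (n : Fin m → ℤ) (ξ : Fin m → L), (∀ i, ξ i ∈ ℒ (n i)) →
    ∀ (e : ℤ) (a b : A), a ∈ 𝒜 e →
      σ m ξ (a * b) = σ m ξ a * b + ((1 + ∑ i, n i) * e).negOnePow • (a * σ m ξ b)
  X_leibniz : ∀ (m : ℕ) (n : Fin m → ℤ) (ξ : Fin m → L), (∀ i, ξ i ∈ ℒ (n i)) →
    ∀ (e : ℤ) (a : A) (ζ : L), a ∈ 𝒜 e →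
      X m (Fin.snoc (α := fun _ => L) ξ (a • ζ)) = σ m ξ a • ζ +
        ((1 + ∑ i, n i) * e).negOnePow • (a • X m (Fin.snoc (α := fun _ => L) ξ ζ))

variable {𝒜 : ℤ → Submodule K A} {ℒ : ℤ → Submodule K L}

/-- The bracket part of the higher Jacobiator `½[𝕏, 𝕏]`, with `N + 1` entries:
`∑_{i+j=N} ∑_{σ ∈ S_{i+1,j}} α(σ, ξ) X(X(ξ_{σ 0}, …, ξ_{σ i}), ξ_{σ (i+1)}, …)`,
on homogeneous `ξ` of degrees `n`. -/
def Multiderivation.jacobiator (𝕏 : Multiderivation 𝒜 ℒ) (N : ℕ) (n : Fin (N + 1) → ℤ)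
    (ξ : Fin (N + 1) → L) : L :=
  ∑ i : Fin (N + 1),
    have h : (i : ℕ) + 1 + (N - i) = N + 1 := by omega
    unshuffleSum (i + 1) (N - i) (n ∘ Fin.cast h) (ξ ∘ Fin.cast h)
      fun _ ξ₁ ξ₂ => 𝕏.X (N - i) (Fin.cons (𝕏.X i ξ₁) ξ₂)

/-- The symbol of the higher Jacobiator `½[𝕏, 𝕏]`, with `N` entries from `L`. The first sum is
`∑_{i+j=N} ∑_{σ ∈ S_{i,j}} (-1)^χ α(σ, ξ) σ(ξ_{σ 0}, … | σ(ξ_{σ i}, … | a))` with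
`χ = |ξ_{σ 0}| + ⋯ + |ξ_{σ (i-1)}|`, the second one is
`∑_{i+1+j=N} ∑_{σ ∈ S_{i+1,j}} α(σ, ξ) σ(X(ξ_{σ 0}, …, ξ_{σ i}), ξ_{σ (i+1)}, … | a)`. -/
def Multiderivation.jacobiatorSymbol (𝕏 : Multiderivation 𝒜 ℒ) (N : ℕ) (n : Fin N → ℤ)
    (ξ : Fin N → L) (a : A) : A :=
  (∑ i : Fin (N + 1),
    have h : (i : ℕ) + (N - i) = N := by omega
    unshuffleSum i (N - i) (n ∘ Fin.cast h) (ξ ∘ Fin.cast h)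
      fun n₁ ξ₁ ξ₂ => (∑ j, n₁ j).negOnePow • 𝕏.σ i ξ₁ (𝕏.σ (N - i) ξ₂ a)) +
  ∑ i : Fin N,
    have h : (i : ℕ) + 1 + (N - (i + 1)) = N := by omega
    unshuffleSum (i + 1) (N - (i + 1)) (n ∘ Fin.cast h) (ξ ∘ Fin.cast h)
      fun _ ξ₁ ξ₂ => 𝕏.σ (N - (i + 1) + 1) (Fin.cons (𝕏.X i ξ₁) ξ₂) a

/-- An `LR_∞[1]` algebra structure on `(A, L)`: a degree `1` multiderivation with vanishing
`0`-entry component and vanishing higher Jacobiator. -/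
structure LRInfinity (𝒜 : ℤ → Submodule K A) (ℒ : ℤ → Submodule K L) extends
    Multiderivation 𝒜 ℒ where
  jacobi : ∀ (N : ℕ) (n : Fin (N + 1) → ℤ) (ξ : Fin (N + 1) → L), (∀ i, ξ i ∈ ℒ (n i)) →
    toMultiderivation.jacobiator N n ξ = 0
  jacobi_symbol : ∀ (N : ℕ) (n : Fin N → ℤ) (ξ : Fin N → L), (∀ i, ξ i ∈ ℒ (n i)) →
    ∀ a : A, toMultiderivation.jacobiatorSymbol N n ξ a = 0

/-- A left `(A, L)`-connection in the graded `A`-module `P`: a degree `1` form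
`∇ = ∇_1 + ∇_2 + ⋯` on `L` with values in the derivations of `P` such that the symbol of
`∇(ξ_1, …, ξ_m)` is the anchor of `(ξ_1, …, ξ_m)`. `conn m` is the component `∇_{m+1}`, with `m`
entries from `L` and one entry from `P`. -/
structure LeftConnection (𝕏 : LRInfinity 𝒜 ℒ) (𝒲 : ℤ → Submodule K P) where
  conn : ∀ m : ℕ, MultilinearMap K (fun _ : Fin m => L) (P →ₗ[K] P)
  degree : ∀ m, HasOpDegree ℒ 𝒲 1 (conn m)
  symm : ∀ m, IsGradedSymm ℒ (conn m)
  linear : ∀ m, IsGradedMultilinear 𝒜 ℒ 1 (conn m)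
  leibniz : ∀ (m : ℕ) (n : Fin m → ℤ) (ξ : Fin m → L), (∀ i, ξ i ∈ ℒ (n i)) →
    ∀ (e : ℤ) (a : A) (x : P), a ∈ 𝒜 e →
      conn m ξ (a • x) = ((1 + ∑ i, n i) * e).negOnePow • (a • conn m ξ x) + 𝕏.σ m ξ a • x

end Structures

/-! ### Symmetric forms -/

section Forms

variable {K A L P : Type*} [Field K] [Ring A] [Algebra K A] [AddCommGroup L] [Module K L]
  [Module A L] [AddCommGroup P] [Module K P] [Module A P] [IsScalarTower K A P]

/-- The symmetric `P`-valued `ℓ`-forms of degree `d`. -/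
def symForm (𝒜 : ℤ → Submodule K A) (ℒ : ℤ → Submodule K L) (𝒲 : ℤ → Submodule K P)
    (ℓ : ℕ) (d : ℤ) : Submodule K (MultilinearMap K (fun _ : Fin ℓ => L) P) where
  carrier := {Ω | HasDegree ℒ 𝒲 d Ω ∧ IsGradedSymm ℒ Ω ∧ IsGradedMultilinear 𝒜 ℒ d Ω}
  zero_mem' := ⟨fun _ _ _ => by simp, fun _ _ _ _ => by simp, fun _ _ _ _ _ _ _ => by simp⟩
  add_mem' := fun {Ω Ω'} h h' =>
    ⟨fun n ξ hξ => by simpa using add_mem (h.1 n ξ hξ) (h'.1 n ξ hξ),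
     fun n ξ hξ σ => by simp [h.2.1 n ξ hξ σ, h'.2.1 n ξ hξ σ],
     fun n ξ hξ e a ha i => by
      simp [h.2.2 n ξ hξ e a ha i, h'.2.2 n ξ hξ e a ha i]⟩
  smul_mem' := fun c Ω h =>
    ⟨fun n ξ hξ => by simpa using Submodule.smul_mem _ c (h.1 n ξ hξ),
     fun n ξ hξ σ => by
      rw [_root_.smul_apply, _root_.smul_apply, h.2.1 n ξ hξ σ, smul_comm],
     fun n ξ hξ e a ha i => by
      simp [h.2.2 n ξ hξ e a ha i, smul_comm c]⟩

variable (𝒜 : ℤ → Submodule K A) (ℒ : ℤ → Submodule K L) (𝒲 : ℤ → Submodule K P)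

/-- The bigraded space `Sym_A(L, P) = ⨁_{ℓ, d} Sym_A^{ℓ, d}(L, P)` of symmetric `P`-valued forms
on `L`. -/
def Sym : Type _ :=
  ⨁ p : ℕ × ℤ, symForm 𝒜 ℒ 𝒲 p.1 p.2

noncomputable instance : AddCommGroup (Sym 𝒜 ℒ 𝒲) :=
  inferInstanceAs (AddCommGroup (⨁ p : ℕ × ℤ, symForm 𝒜 ℒ 𝒲 p.1 p.2))

noncomputable instance : Module K (Sym 𝒜 ℒ 𝒲) :=
  inferInstanceAs (Module K (⨁ p : ℕ × ℤ, symForm 𝒜 ℒ 𝒲 p.1 p.2))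

/-- An `ℓ`-form of degree `d` as an element of `Sym_A(L, P)`. -/
noncomputable def formOf (ℓ : ℕ) (d : ℤ) : symForm 𝒜 ℒ 𝒲 ℓ d →ₗ[K] Sym 𝒜 ℒ 𝒲 :=
  DirectSum.lof K (ℕ × ℤ) (fun p => symForm 𝒜 ℒ 𝒲 p.1 p.2) (ℓ, d)

variable {𝒜 ℒ 𝒲} in
/-- The linear map on `Sym_A(L, P)` with given restrictions to the homogeneous components. -/
noncomputable def symLift {M : Type*} [AddCommGroup M] [Module K M]
    (f : ∀ p : ℕ × ℤ, symForm 𝒜 ℒ 𝒲 p.1 p.2 →ₗ[K] M) : Sym 𝒜 ℒ 𝒲 →ₗ[K] M :=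
  DirectSum.toModule K (ℕ × ℤ) M f

variable {𝒜 ℒ 𝒲} in
theorem symLift_formOf {M : Type*} [AddCommGroup M] [Module K M]
    (f : ∀ p : ℕ × ℤ, symForm 𝒜 ℒ 𝒲 p.1 p.2 →ₗ[K] M) (ℓ : ℕ) (d : ℤ)
    (Ω : symForm 𝒜 ℒ 𝒲 ℓ d) : symLift f (formOf 𝒜 ℒ 𝒲 ℓ d Ω) = f (ℓ, d) Ω :=
  DirectSum.toModule_lof (R := K) (φ := f) (ℓ, d) Ω

variable {𝒜 ℒ 𝒲} in
theorem sym_ext {M : Type*} [AddCommGroup M] [Module K M] {F G : Sym 𝒜 ℒ 𝒲 →ₗ[K] M}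
    (h : ∀ (ℓ : ℕ) (d : ℤ) (Ω : symForm 𝒜 ℒ 𝒲 ℓ d),
      F (formOf 𝒜 ℒ 𝒲 ℓ d Ω) = G (formOf 𝒜 ℒ 𝒲 ℓ d Ω)) : F = G :=
  DirectSum.linearMap_ext K fun p => LinearMap.ext fun Ω => h p.1 p.2 Ω

end Forms

/-! ### The graded symmetric algebra of `L` over `A` -/

section SymmetricAlgebra

variable {K A L : Type*} [Field K] [Ring A] [Algebra K A] [AddCommGroup L] [Module K L]
  [Module A L] (𝒜 : ℤ → Submodule K A) (ℒ : ℤ → Submodule K L)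

/-- The relations that define `S_A^• L` as a quotient of the tensor algebra of `A × L` over `K`. -/
inductive SymRel : TensorAlgebra K (A × L) → TensorAlgebra K (A × L) → Prop
  | one : SymRel (TensorAlgebra.ι K (1, 0)) 1
  | mul (a b : A) : SymRel
      (TensorAlgebra.ι K (a, 0) * TensorAlgebra.ι K (b, 0)) (TensorAlgebra.ι K (a * b, 0))
  | smul (a : A) (ξ : L) : SymRel
      (TensorAlgebra.ι K (a, 0) * TensorAlgebra.ι K (0, ξ)) (TensorAlgebra.ι K (0, a • ξ))
  | comm_left {i j : ℤ} {a : A} {ξ : L} (ha : a ∈ 𝒜 i) (hξ : ξ ∈ ℒ j) : SymRel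
      (TensorAlgebra.ι K (a, 0) * TensorAlgebra.ι K (0, ξ))
      ((i * j).negOnePow • (TensorAlgebra.ι K (0, ξ) * TensorAlgebra.ι K (a, 0)))
  | comm {i j : ℤ} {ξ ζ : L} (hξ : ξ ∈ ℒ i) (hζ : ζ ∈ ℒ j) : SymRel
      (TensorAlgebra.ι K (0, ξ) * TensorAlgebra.ι K (0, ζ))
      ((i * j).negOnePow • (TensorAlgebra.ι K (0, ζ) * TensorAlgebra.ι K (0, ξ)))

/-- The graded symmetric algebra `S_A^• L` of the graded `A`-module `L`: the universal graded
commutative algebra generated by the algebra `A` and the `A`-module `L`. -/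
abbrev SymAlg : Type _ := RingQuot (SymRel 𝒜 ℒ)

/-- The map `A → S_A^• L` onto the `0`-tensors. -/
noncomputable def ofA : A →ₗ[K] SymAlg 𝒜 ℒ :=
  (RingQuot.mkAlgHom K (SymRel 𝒜 ℒ)).toLinearMap ∘ₗ TensorAlgebra.ι K ∘ₗ LinearMap.inl K A L

/-- The map `L → S_A^• L` onto the `1`-tensors. -/
noncomputable def ofL : L →ₗ[K] SymAlg 𝒜 ℒ :=
  (RingQuot.mkAlgHom K (SymRel 𝒜 ℒ)).toLinearMap ∘ₗ TensorAlgebra.ι K ∘ₗ LinearMap.inr K A L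

/-- The symmetric tensors of degree `d`: sums of products `a ζ_1 ⋯ ζ_k` of homogeneous elements
with `|a| + |ζ_1| + ⋯ + |ζ_k| = d`. -/
def symDeg (d : ℤ) : Submodule K (SymAlg 𝒜 ℒ) :=
  Submodule.span K {u | ∃ (e : ℤ) (a : A) (k : ℕ) (n : Fin k → ℤ) (ζ : Fin k → L),
    a ∈ 𝒜 e ∧ (∀ i, ζ i ∈ ℒ (n i)) ∧ e + ∑ i, n i = d ∧
      u = ofA 𝒜 ℒ a * (List.ofFn fun i => ofL 𝒜 ℒ (ζ i)).prod}

end SymmetricAlgebra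

/-! ### Insertion of symmetric tensors into symmetric forms -/

section Insertion

variable {K A L P : Type*} [Field K] [Ring A] [Algebra K A] [AddCommGroup L] [Module K L]
  [Module A L] [AddCommGroup P] [Module K P] [Module A P] [IsScalarTower K A P]
  (𝒜 : ℤ → Submodule K A) (ℒ : ℤ → Submodule K L) (𝒲 : ℤ → Submodule K P)

theorem smulForm_mem [GradedCommutative 𝒜] [SetLike.GradedSMul 𝒜 𝒲] {ℓ : ℕ} {d e : ℤ}
    {a : A} (ha : a ∈ 𝒜 e)
    {Ω : MultilinearMap K (fun _ : Fin ℓ => L) P} (h : Ω ∈ symForm 𝒜 ℒ 𝒲 ℓ d) :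
    a • Ω ∈ symForm 𝒜 ℒ 𝒲 ℓ (e + d) := by
  refine ⟨fun n ξ hξ => ?_, fun n ξ hξ σ => ?_, fun n ξ hξ e' a' ha' i => ?_⟩
  · have := SetLike.GradedSMul.smul_mem ha (h.1 n ξ hξ)
    rwa [vadd_eq_add, ← add_assoc] at this
  · rw [_root_.smul_apply, _root_.smul_apply, h.2.1 n ξ hξ σ, smul_comm]
  · rw [_root_.smul_apply, _root_.smul_apply, h.2.2 n ξ hξ e' a' ha' i,
      smul_comm, smul_smul a a', GradedCommutative.comm ha ha', smul_assoc, smul_smul, smul_smul,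
      ← Int.negOnePow_add]
    congr 2
    ring

theorem koszulSign_cons {ℓ : ℕ} (σ : Perm (Fin ℓ)) (e : ℤ) (n : Fin ℓ → ℤ) :
    koszulSign (Equiv.Perm.decomposeFin.symm (0, σ)) (Fin.cons e n) = koszulSign σ n := by
  simp [koszulSign, Fin.prod_univ_succ]

theorem koszulSign_swap {ℓ : ℕ} (i j : ℤ) (n : Fin ℓ → ℤ) :
    koszulSign (Equiv.swap 0 1) (Fin.cons i (Fin.cons j n) : Fin (ℓ + 2) → ℤ) =
      (i * j).negOnePow := by
  have h2 : ∀ k : Fin ℓ, (Equiv.swap 0 1 : Perm (Fin (ℓ + 2))) k.succ.succ = k.succ.succ :=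
    fun k => Equiv.swap_apply_of_ne_of_ne (by simp) (by simp [Fin.ext_iff])
  have h01 : (0 : Fin (ℓ + 2)) < 1 := by simp
  have hs : (Fin.succ 0 : Fin (ℓ + 2)) = 1 := rfl
  have hns : ∀ k : Fin ℓ, ¬ (k.succ.succ : Fin (ℓ + 2)) < 1 := fun k => by simp [Fin.lt_def]
  have hlt : ∀ k k' : Fin ℓ, ¬ (k < k' ∧ k' < k) := fun k k' h => lt_asymm h.1 h.2
  simp only [koszulSign, Fin.prod_univ_succ, hs, h2]
  simp [hns, hlt, mul_comm]

theorem insertForm_mem {ℓ : ℕ} {d e : ℤ} {ξ₀ : L} (hξ₀ : ξ₀ ∈ ℒ e)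
    {Ω : MultilinearMap K (fun _ : Fin (ℓ + 1) => L) P} (h : Ω ∈ symForm 𝒜 ℒ 𝒲 (ℓ + 1) d) :
    (e * d).negOnePow • Ω.curryLeft ξ₀ ∈ symForm 𝒜 ℒ 𝒲 ℓ (e + d) := by
  have hs : Ω.curryLeft ξ₀ ∈ symForm 𝒜 ℒ 𝒲 ℓ (e + d) := by
    have hc : ∀ (n : Fin ℓ → ℤ) (ξ : Fin ℓ → L), (∀ i, ξ i ∈ ℒ (n i)) → ∀ i : Fin (ℓ + 1),
        (Fin.cons ξ₀ ξ : Fin (ℓ + 1) → L) i ∈ ℒ ((Fin.cons e n : Fin (ℓ + 1) → ℤ) i) := by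
      intro n ξ hξ i
      refine Fin.cases ?_ (fun j => ?_) i
      · simpa using hξ₀
      · simpa using hξ j
    refine ⟨fun n ξ hξ => ?_, fun n ξ hξ σ => ?_, fun n ξ hξ e' a' ha' i => ?_⟩
    · have := h.1 _ _ (hc n ξ hξ)
      rw [Fin.sum_univ_succ] at this
      simpa [add_assoc, add_left_comm] using this
    · have := h.2.1 _ _ (hc n ξ hξ) (Equiv.Perm.decomposeFin.symm (0, σ))
      rw [koszulSign_cons] at this
      rw [MultilinearMap.curryLeft_apply, MultilinearMap.curryLeft_apply, ← this]
      congr 1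
      funext i
      refine Fin.cases ?_ (fun j => ?_) i <;> simp
    · have := h.2.2 _ _ (hc n ξ hξ) e' a' ha' i.succ
      rw [Fin.cons_succ, ← Fin.cons_update] at this
      rw [MultilinearMap.curryLeft_apply, MultilinearMap.curryLeft_apply, this]
      congr 3
      rw [Finset.sum_filter, Fin.sum_univ_succ, Finset.sum_filter]
      simp [add_assoc, add_left_comm]
  rcases Int.units_eq_one_or ((e * d).negOnePow) with h1 | h1 <;> rw [h1]
  · simpa using hs
  · simpa using neg_mem hs

/-- The product of a form by a homogeneous `a ∈ A`, `(a Ω)(ξ_1, …) = a Ω(ξ_1, …)`. -/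
noncomputable def smulForm [GradedCommutative 𝒜] [SetLike.GradedSMul 𝒜 𝒲] (e : ℤ) (ℓ : ℕ) (d : ℤ) :
    𝒜 e →ₗ[K] symForm 𝒜 ℒ 𝒲 ℓ d →ₗ[K] symForm 𝒜 ℒ 𝒲 ℓ (e + d) :=
  LinearMap.mk₂ K (fun a Ω => ⟨(a : A) • (Ω : MultilinearMap K _ P), smulForm_mem _ _ _ a.2 Ω.2⟩)
    (fun a a' Ω => Subtype.ext <| by simp [add_smul])
    (fun c a Ω => Subtype.ext <| MultilinearMap.ext fun η => smul_assoc c (a : A) (Ω.1 η))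
    (fun a Ω Ω' => Subtype.ext <| by simp)
    (fun c a Ω => Subtype.ext <| MultilinearMap.ext fun η => smul_comm (a : A) c (Ω.1 η))

/-- The insertion of a homogeneous `ξ ∈ L`, `(i_ξ Ω)(ξ_1, …) = (-1)^{|ξ||Ω|} Ω(ξ, ξ_1, …)`. -/
noncomputable def insertForm (e : ℤ) (ℓ : ℕ) (d : ℤ) :
    ℒ e →ₗ[K] symForm 𝒜 ℒ 𝒲 (ℓ + 1) d →ₗ[K] symForm 𝒜 ℒ 𝒲 ℓ (e + d) :=
  LinearMap.mk₂ K (fun ξ Ω => ⟨(e * d).negOnePow •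
      (Ω : MultilinearMap K (fun _ : Fin (ℓ + 1) => L) P).curryLeft ξ,
      insertForm_mem _ _ _ ξ.2 Ω.2⟩)
    (fun a a' Ω => Subtype.ext <| by simp)
    (fun c a Ω => Subtype.ext <| by simpa using smul_comm _ c _)
    (fun a Ω Ω' => Subtype.ext <| by ext; simp)
    (fun c a Ω => Subtype.ext <| by ext; simpa using smul_comm _ c _)

variable {𝒜 ℒ 𝒲} in
/-- Assemble maps defined on the homogeneous components of a graded space `V` and of
`Sym_A(L, P)` into a linear map from `V` to the operators on `Sym_A(L, P)`. -/
noncomputable def homogOp {V : Type*} [AddCommGroup V] [Module K V] (𝒱 : ℤ → Submodule K V)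
    [Decomposition 𝒱]
    (f : ∀ (e : ℤ) (p : ℕ × ℤ), 𝒱 e →ₗ[K] symForm 𝒜 ℒ 𝒲 p.1 p.2 →ₗ[K] Sym 𝒜 ℒ 𝒲) :
    V →ₗ[K] Module.End K (Sym 𝒜 ℒ 𝒲) :=
  DirectSum.toModule K ℤ _ (fun e =>
    (symLift fun p => (f e p).flip).flip) ∘ₗ
    (decomposeLinearEquiv 𝒱).toLinearMap

variable {𝒜 ℒ 𝒲} in
theorem homogOp_apply {V : Type*} [AddCommGroup V] [Module K V] (𝒱 : ℤ → Submodule K V)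
    [Decomposition 𝒱]
    (f : ∀ (e : ℤ) (p : ℕ × ℤ), 𝒱 e →ₗ[K] symForm 𝒜 ℒ 𝒲 p.1 p.2 →ₗ[K] Sym 𝒜 ℒ 𝒲)
    {e : ℤ} {v : V} (hv : v ∈ 𝒱 e) (ℓ : ℕ) (d : ℤ) (Ω : symForm 𝒜 ℒ 𝒲 ℓ d) :
    homogOp 𝒱 f v (formOf 𝒜 ℒ 𝒲 ℓ d Ω) = f e (ℓ, d) ⟨v, hv⟩ Ω := by
  simp only [homogOp, LinearMap.comp_apply, LinearEquiv.coe_coe, decomposeLinearEquiv_apply]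
  rw [decompose_of_mem 𝒱 hv]
  erw [DirectSum.toModule_lof K e]
  rw [LinearMap.flip_apply, symLift_formOf]
  rfl

/-- The action of `0`-tensors on forms: `i_a Ω = a Ω`. -/
noncomputable def insertA [Decomposition 𝒜] [GradedCommutative 𝒜] [SetLike.GradedSMul 𝒜 𝒲] :
    A →ₗ[K] Module.End K (Sym 𝒜 ℒ 𝒲) :=
  homogOp 𝒜 fun e p => (smulForm 𝒜 ℒ 𝒲 e p.1 p.2).compr₂ (formOf 𝒜 ℒ 𝒲 p.1 (e + p.2))

/-- The insertion of `1`-tensors into forms: `(i_ξ Ω)(ξ_1, …) = (-1)^{|ξ||Ω|} Ω(ξ, ξ_1, …)`, and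
`i_ξ Ω = 0` for a `0`-form `Ω`. -/
noncomputable def insertL [Decomposition ℒ] : L →ₗ[K] Module.End K (Sym 𝒜 ℒ 𝒲) :=
  homogOp ℒ fun e p => match p with
    | (0, _) => 0
    | (ℓ + 1, d) => (insertForm 𝒜 ℒ 𝒲 e ℓ d).compr₂ (formOf 𝒜 ℒ 𝒲 ℓ (e + d))

theorem multilinear_ext [Decomposition ℒ] {ℓ : ℕ}
    {Ω Ω' : MultilinearMap K (fun _ : Fin ℓ => L) P}
    (h : ∀ (n : Fin ℓ → ℤ) (ξ : Fin ℓ → L), (∀ i, ξ i ∈ ℒ (n i)) → Ω ξ = Ω' ξ) : Ω = Ω' := by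
  classical
  ext ξ
  have hξ : ξ = fun k => ∑ j ∈ (decompose ℒ (ξ k)).support, (decompose ℒ (ξ k) j : L) :=
    funext fun k => (sum_support_decompose ℒ (ξ k)).symm
  rw [hξ, MultilinearMap.map_sum_finset, MultilinearMap.map_sum_finset]
  exact Finset.sum_congr rfl fun n _ => h n _ fun i => SetLike.coe_mem _

theorem insertA_apply [Decomposition 𝒜] [GradedCommutative 𝒜] [SetLike.GradedSMul 𝒜 𝒲]
    {e : ℤ} {a : A} (ha : a ∈ 𝒜 e) (ℓ : ℕ) (d : ℤ) (Ω : symForm 𝒜 ℒ 𝒲 ℓ d) :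
    insertA 𝒜 ℒ 𝒲 a (formOf 𝒜 ℒ 𝒲 ℓ d Ω) =
      formOf 𝒜 ℒ 𝒲 ℓ (e + d) (smulForm 𝒜 ℒ 𝒲 e ℓ d ⟨a, ha⟩ Ω) :=
  homogOp_apply 𝒜 _ ha ℓ d Ω

theorem insertL_zero [Decomposition ℒ] {e : ℤ} {ξ : L} (hξ : ξ ∈ ℒ e) (d : ℤ)
    (Ω : symForm 𝒜 ℒ 𝒲 0 d) : insertL 𝒜 ℒ 𝒲 ξ (formOf 𝒜 ℒ 𝒲 0 d Ω) = 0 :=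
  homogOp_apply ℒ _ hξ 0 d Ω

theorem insertL_succ [Decomposition ℒ] {e : ℤ} {ξ : L} (hξ : ξ ∈ ℒ e) (ℓ : ℕ) (d : ℤ)
    (Ω : symForm 𝒜 ℒ 𝒲 (ℓ + 1) d) :
    insertL 𝒜 ℒ 𝒲 ξ (formOf 𝒜 ℒ 𝒲 (ℓ + 1) d Ω) =
      formOf 𝒜 ℒ 𝒲 ℓ (e + d) (insertForm 𝒜 ℒ 𝒲 e ℓ d ⟨ξ, hξ⟩ Ω) :=
  homogOp_apply ℒ _ hξ (ℓ + 1) d Ω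

theorem formOf_congr {ℓ : ℕ} {d d' : ℤ} (hd : d = d') {Ω : symForm 𝒜 ℒ 𝒲 ℓ d}
    {Ω' : symForm 𝒜 ℒ 𝒲 ℓ d'}
    (h : (Ω : MultilinearMap K (fun _ : Fin ℓ => L) P) = Ω') :
    formOf 𝒜 ℒ 𝒲 ℓ d Ω = formOf 𝒜 ℒ 𝒲 ℓ d' Ω' := by
  subst hd
  rw [Subtype.ext h]

variable [GradedAlgebra 𝒜] [GradedCommutative 𝒜] [Decomposition ℒ] [SetLike.GradedSMul 𝒜 ℒ]
  [SetLike.GradedSMul 𝒜 𝒲]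

theorem insertA_one : insertA 𝒜 ℒ 𝒲 1 = 1 := by
  refine sym_ext fun ℓ d Ω => ?_
  rw [insertA_apply _ _ _ (SetLike.GradedOne.one_mem (A := 𝒜))]
  exact formOf_congr _ _ _ (zero_add d) (one_smul A Ω.1)

theorem insertA_mul (a b : A) :
    insertA 𝒜 ℒ 𝒲 a * insertA 𝒜 ℒ 𝒲 b = insertA 𝒜 ℒ 𝒲 (a * b) := by
  induction a using Decomposition.inductionOn 𝒜 with
  | zero => simp
  | add x y hx hy => rw [map_add, add_mul, hx, hy, add_mul, map_add]
  | @homogeneous i a =>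
    induction b using Decomposition.inductionOn 𝒜 with
    | zero => simp
    | add x y hx hy => rw [map_add, mul_add, hx, hy, mul_add, map_add]
    | @homogeneous j b =>
      refine sym_ext fun ℓ d Ω => ?_
      rw [Module.End.mul_apply, insertA_apply _ _ _ b.2, insertA_apply _ _ _ a.2,
        insertA_apply _ _ _ (SetLike.GradedMul.mul_mem a.2 b.2)]
      exact formOf_congr _ _ _ (add_assoc i j d).symm (smul_smul (a : A) (b : A) Ω.1)

theorem insertA_insertL (a : A) (ξ : L) :
    insertA 𝒜 ℒ 𝒲 a * insertL 𝒜 ℒ 𝒲 ξ = insertL 𝒜 ℒ 𝒲 (a • ξ) := by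
  induction a using Decomposition.inductionOn 𝒜 with
  | zero => simp
  | add x y hx hy => rw [map_add, add_mul, hx, hy, add_smul, map_add]
  | @homogeneous i a =>
    induction ξ using Decomposition.inductionOn ℒ with
    | zero => simp
    | add x y hx hy => rw [map_add, mul_add, hx, hy, smul_add, map_add]
    | @homogeneous j ξ =>
      have hs : (a : A) • (ξ : L) ∈ ℒ (i + j) := SetLike.GradedSMul.smul_mem a.2 ξ.2
      refine sym_ext fun ℓ d Ω => ?_
      rw [Module.End.mul_apply]
      cases ℓ with
      | zero => rw [insertL_zero _ _ _ ξ.2, insertL_zero _ _ _ hs, map_zero]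
      | succ ℓ =>
        rw [insertL_succ _ _ _ ξ.2, insertL_succ _ _ _ hs, insertA_apply _ _ _ a.2]
        refine formOf_congr _ _ _ (add_assoc i j d).symm ?_
        refine multilinear_ext ℒ fun n η hη => ?_
        have := Ω.2.2.2 (Fin.cons j n) (Fin.cons (ξ : L) η)
          (fun k => Fin.cases (by simp) (fun k => by simpa using hη k) k) i a a.2 0
        rw [Fin.cons_zero, Fin.update_cons_zero] at this
        simp only [smulForm, insertForm, LinearMap.mk₂_apply, _root_.smul_apply,
          MultilinearMap.curryLeft_apply, this]
        have hsgn : ((i + j) * d + i * d).negOnePow = (j * d).negOnePow := by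
          rw [Int.negOnePow_eq_iff]
          exact ⟨i * d, by ring⟩
        simp only [Fin.not_lt_zero, Finset.filter_false, Finset.sum_empty, add_zero]
        rw [smul_smul, ← Int.negOnePow_add, hsgn, smul_comm]

theorem insertA_insertL_comm {i j : ℤ} {a : A} {ξ : L} (ha : a ∈ 𝒜 i) (hξ : ξ ∈ ℒ j) :
    insertA 𝒜 ℒ 𝒲 a * insertL 𝒜 ℒ 𝒲 ξ =
      (i * j).negOnePow • (insertL 𝒜 ℒ 𝒲 ξ * insertA 𝒜 ℒ 𝒲 a) := by
  refine sym_ext fun ℓ d Ω => ?_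
  rw [Units.smul_def, LinearMap.smul_apply, Module.End.mul_apply, Module.End.mul_apply,
    insertA_apply _ _ _ ha]
  cases ℓ with
  | zero => rw [insertL_zero _ _ _ hξ, insertL_zero _ _ _ hξ, map_zero, smul_zero]
  | succ ℓ =>
    rw [insertL_succ _ _ _ hξ, insertL_succ _ _ _ hξ, insertA_apply _ _ _ ha]
    refine Eq.trans ?_ (map_zsmul (formOf 𝒜 ℒ 𝒲 ℓ (j + (i + d))) _ _)
    refine formOf_congr _ _ _ (add_left_comm i j d) ?_
    have hsgn : (i * j + j * (i + d)).negOnePow = (j * d).negOnePow := by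
      rw [Int.negOnePow_eq_iff]
      exact ⟨i * j, by ring⟩
    ext η
    have h : a • (j * d).negOnePow • Ω.1 (Fin.cons ξ η) =
        (i * j).negOnePow • (j * (i + d)).negOnePow • a • Ω.1 (Fin.cons ξ η) := by
      rw [smul_smul, ← Int.negOnePow_add, hsgn, smul_comm]
    exact h

theorem insertL_comm {i j : ℤ} {ξ ζ : L} (hξ : ξ ∈ ℒ i) (hζ : ζ ∈ ℒ j) :
    insertL 𝒜 ℒ 𝒲 ξ * insertL 𝒜 ℒ 𝒲 ζ =
      (i * j).negOnePow • (insertL 𝒜 ℒ 𝒲 ζ * insertL 𝒜 ℒ 𝒲 ξ) := by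
  refine sym_ext fun ℓ d Ω => ?_
  rw [Units.smul_def, LinearMap.smul_apply, Module.End.mul_apply, Module.End.mul_apply]
  match ℓ, Ω with
  | 0, Ω => rw [insertL_zero _ _ _ hξ, insertL_zero _ _ _ hζ, map_zero, map_zero, smul_zero]
  | 1, Ω =>
    rw [insertL_succ _ _ _ hξ, insertL_succ _ _ _ hζ, insertL_zero _ _ _ hξ,
      insertL_zero _ _ _ hζ, smul_zero]
  | ℓ + 2, Ω =>
    rw [insertL_succ _ _ _ hξ, insertL_succ _ _ _ hζ, insertL_succ _ _ _ hξ,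
      insertL_succ _ _ _ hζ]
    refine Eq.trans ?_ (map_zsmul (formOf 𝒜 ℒ 𝒲 ℓ (j + (i + d))) _ _)
    refine formOf_congr _ _ _ (add_left_comm i j d) ?_
    refine multilinear_ext ℒ fun n η hη => ?_
    have := Ω.2.2.1 (Fin.cons i (Fin.cons j n)) (Fin.cons ξ (Fin.cons ζ η))
      (fun k => Fin.cases (by simpa using hξ)
        (fun k => Fin.cases (by simpa using hζ) (fun k => by simpa using hη k) k) k)
      (Equiv.swap 0 1)
    have hk : koszulSign (Equiv.swap 0 1) (Fin.cons i (Fin.cons j n)) = (i * j).negOnePow :=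
      koszulSign_swap i j n
    have hf : (fun k => (Fin.cons ξ (Fin.cons ζ η) : Fin (ℓ + 2) → L) (Equiv.swap 0 1 k)) =
        Fin.cons ζ (Fin.cons ξ η) := by
      funext k
      refine Fin.cases ?_ (fun k => Fin.cases ?_ (fun k => ?_) k) k
      · simp
      · simp
      · rw [Equiv.swap_apply_of_ne_of_ne (by simp) (by simp [Fin.ext_iff])]
        simp
    rw [hk, hf] at this
    have h : (i * (j + d)).negOnePow • (j * d).negOnePow •
          Ω.1 (Fin.cons ζ (Fin.cons ξ η)) =
        (i * j).negOnePow • (j * (i + d)).negOnePow • (i * d).negOnePow •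
          Ω.1 (Fin.cons ξ (Fin.cons ζ η)) := by
      rw [this, smul_smul, smul_smul, smul_smul, smul_smul, ← Int.negOnePow_add,
        ← Int.negOnePow_add, ← Int.negOnePow_add, ← Int.negOnePow_add]
      congr 1
      rw [Int.negOnePow_eq_iff]
      exact ⟨0, by ring⟩
    exact h

theorem insertion_rel : ∀ ⦃x y : TensorAlgebra K (A × L)⦄, SymRel 𝒜 ℒ x y →
    TensorAlgebra.lift K ((insertA 𝒜 ℒ 𝒲).coprod (insertL 𝒜 ℒ 𝒲)) x =
      TensorAlgebra.lift K ((insertA 𝒜 ℒ 𝒲).coprod (insertL 𝒜 ℒ 𝒲)) y := by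
  intro x y h
  cases h with
  | one => simp [insertA_one]
  | mul a b => simp [insertA_mul]
  | smul a ξ => simp [insertA_insertL]
  | comm_left ha hξ =>
    rw [Units.smul_def, map_zsmul, ← Units.smul_def]
    simpa only [map_mul, TensorAlgebra.lift_ι_apply, LinearMap.coprod_apply, map_zero, zero_add,
      add_zero] using insertA_insertL_comm 𝒜 ℒ 𝒲 ha hξ
  | comm hξ hζ =>
    rw [Units.smul_def, map_zsmul, ← Units.smul_def]
    simpa only [map_mul, TensorAlgebra.lift_ι_apply, LinearMap.coprod_apply, map_zero, zero_add,
      add_zero] using insertL_comm 𝒜 ℒ 𝒲 hξ hζ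

/-- The `S_A^• L`-module structure `u ↦ i_u` of `Sym_A(L, P)`: on generators it is given by
`i_a Ω = a Ω` and `(i_ξ Ω)(ξ_1, …) = (-1)^{|ξ||Ω|} Ω(ξ, ξ_1, …)`, so that for `u = ζ_1 ⋯ ζ_k` and
`Ω` an `ℓ`-form, `(i_u Ω)(ξ_1, …, ξ_{ℓ-k}) = (-1)^{|u||Ω|} Ω(ζ_1, …, ζ_k, ξ_1, …, ξ_{ℓ-k})`. -/
noncomputable def insertion : SymAlg 𝒜 ℒ →ₐ[K] Module.End K (Sym 𝒜 ℒ 𝒲) :=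
  RingQuot.liftAlgHom K
    ⟨TensorAlgebra.lift K ((insertA 𝒜 ℒ 𝒲).coprod (insertL 𝒜 ℒ 𝒲)), insertion_rel 𝒜 ℒ 𝒲⟩

end Insertion

/-! ### The Chevalley-Eilenberg operators of a connection -/

section ChevalleyEilenberg

variable {K A L P : Type*} [Field K] [Ring A] [Algebra K A] [AddCommGroup L] [Module K L]
  [Module A L] [AddCommGroup P] [Module K P] [Module A P] [IsScalarTower K A P]
  {𝒜 : ℤ → Submodule K A} {ℒ : ℤ → Submodule K L} {𝒲 : ℤ → Submodule K P}

/-- The sum `∑_{τ ∈ S_{m+1,ℓ-1}} α(τ, ξ) Ω(X(ξ_{τ 0}, …, ξ_{τ m}), ξ_{τ (m+1)}, …)` over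
`ξ = (ξ_0, …, ξ_{m+ℓ-1})` homogeneous of degrees `n`; it is empty for `ℓ = 0`. -/
def ceBracketSum (𝕏 : LRInfinity 𝒜 ℒ) (m : ℕ) :
    ∀ (ℓ : ℕ), MultilinearMap K (fun _ : Fin ℓ => L) P → (Fin (m + ℓ) → ℤ) → (Fin (m + ℓ) → L) → P
  | 0, _, _, _ => 0
  | ℓ + 1, Ω, n, ξ =>
    have h : m + 1 + ℓ = m + (ℓ + 1) := by omega
    unshuffleSum (m + 1) ℓ (n ∘ Fin.cast h) (ξ ∘ Fin.cast h)
      fun _ ξ₁ ξ₂ => Ω (Fin.cons (𝕏.X m ξ₁) ξ₂)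

/-- The higher Chevalley-Eilenberg formula for `(D_{m+1}^∇ Ω)(ξ_0, …, ξ_{m+ℓ-1})`, with `Ω` an
`ℓ`-form of degree `d` and `ξ` homogeneous of degrees `n`:
`∑_{σ ∈ S_{m,ℓ}} (-1)^χ α(σ, ξ) ∇(ξ_{σ 0}, …, ξ_{σ (m-1)} | Ω(ξ_{σ m}, …))
- (-1)^{|Ω|} ∑_{τ ∈ S_{m+1,ℓ-1}} α(τ, ξ) Ω(X(ξ_{τ 0}, …, ξ_{τ m}), ξ_{τ (m+1)}, …)`,
where `χ = |Ω| (|ξ_{σ 0}| + ⋯ + |ξ_{σ (m-1)}|)`. -/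
def ceFormula {𝕏 : LRInfinity 𝒜 ℒ} (nabla : LeftConnection 𝕏 𝒲) (m ℓ : ℕ) (d : ℤ)
    (Ω : MultilinearMap K (fun _ : Fin ℓ => L) P) (n : Fin (m + ℓ) → ℤ) (ξ : Fin (m + ℓ) → L) : P :=
  unshuffleSum m ℓ n ξ
      (fun n₁ ξ₁ ξ₂ => (d * ∑ i, n₁ i).negOnePow • nabla.conn m ξ₁ (Ω ξ₂)) -
    d.negOnePow • ceBracketSum 𝕏 m ℓ Ω n ξ

/-- `D` is the Chevalley-Eilenberg operator `D_{m+1}^∇` on `Sym_A(L, P)`: it maps an `ℓ`-form of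
degree `d` to the `(m + ℓ)`-form of degree `1 + d` given by the higher Chevalley-Eilenberg
formula. -/
def IsCEOperator {𝕏 : LRInfinity 𝒜 ℒ} (nabla : LeftConnection 𝕏 𝒲) (m : ℕ)
    (D : Module.End K (Sym 𝒜 ℒ 𝒲)) : Prop :=
  ∀ (ℓ : ℕ) (d : ℤ) (Ω : symForm 𝒜 ℒ 𝒲 ℓ d), ∃ Ω' : symForm 𝒜 ℒ 𝒲 (m + ℓ) (1 + d),
    D (formOf 𝒜 ℒ 𝒲 ℓ d Ω) = formOf 𝒜 ℒ 𝒲 (m + ℓ) (1 + d) Ω' ∧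
    ∀ (n : Fin (m + ℓ) → ℤ) (ξ : Fin (m + ℓ) → L), (∀ i, ξ i ∈ ℒ (n i)) →
      Ω'.1 ξ = ceFormula nabla m ℓ d Ω.1 n ξ

/-- `Λ` is the bracket `{u_0, …, u_m}` with `m + 1` entries of the `P_∞[1]` algebra `S_A^• L`, that
is, the multiderivation of `S_A^• L` which extends the component `𝕏_{m+1}` of the structure
multiderivation. It is determined by the bracket on `L`, by the anchor, and by vanishing as soon as
two entries are in `A`. -/
structure IsTensorBracket (𝕏 : LRInfinity 𝒜 ℒ) (m : ℕ)
    (Λ : MultilinearMap K (fun _ : Fin (m + 1) => SymAlg 𝒜 ℒ) (SymAlg 𝒜 ℒ)) : Prop where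
  degree : HasDegree (symDeg 𝒜 ℒ) (symDeg 𝒜 ℒ) 1 Λ
  symm : IsGradedSymm (symDeg 𝒜 ℒ) Λ
  leibniz : ∀ (n : Fin m → ℤ) (u : Fin m → SymAlg 𝒜 ℒ), (∀ i, u i ∈ symDeg 𝒜 ℒ (n i)) →
    ∀ (e : ℤ) (v w : SymAlg 𝒜 ℒ), v ∈ symDeg 𝒜 ℒ e →
      Λ (Fin.snoc (α := fun _ => SymAlg 𝒜 ℒ) u (v * w)) =
        ((1 + ∑ i, n i) * e).negOnePow • (v * Λ (Fin.snoc (α := fun _ => SymAlg 𝒜 ℒ) u w)) +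
          Λ (Fin.snoc (α := fun _ => SymAlg 𝒜 ℒ) u v) * w
  bracket : ∀ ξ : Fin (m + 1) → L, Λ (fun i => ofL 𝒜 ℒ (ξ i)) = ofL 𝒜 ℒ (𝕏.X m ξ)
  anchor : ∀ (ξ : Fin m → L) (a : A),
    Λ (Fin.snoc (α := fun _ => SymAlg 𝒜 ℒ) (fun i => ofL 𝒜 ℒ (ξ i)) (ofA 𝒜 ℒ a)) =
      ofA 𝒜 ℒ (𝕏.σ m ξ a)
  vanish : ∀ (u : Fin (m + 1) → SymAlg 𝒜 ℒ) (i j : Fin (m + 1)), i ≠ j →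
    u i ∈ LinearMap.range (ofA 𝒜 ℒ) → u j ∈ LinearMap.range (ofA 𝒜 ℒ) → Λ u = 0

end ChevalleyEilenberg

/-! ### Graded commutators and differential operators -/

section DifferentialOperators

variable {K B R : Type*} [Field K] [Ring B] [Algebra K B] [AddCommGroup R] [Module K R]

/-- The graded commutator `[F, G] = F G - (-1)^{d e} G F` of operators of degrees `d` and `e`. -/
def gradedComm (d e : ℤ) (F G : Module.End K R) : Module.End K R :=
  F * G - (d * e).negOnePow • (G * F)

/-- The nested graded commutator `[⋯[[F, G_0], G_1]⋯, G_{k-1}]`, where `F` has degree `f` and `G_i`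
has degree `n i`. -/
def nestedComm (F : Module.End K R) (f : ℤ) :
    ∀ k : ℕ, (Fin k → ℤ) → (Fin k → Module.End K R) → Module.End K R
  | 0, _, _ => F
  | k + 1, n, G =>
    gradedComm (f + ∑ i : Fin k, n i.castSucc) (n (Fin.last k))
      (nestedComm F f k (fun i => n i.castSucc) (fun i => G i.castSucc)) (G (Fin.last k))

/-- The operator `F`, of degree `f`, is a differential operator of order `k` in the graded module
`R` (with structure map `ρ`) over the graded commutative algebra `B`. -/
def IsDiffOp (ℬ : ℤ → Submodule K B) (ρ : B →ₐ[K] Module.End K R) (F : Module.End K R) (f : ℤ)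
    (k : ℕ) : Prop :=
  ∀ (n : Fin (k + 1) → ℤ) (b : Fin (k + 1) → B), (∀ i, b i ∈ ℬ (n i)) →
    nestedComm F f (k + 1) n (fun i => ρ (b i)) = 0

end DifferentialOperators

end SHLR

set_option linter.unusedSectionVars false

namespace SHLR
open Equiv DirectSum

/-! Both sides of (1) are functions of `u_1, …, u_k` with values in the operators on forms, and both
are graded symmetric multiderivations along `u ↦ i_u`. For the bracket this is part of its
definition. For the nested commutator it holds whatever the operator is (`isMultiDer_nest`): `[F,
i_{xy}]` obeys a Leibniz rule, and since insertions supercommute, iterated commutators are symmetric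
and linear over the insertions. Multiderivations that agree on generators are equal
(`IsMultiDer.ext_gens`), so (1) has to be checked only for entries in `L` and `A`.

That check rests on a closure property. Say that an operator is of Chevalley-Eilenberg type if it is
given by the Chevalley-Eilenberg formula for some operators `N` on `P` and some bracket `X` with
values in `L` (`Realizes`). In the commutator with `i_ξ` the terms where `ξ` remains an argument of
the form cancel, and an operator of the same type is left, with data `-N(ξ, …)` and `-X(ξ, …)`
(`Realizes.comm_insertL`). The commutator with `a ∈ A` kills `X` and replaces `N` by its failure to
be `A`-linear, which for a connection is multiplication by the anchor (`Realizes.comm_insertA`).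
After `k` entries from `L` nothing is left of `N` and `X` has become the constant `± X_k(ξ_1, …,
ξ_k)`, so the operator is an insertion. With one entry from `A` it is multiplication by `± σ_k(ξ_1,
… | a)`. With two it is zero, because `A` is graded commutative. Then (2) follows, since the
`k`-fold commutator is an insertion and insertions supercommute.

The operator exists because the Chevalley-Eilenberg formula yields graded `A`-multilinear forms: the
anchor terms coming from the connection and from the bracket cancel (`ceTerm_smul_cons`).

The bracket is built by induction on the number of entries (`exists_isExtension`). With all entries
but the first fixed, it is a sign-twisted derivation of `S_A L`. Such derivations are algebra
homomorphisms into upper triangular `2 × 2` matrices, hence are supplied by the universal property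
(`exists_twistedDerivation`); the relations to verify are identities between multiderivations in the
remaining entries, again checked on generators.

Throughout, unshuffle sums are replaced by sums over the splittings of a list of pairs (degree,
element), which satisfy a recursion on the first entry (`unshuffleSum_eq_splitSum`). -/

theorem negOnePow_congr {m n : ℤ} (h : Even (m - n)) : m.negOnePow = n.negOnePow :=
  (Int.negOnePow_eq_iff m n).2 h

/-! ### Functions of lists of homogeneous elements -/

section Degree

variable {M : Type*}

/-- The total degree of a list of elements with prescribed degrees. -/
def dg (l : List (ℤ × M)) : ℤ := (l.map Prod.fst).sum

@[simp] theorem dg_nil : dg ([] : List (ℤ × M)) = 0 := rfl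

@[simp] theorem dg_cons (h : ℤ × M) (l : List (ℤ × M)) : dg (h :: l) = h.1 + dg l := by
  simp [dg]

@[simp] theorem dg_append (l r : List (ℤ × M)) : dg (l ++ r) = dg l + dg r := by
  simp [dg]

theorem dg_ofFn {k : ℕ} (n : Fin k → ℤ) (ξ : Fin k → M) :
    dg (List.ofFn fun i => (n i, ξ i)) = ∑ i, n i := by
  simp [dg, List.map_ofFn, List.sum_ofFn]

end Degree

section Lists

variable {K M N : Type*} [Field K] [AddCommGroup M] [Module K M] [AddCommGroup N] [Module K N]

/-- Every entry of a list of elements with prescribed degrees is homogeneous of its degree. -/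
def Homog (ℳ : ℤ → Submodule K M) (l : List (ℤ × M)) : Prop := ∀ h ∈ l, h.2 ∈ ℳ h.1

variable (ℳ : ℤ → Submodule K M)

@[simp] theorem homog_nil : Homog ℳ [] := by simp [Homog]

@[simp] theorem homog_cons (h : ℤ × M) (l : List (ℤ × M)) :
    Homog ℳ (h :: l) ↔ h.2 ∈ ℳ h.1 ∧ Homog ℳ l := by simp [Homog]

@[simp] theorem homog_append (l r : List (ℤ × M)) :
    Homog ℳ (l ++ r) ↔ Homog ℳ l ∧ Homog ℳ r := by
  simp [Homog, or_imp, forall_and]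

theorem homog_ofFn {k : ℕ} {n : Fin k → ℤ} {ξ : Fin k → M} :
    Homog ℳ (List.ofFn fun i => (n i, ξ i)) ↔ ∀ i, ξ i ∈ ℳ (n i) := by
  simp [Homog, List.mem_ofFn]

theorem exists_eq_ofFn {k : ℕ} {l : List (ℤ × M)} (hk : l.length = k) :
    ∃ (n : Fin k → ℤ) (ξ : Fin k → M), l = List.ofFn fun i => (n i, ξ i) := by
  subst hk
  exact ⟨fun i => (l.get i).1, fun i => (l.get i).2, (List.ofFn_get l).symm⟩

/-- A function of lists of length `k` of homogeneous elements is linear in every entry. -/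
structure SlotLinear (k : ℕ) (f : List (ℤ × M) → N) : Prop where
  add : ∀ (l r : List (ℤ × M)) (e : ℤ) (x y : M), l.length + r.length + 1 = k →
    Homog ℳ l → Homog ℳ r → x ∈ ℳ e → y ∈ ℳ e →
      f (l ++ (e, x + y) :: r) = f (l ++ (e, x) :: r) + f (l ++ (e, y) :: r)
  smul : ∀ (l r : List (ℤ × M)) (e : ℤ) (c : K) (x : M), l.length + r.length + 1 = k →
    Homog ℳ l → Homog ℳ r → x ∈ ℳ e → f (l ++ (e, c • x) :: r) = c • f (l ++ (e, x) :: r)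

/-- A function of lists of length `k` of homogeneous elements is graded symmetric under the
exchange of adjacent entries. -/
def SwapSymm (k : ℕ) (f : List (ℤ × M) → N) : Prop :=
  ∀ (l : List (ℤ × M)) (h h' : ℤ × M) (r : List (ℤ × M)), l.length + r.length + 2 = k →
    Homog ℳ l → h.2 ∈ ℳ h.1 → h'.2 ∈ ℳ h'.1 → Homog ℳ r →
      f (l ++ h :: h' :: r) = (h.1 * h'.1).negOnePow • f (l ++ h' :: h :: r)

variable {ℳ}

theorem SlotLinear.cons {k : ℕ} {f : List (ℤ × M) → N} (hf : SlotLinear ℳ (k + 1) f)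
    {h : ℤ × M} (hh : h.2 ∈ ℳ h.1) : SlotLinear ℳ k (fun l => f (h :: l)) :=
  ⟨fun l r e x y hk hl hr hx hy => hf.add (h :: l) r e x y (by simp; omega) (by simp [hh, hl])
      hr hx hy,
    fun l r e c x hk hl hr hx => hf.smul (h :: l) r e c x (by simp; omega) (by simp [hh, hl])
      hr hx⟩

theorem SwapSymm.cons {k : ℕ} {f : List (ℤ × M) → N} (hf : SwapSymm ℳ (k + 1) f)
    {h : ℤ × M} (hh : h.2 ∈ ℳ h.1) : SwapSymm ℳ k (fun l => f (h :: l)) :=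
  fun l h₁ h₂ r hk hl h1 h2 hr =>
    hf (h :: l) h₁ h₂ r (by simp; omega) (by simp [hh, hl]) h1 h2 hr

theorem SwapSymm.move_front {k : ℕ} {f : List (ℤ × M) → N} (hf : SwapSymm ℳ k f)
    {h : ℤ × M} (hh : h.2 ∈ ℳ h.1) (l r : List (ℤ × M)) (hk : l.length + r.length + 1 = k)
    (hl : Homog ℳ l) (hr : Homog ℳ r) :
    f (l ++ h :: r) = (h.1 * dg l).negOnePow • f (h :: (l ++ r)) := by
  -- The last entry of `l` is the first one that `h` has to cross.
  induction l using List.reverseRecOn generalizing r with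
  | nil => simp
  | append_singleton l x ih =>
    rw [homog_append, homog_cons] at hl
    rw [List.append_assoc, List.singleton_append,
      hf l x h r (by simp at hk; omega) hl.1 hl.2.1 hh hr,
      ih (x :: r) (by simp at hk ⊢; omega) hl.1 (by simp [hl.2.1, hr]), smul_smul,
      ← Int.negOnePow_add]
    simp only [dg_append, dg_cons, dg_nil, List.append_assoc, List.singleton_append]
    rw [negOnePow_congr]
    grind

theorem SwapSymm.smul_unit {k : ℕ} {f : List (ℤ × M) → N} (hf : SwapSymm ℳ k f) (c : ℤˣ) :
    SwapSymm ℳ k (fun l => c • f l) := fun l h h' r hk hl h1 h2 hr => by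
  simp only [hf l h h' r hk hl h1 h2 hr, smul_comm c]

/-- The degree is an argument of `g` because signs depend on it. Only zero lies in several degrees,
and there `smul` with `c = 0` forces `g e 0 = 0`, so no conflict arises. -/
theorem exists_linearMap_of_homog [Decomposition ℳ] (g : ℤ → M → N)
    (add : ∀ e x y, x ∈ ℳ e → y ∈ ℳ e → g e (x + y) = g e x + g e y)
    (smul : ∀ e (c : K) x, x ∈ ℳ e → g e (c • x) = c • g e x) :
    ∃ φ : M →ₗ[K] N, ∀ e x, x ∈ ℳ e → φ x = g e x := by
  let ψ : ∀ e, ℳ e →ₗ[K] N := fun e =>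
    { toFun := fun x => g e x
      map_add' := fun x y => add e x y x.2 y.2
      map_smul' := fun c x => smul e c x x.2 }
  refine ⟨DirectSum.toModule K ℤ N ψ ∘ₗ (decomposeLinearEquiv ℳ).toLinearMap, fun e x hx => ?_⟩
  simp only [LinearMap.comp_apply, LinearEquiv.coe_coe, decomposeLinearEquiv_apply]
  rw [decompose_of_mem ℳ hx]
  erw [DirectSum.toModule_lof K e]
  rfl

theorem exists_multilinearMap_of_slotLinear [Decomposition ℳ] {k : ℕ} {f : List (ℤ × M) → N}
    (hf : SlotLinear ℳ k f) : ∃ Ω : MultilinearMap K (fun _ : Fin k => M) N,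
      ∀ (n : Fin k → ℤ) (ξ : Fin k → M), (∀ i, ξ i ∈ ℳ (n i)) →
        Ω ξ = f (List.ofFn fun i => (n i, ξ i)) := by
  induction k generalizing f with
  | zero => exact ⟨MultilinearMap.constOfIsEmpty K _ (f []), fun n ξ _ => by simp⟩
  | succ k ih =>
    -- The membership `x ∈ ℳ e` is moved behind the existential, with default value `0`, so that
    -- `choose` yields a function defined for all `e` and `x`, to which `exists_linearMap_of_homog`
    -- applies with values in multilinear maps.
    have hΩ : ∀ e x, ∃ Ω : MultilinearMap K (fun _ : Fin k => M) N, x ∈ ℳ e →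
        ∀ (n : Fin k → ℤ) (ξ : Fin k → M), (∀ i, ξ i ∈ ℳ (n i)) →
          Ω ξ = f ((e, x) :: List.ofFn fun i => (n i, ξ i)) := by
      intro e x
      by_cases hx : x ∈ ℳ e
      · obtain ⟨Ω, h⟩ := ih (hf.cons (h := (e, x)) hx)
        exact ⟨Ω, fun _ => h⟩
      · exact ⟨0, fun h => absurd h hx⟩
    choose Ω hΩ using hΩ
    obtain ⟨φ, hφ⟩ := exists_linearMap_of_homog (ℳ := ℳ) Ω
      (fun e x y hx hy => multilinear_ext ℳ fun n ξ hξ => by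
        rw [_root_.add_apply, hΩ _ _ hx n ξ hξ, hΩ _ _ hy n ξ hξ,
          hΩ _ _ (add_mem hx hy) n ξ hξ]
        exact hf.add [] _ e x y (by simp) (by simp) ((homog_ofFn ℳ).2 hξ) hx hy)
      (fun e c x hx => multilinear_ext ℳ fun n ξ hξ => by
        rw [_root_.smul_apply, hΩ _ _ hx n ξ hξ,
          hΩ _ _ (Submodule.smul_mem _ c hx) n ξ hξ]
        exact hf.smul [] _ e c x (by simp) (by simp) ((homog_ofFn ℳ).2 hξ) hx)
    refine ⟨φ.uncurryLeft, fun n ξ hξ => ?_⟩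
    rw [LinearMap.uncurryLeft_apply, hφ _ _ (hξ 0), List.ofFn_succ]
    exact hΩ _ _ (hξ 0) (fun i => n i.succ) _ fun i => hξ i.succ

/-- The values of a multilinear map on lists; it vanishes on lists of the wrong length. -/
def lf : ∀ {k : ℕ}, MultilinearMap K (fun _ : Fin k => M) N → List (ℤ × M) → N
  | 0, Ω, [] => Ω Fin.elim0
  | 0, _, _ :: _ => 0
  | _ + 1, _, [] => 0
  | _ + 1, Ω, h :: l => lf (Ω.curryLeft h.2) l

theorem lf_succ_cons {k : ℕ} (Ω : MultilinearMap K (fun _ : Fin (k + 1) => M) N) (h : ℤ × M)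
    (l : List (ℤ × M)) : lf Ω (h :: l) = lf (Ω.curryLeft h.2) l := rfl

theorem lf_zero_cons (Ω : MultilinearMap K (fun _ : Fin 0 => M) N) (h : ℤ × M)
    (l : List (ℤ × M)) : lf Ω (h :: l) = 0 := rfl

theorem lf_ofFn {k : ℕ} (Ω : MultilinearMap K (fun _ : Fin k => M) N) (n : Fin k → ℤ)
    (ξ : Fin k → M) : lf Ω (List.ofFn fun i => (n i, ξ i)) = Ω ξ := by
  induction k with
  | zero => simp only [List.ofFn_zero, lf]; congr; funext i; exact i.elim0
  | succ k ih =>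
    rw [List.ofFn_succ, lf_succ_cons, ih, MultilinearMap.curryLeft_apply]
    exact congrArg Ω (Fin.cons_self_tail ξ)

theorem lf_of_length_ne {k : ℕ} (Ω : MultilinearMap K (fun _ : Fin k => M) N)
    {l : List (ℤ × M)} (h : l.length ≠ k) : lf Ω l = 0 := by
  induction k generalizing l with
  | zero => cases l with
    | nil => simp at h
    | cons => rfl
  | succ k ih => cases l with
    | nil => rfl
    | cons => exact ih _ (by simpa using h)

theorem lf_add {k : ℕ} (Ω Ω' : MultilinearMap K (fun _ : Fin k => M) N) (l : List (ℤ × M)) :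
    lf (Ω + Ω') l = lf Ω l + lf Ω' l := by
  induction k generalizing l with
  | zero => cases l <;> simp [lf]
  | succ k ih => cases l with
    | nil => simp [lf]
    | cons h l => simp only [lf_succ_cons]; rw [← ih]; rfl

theorem lf_smul {R : Type*} [Monoid R] [DistribMulAction R N] [SMulCommClass K R N] {k : ℕ}
    (c : R) (Ω : MultilinearMap K (fun _ : Fin k => M) N)
    (l : List (ℤ × M)) : lf (c • Ω) l = c • lf Ω l := by
  induction k generalizing l with
  | zero => cases l <;> simp [lf]
  | succ k ih => cases l with
    | nil => simp [lf]
    | cons h l => simp only [lf_succ_cons]; rw [← ih]; rfl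

theorem lf_append_add {k : ℕ} (Ω : MultilinearMap K (fun _ : Fin k => M) N)
    (l r : List (ℤ × M)) (e : ℤ) (x y : M) :
    lf Ω (l ++ (e, x + y) :: r) = lf Ω (l ++ (e, x) :: r) + lf Ω (l ++ (e, y) :: r) := by
  induction l generalizing k with
  | nil => cases k with
    | zero => simp [lf_zero_cons]
    | succ k => simp only [List.nil_append, lf_succ_cons]; rw [← lf_add, map_add]
  | cons h l ih => cases k with
    | zero => simp [lf_zero_cons]
    | succ k => simp only [List.cons_append, lf_succ_cons, ih]

theorem lf_append_smul {k : ℕ} (Ω : MultilinearMap K (fun _ : Fin k => M) N)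
    (l r : List (ℤ × M)) (e : ℤ) (c : K) (x : M) :
    lf Ω (l ++ (e, c • x) :: r) = c • lf Ω (l ++ (e, x) :: r) := by
  induction l generalizing k with
  | nil => cases k with
    | zero => simp [lf_zero_cons]
    | succ k => simp only [List.nil_append, lf_succ_cons]; rw [← lf_smul, map_smul]
  | cons h l ih => cases k with
    | zero => simp [lf_zero_cons]
    | succ k => simp only [List.cons_append, lf_succ_cons, ih]

theorem lf_slotLinear {k j : ℕ} (Ω : MultilinearMap K (fun _ : Fin k => M) N) :
    SlotLinear ℳ j (lf Ω) :=
  ⟨fun l r e x y _ _ _ _ _ => lf_append_add Ω l r e x y,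
    fun l r e c x _ _ _ _ => lf_append_smul Ω l r e c x⟩

theorem homog_fin_cons {k : ℕ} {n : Fin k → ℤ} {ξ : Fin k → M} (hξ : ∀ i, ξ i ∈ ℳ (n i))
    {e : ℤ} {x : M} (hx : x ∈ ℳ e) (i : Fin (k + 1)) :
    (Fin.cons x ξ : Fin (k + 1) → M) i ∈ ℳ ((Fin.cons e n : Fin (k + 1) → ℤ) i) :=
  Fin.cases (by simpa using hx) (fun j => by simpa using hξ j) i

theorem isGradedSymm_curryLeft {k : ℕ} {Ω : MultilinearMap K (fun _ : Fin (k + 1) => M) N}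
    (h : IsGradedSymm ℳ Ω) {e : ℤ} {x : M} (hx : x ∈ ℳ e) : IsGradedSymm ℳ (Ω.curryLeft x) := by
  intro n ξ hξ σ
  have := h _ _ (homog_fin_cons hξ hx) (Equiv.Perm.decomposeFin.symm (0, σ))
  rw [koszulSign_cons] at this
  rw [MultilinearMap.curryLeft_apply, MultilinearMap.curryLeft_apply, ← this]
  congr 1
  funext i
  refine Fin.cases ?_ (fun j => ?_) i <;> simp

theorem lf_swapSymm {k j : ℕ} {Ω : MultilinearMap K (fun _ : Fin k => M) N}
    (hΩ : IsGradedSymm ℳ Ω) : SwapSymm ℳ j (lf Ω) := by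
  intro l h h' r _ hl h1 h2 hr
  -- The length condition is dropped so that `k` may vary in the induction independently of the
  -- lists: on lists of the wrong length both sides are zero.
  clear * - hΩ hl h1 h2 hr
  induction l generalizing k with
  | nil =>
    match k, Ω, hΩ with
    | 0, _, _ => simp [lf_zero_cons]
    | 1, _, _ => simp [lf_succ_cons, lf_zero_cons]
    | k + 2, Ω, hΩ =>
      by_cases hk : r.length = k
      · obtain ⟨n, ξ, rfl⟩ := exists_eq_ofFn hk
        have hξ := (homog_ofFn ℳ).1 hr
        have := hΩ _ _ (homog_fin_cons (homog_fin_cons hξ h1) h2) (Equiv.swap 0 1)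
        rw [koszulSign_swap] at this
        simp only [List.nil_append, lf_succ_cons, lf_ofFn, MultilinearMap.curryLeft_apply]
        rw [mul_comm, ← this]
        congr 1
        funext i
        refine Fin.cases ?_ (fun i => Fin.cases ?_ (fun i => ?_) i) i
        · simp
        · simp
        · rw [Equiv.swap_apply_of_ne_of_ne (by simp) (by simp [Fin.ext_iff])]
          simp
      · rw [lf_of_length_ne, lf_of_length_ne, smul_zero] <;> simpa using hk
  | cons x l ih =>
    rw [homog_cons] at hl
    cases k with
    | zero => simp [lf_zero_cons]
    | succ k =>
      simp only [List.cons_append, lf_succ_cons]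
      exact ih (isGradedSymm_curryLeft hΩ hl.1) hl.2

end Lists

/-! ### Koszul signs of lists of indices -/

section KoszulSigns

variable {N : ℕ}

/-- The Koszul sign of a list of indices: the product of the signs of its inversions. -/
def listSign (n : Fin N → ℤ) : List (Fin N) → ℤˣ
  | [] => 1
  | x :: t => (t.map fun y => if y < x then (n x * n y).negOnePow else 1).prod * listSign n t

theorem listSign_ofFn (n : Fin N → ℤ) {k : ℕ} (g : Fin k → Fin N) :
    listSign n (List.ofFn g) =
      ∏ i, ∏ j, if i < j ∧ g j < g i then (n (g i) * n (g j)).negOnePow else 1 := by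
  induction k with
  | zero => simp [listSign]
  | succ k ih =>
    rw [List.ofFn_succ, listSign, ih, Fin.prod_univ_succ, List.map_ofFn, List.prod_ofFn]
    simp [Fin.prod_univ_succ]

theorem koszulSign_eq_listSign (σ : Perm (Fin N)) (n : Fin N → ℤ) :
    koszulSign σ n = listSign n (List.ofFn σ) := (listSign_ofFn n σ).symm

theorem listSign_cons_of_lt (n : Fin N → ℤ) {x : Fin N} {t : List (Fin N)}
    (h : ∀ y ∈ t, x < y) : listSign n (x :: t) = listSign n t := by
  rw [listSign, List.prod_eq_one, one_mul]
  intro u hu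
  obtain ⟨y, hy, rfl⟩ := List.mem_map.1 hu
  simp [(h y hy).not_gt]

/-- A minimal index forms an inversion with each entry in front of it and with no other entry. The
resulting sign is the one in the second summand of `splitSum`. -/
theorem listSign_append_cons_of_lt {M : Type*} (n : Fin N → ℤ) (ξ : Fin N → M) {x : Fin N}
    {l r : List (Fin N)} (hl : ∀ y ∈ l, x < y) (hr : ∀ y ∈ r, x < y) :
    listSign n (l ++ x :: r) =
      (n x * dg (l.map fun i => (n i, ξ i))).negOnePow * listSign n (l ++ r) := by
  induction l with
  | nil => simpa using listSign_cons_of_lt n hr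
  | cons y l ih =>
    have hy : x < y := hl y (by simp)
    simp only [List.cons_append, listSign]
    rw [ih fun z hz => hl z (by simp [hz])]
    simp only [List.map_append, List.map_cons, List.prod_append, List.prod_cons, if_pos hy,
      dg_cons, mul_add, Int.negOnePow_add, mul_comm (n y) (n x)]
    simp only [mul_assoc, mul_left_comm, mul_comm]

end KoszulSigns

/-! ### Graded symmetry under all permutations from adjacent exchanges. -/

section Sorting

variable {K M N : Type*} [Field K] [AddCommGroup M] [Module K M] [AddCommGroup N] [Module K N]
  {ℳ : ℤ → Submodule K M} {k : ℕ} {n : Fin k → ℤ} {ξ : Fin k → M}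

theorem homog_map (hξ : ∀ i, ξ i ∈ ℳ (n i)) (l : List (Fin k)) :
    Homog ℳ (l.map fun i => (n i, ξ i)) := by
  intro h hh
  obtain ⟨i, _, rfl⟩ := List.mem_map.1 hh
  exact hξ i

/-- Inserting `x` into a sorted list moves it past exactly the entries smaller than `x`, that is,
past those with which it forms an inversion. -/
theorem SwapSymm.orderedInsert {j : ℕ} {f : List (ℤ × M) → N} (hf : SwapSymm ℳ j f)
    (hξ : ∀ i, ξ i ∈ ℳ (n i)) (x : Fin k) (s : List (Fin k)) (hs : s.Pairwise (· ≤ ·))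
    (l : List (ℤ × M)) (hl : Homog ℳ l) (hj : l.length + s.length + 1 = j) :
    f (l ++ (x :: s).map fun i => (n i, ξ i)) =
      (s.map fun y => if y < x then (n x * n y).negOnePow else 1).prod •
        f (l ++ (s.orderedInsert (· ≤ ·) x).map fun i => (n i, ξ i)) := by
  induction s generalizing l with
  | nil => simp
  | cons y s ih =>
    rw [List.pairwise_cons] at hs
    by_cases hxy : x ≤ y
    · rw [List.orderedInsert_cons_of_le _ _ hxy, List.prod_eq_one, one_smul]
      intro u hu
      obtain ⟨z, hz, rfl⟩ := List.mem_map.1 hu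
      have : x ≤ z := by
        rcases List.mem_cons.1 hz with rfl | hz
        · exact hxy
        · exact hxy.trans (hs.1 z hz)
      simp [this.not_gt]
    · rw [List.orderedInsert_of_not_le _ _ hxy]
      simp only [List.map_cons, List.prod_cons, if_pos (not_le.1 hxy)]
      rw [hf l _ _ _ (by simp at hj ⊢; omega) hl (hξ x) (hξ y) (homog_map hξ s)]
      have := ih hs.2 (l ++ [(n y, ξ y)]) (by simp [hl, hξ y]) (by simp at hj ⊢; omega)
      simp only [List.append_assoc, List.singleton_append, List.map_cons] at this
      rw [this, smul_smul]

theorem SwapSymm.insertionSort {j : ℕ} {f : List (ℤ × M) → N} (hf : SwapSymm ℳ j f)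
    (hξ : ∀ i, ξ i ∈ ℳ (n i)) (w : List (Fin k))
    (l : List (ℤ × M)) (hl : Homog ℳ l) (hj : l.length + w.length = j) :
    f (l ++ w.map fun i => (n i, ξ i)) =
      listSign n w • f (l ++ (w.insertionSort (· ≤ ·)).map fun i => (n i, ξ i)) := by
  induction w generalizing l with
  | nil => simp [listSign]
  | cons x w ih =>
    have := ih (l ++ [(n x, ξ x)]) (by simp [hl, hξ x]) (by simp at hj ⊢; omega)
    simp only [List.append_assoc, List.singleton_append] at this
    rw [List.map_cons, this, List.insertionSort_cons,
      ← List.map_cons (f := fun i => (n i, ξ i)), hf.orderedInsert hξ x _ (List.pairwise_insertionSort _ w) l hl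
        (by simp at hj ⊢; omega), smul_smul, listSign, mul_comm]
    congr 2
    exact ((List.perm_insertionSort (· ≤ ·) w).map _).prod_eq

/-- Insertion sort carries the list of values of `σ` to the increasing list by adjacent exchanges,
each removing one inversion. The signs collected on the way multiply to the Koszul sign. -/
theorem isGradedSymm_of_swapSymm {Ω : MultilinearMap K (fun _ : Fin k => M) N}
    {f : List (ℤ × M) → N} (hf : SwapSymm ℳ k f)
    (h : ∀ (n : Fin k → ℤ) (ξ : Fin k → M), (∀ i, ξ i ∈ ℳ (n i)) →
      Ω ξ = f (List.ofFn fun i => (n i, ξ i))) : IsGradedSymm ℳ Ω := by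
  intro n ξ hξ σ
  have hsort : (List.ofFn σ).insertionSort (· ≤ ·) = List.finRange k := by
    refine List.Perm.eq_of_pairwise' (r := (· ≤ ·)) (List.pairwise_insertionSort _ _)
      ((List.pairwise_lt_finRange k).imp le_of_lt) ?_
    refine (List.perm_insertionSort _ _).trans ?_
    rw [List.ofFn_eq_map]
    exact Equiv.Perm.map_finRange_perm σ
  have := hf.insertionSort hξ (List.ofFn σ) [] (by simp) (by simp)
  rw [hsort, List.map_ofFn] at this
  rw [h _ _ fun i => hξ (σ i), h n ξ hξ, koszulSign_eq_listSign, List.ofFn_eq_map (n := k)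
    (f := fun i => (n i, ξ i))]
  simpa [Function.comp_def] using this

end Sorting

/-! ### Sums over the splittings of a list -/

section SplitSums

variable {M N : Type*} [AddCommGroup N]

/-- The sum over all splittings of a list into two complementary sublists `l₁`, `l₂`, with Koszul
signs, of `G l₁ l₂`. -/
def splitSum : (List (ℤ × M) → List (ℤ × M) → N) → List (ℤ × M) → N
  | G, [] => G [] []
  | G, h :: t => splitSum (fun l₁ l₂ => G (h :: l₁) l₂) t +
      splitSum (fun l₁ l₂ => (h.1 * dg l₁).negOnePow • G l₁ (h :: l₂)) t

theorem splitSum_nil (G : List (ℤ × M) → List (ℤ × M) → N) : splitSum G [] = G [] [] := by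
  rw [splitSum]

theorem splitSum_cons (G : List (ℤ × M) → List (ℤ × M) → N) (h : ℤ × M) (t : List (ℤ × M)) :
    splitSum G (h :: t) = splitSum (fun l₁ l₂ => G (h :: l₁) l₂) t +
      splitSum (fun l₁ l₂ => (h.1 * dg l₁).negOnePow • G l₁ (h :: l₂)) t := by
  rw [splitSum]

theorem splitSum_add (G G' : List (ℤ × M) → List (ℤ × M) → N) (l : List (ℤ × M)) :
    splitSum (fun l₁ l₂ => G l₁ l₂ + G' l₁ l₂) l = splitSum G l + splitSum G' l := by
  induction l generalizing G G' with
  | nil => simp only [splitSum_nil]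
  | cons h t ih => simp only [splitSum_cons, smul_add, ih]; abel

theorem map_splitSum {N' : Type*} [AddCommGroup N'] (φ : N →+ N')
    (G : List (ℤ × M) → List (ℤ × M) → N) (l : List (ℤ × M)) :
    φ (splitSum G l) = splitSum (fun l₁ l₂ => φ (G l₁ l₂)) l := by
  induction l generalizing G with
  | nil => simp only [splitSum_nil]
  | cons h t ih => simp only [splitSum_cons, map_add, ih, Units.smul_def, map_zsmul]

theorem splitSum_smul {R : Type*} [Monoid R] [DistribMulAction R N] (c : R)
    (G : List (ℤ × M) → List (ℤ × M) → N) (l : List (ℤ × M)) :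
    splitSum (fun l₁ l₂ => c • G l₁ l₂) l = c • splitSum G l :=
  (map_splitSum (DistribSMul.toAddMonoidHom N c) G l).symm

theorem splitSum_zero (l : List (ℤ × M)) :
    splitSum (fun _ _ => (0 : N)) l = 0 := by
  simpa using (map_splitSum (0 : N →+ N) (fun _ _ => 0) l).symm

theorem splitSum_neg (G : List (ℤ × M) → List (ℤ × M) → N) (l : List (ℤ × M)) :
    splitSum (fun l₁ l₂ => - G l₁ l₂) l = - splitSum G l :=
  (map_splitSum (negAddMonoidHom : N →+ N) G l).symm

theorem splitSum_sub (G G' : List (ℤ × M) → List (ℤ × M) → N) (l : List (ℤ × M)) :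
    splitSum (fun l₁ l₂ => G l₁ l₂ - G' l₁ l₂) l = splitSum G l - splitSum G' l := by
  simp only [sub_eq_add_neg, splitSum_add, splitSum_neg]

end SplitSums

/-! ### Degree, linearity and symmetry of splitting sums. -/

section SplitSumsHomog

variable {K M N : Type*} [Field K] [AddCommGroup M] [Module K M] [AddCommGroup N] [Module K N]
  {ℳ : ℤ → Submodule K M}

theorem splitSum_congr {G G' : List (ℤ × M) → List (ℤ × M) → N} {l : List (ℤ × M)}
    (hl : Homog ℳ l)
    (h : ∀ l₁ l₂, Homog ℳ l₁ → Homog ℳ l₂ → dg l₁ + dg l₂ = dg l →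
      l₁.length + l₂.length = l.length → G l₁ l₂ = G' l₁ l₂) : splitSum G l = splitSum G' l := by
  induction l generalizing G G' with
  | nil => simpa only [splitSum_nil] using h [] [] (by simp) (by simp) (by simp) (by simp)
  | cons x t ih =>
    rw [homog_cons] at hl
    rw [splitSum_cons, splitSum_cons]
    congr 1
    · refine ih hl.2 fun l₁ l₂ h1 h2 hd hk => h _ _ (by simp [hl.1, h1]) h2 ?_ ?_
      · simp [← hd, add_assoc]
      · simp [← hk]; omega
    · refine ih hl.2 fun l₁ l₂ h1 h2 hd hk => ?_
      rw [h _ _ h1 (by simp [hl.1, h2])]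
      · simp [← hd, add_left_comm]
      · simp [← hk]; omega

/-- Only the splitting with empty first block survives, and its sign is trivial because an empty
block has degree zero. -/
theorem splitSum_eq_of_ne_nil {G : List (ℤ × M) → List (ℤ × M) → N} {l : List (ℤ × M)}
    (hl : Homog ℳ l) (h : ∀ x l₁ l₂, Homog ℳ (x :: l₁) → Homog ℳ l₂ → G (x :: l₁) l₂ = 0) :
    splitSum G l = G [] l := by
  induction l generalizing G with
  | nil => rw [splitSum_nil]
  | cons x t ih =>
    rw [homog_cons] at hl
    rw [splitSum_cons, splitSum_congr (G' := fun _ _ => 0) hl.2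
      fun l₁ l₂ h1 h2 _ _ => h x l₁ l₂ (by simp [hl.1, h1]) h2, splitSum_zero, zero_add, ih hl.2]
    · simp
    · intro y l₁ l₂ h1 h2
      rw [h y l₁ (x :: l₂) h1 (by simp [hl.1, h2]), smul_zero]

theorem splitSum_mem {𝒩 : ℤ → Submodule K N} {G : List (ℤ × M) → List (ℤ × M) → N}
    {l : List (ℤ × M)} (hl : Homog ℳ l) (d : ℤ)
    (h : ∀ l₁ l₂, Homog ℳ l₁ → Homog ℳ l₂ → dg l₁ + dg l₂ = dg l →
      l₁.length + l₂.length = l.length → G l₁ l₂ ∈ 𝒩 d) :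
    splitSum G l ∈ 𝒩 d := by
  induction l generalizing G with
  | nil => simpa only [splitSum_nil] using h [] [] (by simp) (by simp) (by simp) (by simp)
  | cons x t ih =>
    rw [homog_cons] at hl
    rw [splitSum_cons]
    refine add_mem (ih hl.2 ?_) (ih hl.2 ?_)
    · intro l₁ l₂ h1 h2 hd hk
      refine h _ _ (by simp [hl.1, h1]) h2 ?_ ?_
      · simp [← hd, add_assoc]
      · simp [← hk]; omega
    · intro l₁ l₂ h1 h2 hd hk
      rw [Units.smul_def]
      refine zsmul_mem (h _ _ h1 (by simp [hl.1, h2]) ?_ ?_) _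
      · simp [← hd, add_left_comm]
      · simp [← hk]; omega

/-- The signs in `splitSum` see the entries only through their degrees, so they are the same for
`x`, `y` and `x + y`. The hypotheses are stated for blocks of every length because splittings of all
shapes occur. -/
theorem splitSum_slotLinear {k : ℕ} {G : List (ℤ × M) → List (ℤ × M) → N}
    (h₁ : ∀ j l₂, Homog ℳ l₂ → SlotLinear ℳ j fun l₁ => G l₁ l₂)
    (h₂ : ∀ j l₁, Homog ℳ l₁ → SlotLinear ℳ j fun l₂ => G l₁ l₂) :
    SlotLinear ℳ k (splitSum G) := by
  constructor
  · intro l r e x y _ hl hr hx hy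
    clear * - h₁ h₂ hl hr hx hy
    induction l generalizing G with
    | nil =>
      simp only [List.nil_append, splitSum_cons]
      have a1 := splitSum_congr hr (G := fun l₁ l₂ => G ((e, x + y) :: l₁) l₂)
        (G' := fun l₁ l₂ => G ((e, x) :: l₁) l₂ + G ((e, y) :: l₁) l₂)
        fun l₁ l₂ hl₁ hl₂ _ _ => (h₁ _ l₂ hl₂).add [] l₁ e x y rfl (by simp) hl₁ hx hy
      have a2 := splitSum_congr hr (G := fun l₁ l₂ => (e * dg l₁).negOnePow • G l₁ ((e, x + y) :: l₂))
        (G' := fun l₁ l₂ => (e * dg l₁).negOnePow • G l₁ ((e, x) :: l₂) +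
          (e * dg l₁).negOnePow • G l₁ ((e, y) :: l₂))
        fun l₁ l₂ hl₁ hl₂ _ _ => by
          rw [← smul_add]
          exact congrArg _ ((h₂ _ l₁ hl₁).add [] l₂ e x y rfl (by simp) hl₂ hx hy)
      rw [a1, a2, splitSum_add, splitSum_add]
      abel
    | cons z l ih =>
      rw [homog_cons] at hl
      simp only [List.cons_append, splitSum_cons]
      rw [ih (fun j l₂ hl₂ => (h₁ _ l₂ hl₂).cons hl.1)
          (fun j l₁ hl₁ => h₂ _ _ (by simp [hl.1, hl₁])) hl.2,
        ih (G := fun l₁ l₂ => (z.1 * dg l₁).negOnePow • G l₁ (z :: l₂)) ?_ ?_ hl.2,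
        add_add_add_comm]
      · intro j l₂ hl₂
        have h := fun j => h₁ j (z :: l₂) (by simp [hl.1, hl₂])
        refine ⟨fun l r e x y hk hl hr hx hy => ?_, fun l r e c x hk hl hr hx => ?_⟩
        · simp only [(h _).add l r e x y hk hl hr hx hy, smul_add, dg_append, dg_cons]
        · simp only [(h _).smul l r e c x hk hl hr hx, dg_append, dg_cons, smul_comm c]
      · intro j l₁ hl₁
        have h := fun j => (h₂ (j + 1) l₁ hl₁).cons hl.1
        refine ⟨fun l r e x y hk hl hr hx hy => ?_, fun l r e c x hk hl hr hx => ?_⟩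
        · simp only [(h _).add l r e x y hk hl hr hx hy, smul_add]
        · simp only [(h _).smul l r e c x hk hl hr hx, smul_comm c]
  · intro l r e c x _ hl hr hx
    clear * - h₁ h₂ hl hr hx
    induction l generalizing G with
    | nil =>
      simp only [List.nil_append, splitSum_cons]
      rw [smul_add, ← splitSum_smul, ← splitSum_smul]
      congr 1
      · refine splitSum_congr hr fun l₁ l₂ hl₁ hl₂ _ _ => ?_
        exact (h₁ _ l₂ hl₂).smul [] l₁ e c x rfl (by simp) hl₁ hx
      · refine splitSum_congr hr fun l₁ l₂ hl₁ hl₂ _ _ => ?_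
        rw [smul_comm]
        exact congrArg _ ((h₂ _ l₁ hl₁).smul [] l₂ e c x rfl (by simp) hl₂ hx)
    | cons z l ih =>
      rw [homog_cons] at hl
      simp only [List.cons_append, splitSum_cons]
      rw [ih (fun j l₂ hl₂ => (h₁ _ l₂ hl₂).cons hl.1)
          (fun j l₁ hl₁ => h₂ _ _ (by simp [hl.1, hl₁])) hl.2,
        ih (G := fun l₁ l₂ => (z.1 * dg l₁).negOnePow • G l₁ (z :: l₂)) ?_ ?_ hl.2, smul_add]
      · intro j l₂ hl₂
        have h := fun j => h₁ j (z :: l₂) (by simp [hl.1, hl₂])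
        refine ⟨fun l r e x y hk hl hr hx hy => ?_, fun l r e c x hk hl hr hx => ?_⟩
        · simp only [(h _).add l r e x y hk hl hr hx hy, smul_add, dg_append, dg_cons]
        · simp only [(h _).smul l r e c x hk hl hr hx, dg_append, dg_cons, smul_comm c]
      · intro j l₁ hl₁
        have h := fun j => (h₂ (j + 1) l₁ hl₁).cons hl.1
        refine ⟨fun l r e x y hk hl hr hx hy => ?_, fun l r e c x hk hl hr hx => ?_⟩
        · simp only [(h _).add l r e x y hk hl hr hx hy, smul_add]
        · simp only [(h _).smul l r e c x hk hl hr hx, smul_comm c]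

/-- Two adjacent entries can be distributed over the blocks in four ways. If both go to the same
block, symmetry in that block applies; the two mixed distributions are exchanged, and the Koszul
signs of `splitSum` account for the difference. -/
theorem splitSum_swapSymm {k : ℕ} {G : List (ℤ × M) → List (ℤ × M) → N}
    (h₁ : ∀ j l₂, Homog ℳ l₂ → SwapSymm ℳ j fun l₁ => G l₁ l₂)
    (h₂ : ∀ j l₁, Homog ℳ l₁ → SwapSymm ℳ j fun l₂ => G l₁ l₂) :
    SwapSymm ℳ k (splitSum G) := by
  intro l h h' r _ hl hh hh' hr
  clear * - h₁ h₂ hl hr hh hh'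
  induction l generalizing G with
  | nil =>
    simp only [List.nil_append, splitSum_cons, smul_add, ← splitSum_smul]
    have e1 := splitSum_congr (ℳ := ℳ) hr (G := fun l₁ l₂ => G (h :: h' :: l₁) l₂)
      (G' := fun l₁ l₂ => (h.1 * h'.1).negOnePow • G (h' :: h :: l₁) l₂)
      fun l₁ l₂ hl₁ hl₂ _ _ => h₁ _ l₂ hl₂ [] h h' l₁ rfl (by simp) hh hh' hl₁
    have e2 := splitSum_congr (ℳ := ℳ) hr
      (G := fun l₁ l₂ => (h.1 * dg l₁).negOnePow • (h'.1 * dg l₁).negOnePow • G l₁ (h :: h' :: l₂))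
      (G' := fun l₁ l₂ => (h.1 * h'.1).negOnePow •
        (h'.1 * dg l₁).negOnePow • (h.1 * dg l₁).negOnePow • G l₁ (h' :: h :: l₂))
      fun l₁ l₂ hl₁ hl₂ _ _ => by
        have := h₂ _ l₁ hl₁ [] h h' l₂ rfl (by simp) hh hh' hl₂
        simp only [List.nil_append] at this
        rw [this]
        simp only [smul_smul, ← Int.negOnePow_add]
        rw [negOnePow_congr]
        grind
    rw [e1]
    simp only [dg_cons, mul_add, Int.negOnePow_add, mul_smul]
    rw [splitSum_congr (ℳ := ℳ) hr (G := fun l₁ l₂ => (h'.1 * dg l₁).negOnePow •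
      (h.1 * dg l₁).negOnePow • G l₁ (h :: h' :: l₂)) (fun l₁ l₂ _ _ _ _ => smul_comm _ _ _), e2]
    -- In the mixed distributions the sign of exchanging `h` and `h'` occurs twice and drops out.
    have e4 : ∀ x : N, (h.1 * h'.1).negOnePow • (h'.1 * h.1).negOnePow • x = x := fun x => by
      rw [mul_comm h'.1, smul_smul, ← Int.negOnePow_add, negOnePow_congr (n := 0)]
      · simp
      · grind
    simp only [e4]
    rw [splitSum_congr (ℳ := ℳ) hr (G := fun l₁ l₂ => (h.1 * h'.1).negOnePow •
      (h'.1 * dg l₁).negOnePow • (h.1 * dg l₁).negOnePow • G l₁ (h' :: h :: l₂))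
      (fun l₁ l₂ _ _ _ _ => by rw [smul_comm (h'.1 * dg l₁).negOnePow])]
    abel
  | cons z l ih =>
    rw [homog_cons] at hl
    simp only [List.cons_append, splitSum_cons, smul_add]
    rw [ih (fun j l₂ hl₂ => (h₁ _ l₂ hl₂).cons hl.1)
        (fun j l₁ hl₁ => h₂ _ _ (by simp [hl.1, hl₁])) hl.2,
      ih (G := fun l₁ l₂ => (z.1 * dg l₁).negOnePow • G l₁ (z :: l₂)) ?_ ?_ hl.2]
    · intro j l₂ hl₂ l a b r hk hl' ha hb hr
      have := h₁ _ (z :: l₂) (by simp [hl.1, hl₂]) l a b r hk hl' ha hb hr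
      simp only [this, smul_comm (a.1 * b.1).negOnePow, dg_append, dg_cons, add_left_comm]
    · intro j l₁ hl₁
      exact ((h₂ (j + 1) l₁ hl₁).cons hl.1).smul_unit _

end SplitSumsHomog

/-! ### Unshuffles as splittings -/

section Unshuffles

/-- All splittings of a list into two complementary sublists. -/
def splits {α : Type*} : List α → List (List α × List α)
  | [] => [([], [])]
  | x :: t => (splits t).map (fun s => (x :: s.1, s.2)) ++ (splits t).map fun s => (s.1, x :: s.2)

variable {N : ℕ}

theorem exists_list_eq_ofFn {α : Type*} {k : ℕ} {l : List α} (hk : l.length = k) :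
    ∃ f : Fin k → α, l = List.ofFn f := by
  subst hk
  exact ⟨l.get, (List.ofFn_get l).symm⟩

theorem perm_of_mem_splits {α : Type*} {w : List α} {s : List α × List α} (hs : s ∈ splits w) :
    (s.1 ++ s.2).Perm w := by
  induction w generalizing s with
  | nil => simp [splits] at hs; simp [hs]
  | cons x w ih =>
    simp only [splits, List.mem_append, List.mem_map] at hs
    rcases hs with ⟨s, hs, rfl⟩ | ⟨s, hs, rfl⟩
    · simpa using ih hs
    · exact List.perm_middle.trans ((ih hs).cons x)

theorem sublist_of_mem_splits {α : Type*} {w : List α} {s : List α × List α}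
    (hs : s ∈ splits w) : s.1.Sublist w ∧ s.2.Sublist w := by
  induction w generalizing s with
  | nil => simp [splits] at hs; simp [hs]
  | cons x w ih =>
    simp only [splits, List.mem_append, List.mem_map] at hs
    rcases hs with ⟨s, hs, rfl⟩ | ⟨s, hs, rfl⟩
    · exact ⟨(ih hs).1.cons_cons x, (ih hs).2.cons x⟩
    · exact ⟨(ih hs).1.cons x, (ih hs).2.cons_cons x⟩

theorem nodup_splits {α : Type*} {w : List α} (hw : w.Nodup) : (splits w).Nodup := by
  induction w with
  | nil => simp [splits]
  | cons x w ih =>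
    rw [List.nodup_cons] at hw
    rw [splits, List.nodup_append]
    refine ⟨(ih hw.2).map ?_, (ih hw.2).map ?_, ?_⟩
    · rintro ⟨a, b⟩ ⟨c, d⟩ h
      simpa using h
    · rintro ⟨a, b⟩ ⟨c, d⟩ h
      simpa using h
    · rintro _ h1 _ h2 rfl
      obtain ⟨s, _, rfl⟩ := List.mem_map.1 h1
      obtain ⟨s', hs', h⟩ := List.mem_map.1 h2
      have h1 : s'.1 = x :: s.1 := congrArg Prod.fst h
      exact hw.1 ((sublist_of_mem_splits hs').1.subset (by simp [h1]))

/-- The head of an increasing list is its minimum, so it must be the head of whichever increasing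
block contains it. -/
theorem mem_splits {w l r : List (Fin N)} (hw : w.Pairwise (· < ·)) (hl : l.Pairwise (· < ·))
    (hr : r.Pairwise (· < ·)) (h : (l ++ r).Perm w) : (l, r) ∈ splits w := by
  induction w generalizing l r with
  | nil => simp at h; simp [splits, h]
  | cons x w ih =>
    rw [List.pairwise_cons] at hw
    simp only [splits, List.mem_append, List.mem_map]
    have hmin : ∀ y ∈ l ++ r, x ≤ y := fun y hy => by
      rcases List.mem_cons.1 (h.subset hy) with rfl | hy
      · exact le_rfl
      · exact (hw.1 y hy).le
    have hx : x ∈ l ++ r := h.symm.subset (by simp)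
    rcases List.mem_append.1 hx with hx | hx
    · left
      match l, hl, hx with
      | y :: l, hl, hx =>
        rw [List.pairwise_cons] at hl
        have : y = x := by
          rcases List.mem_cons.1 hx with h | h
          · exact h.symm
          · exact absurd (hl.1 x h) (hmin y (by simp)).not_gt
        subst this
        exact ⟨(l, r), ih hw.2 hl.2 hr (by simpa using h), rfl⟩
    · right
      match r, hr, hx with
      | y :: r, hr, hx =>
        rw [List.pairwise_cons] at hr
        have : y = x := by
          rcases List.mem_cons.1 hx with h | h
          · exact h.symm
          · exact absurd (hr.1 x h) (hmin y (by simp)).not_gt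
        subst this
        exact ⟨(l, r), ih hw.2 hl hr.2 (List.perm_middle.symm.trans h).cons_inv, rfl⟩

variable {K L M : Type*} [AddCommGroup M]

/-- As `w` is increasing, each head is smaller than all that follows. Putting it in the first block
creates no inversion, and putting it in the second creates one with every entry of the first block,
exactly as in the recursion of `splitSum`. -/
theorem splitSum_map (G : List (ℤ × L) → List (ℤ × L) → M) (n : Fin N → ℤ) (ξ : Fin N → L)
    {w : List (Fin N)} (hw : w.Pairwise (· < ·)) :
    splitSum G (w.map fun i => (n i, ξ i)) = ((splits w).map fun s => listSign n (s.1 ++ s.2) •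
      G (s.1.map fun i => (n i, ξ i)) (s.2.map fun i => (n i, ξ i))).sum := by
  induction w generalizing G with
  | nil => simp [splits, splitSum_nil, listSign]
  | cons x w ih =>
    rw [List.pairwise_cons] at hw
    rw [List.map_cons, splitSum_cons, ih _ hw.2, ih _ hw.2, splits, List.map_append,
      List.sum_append, List.map_map, List.map_map]
    congr 2
    · refine List.map_congr_left fun s hs => ?_
      simp only [Function.comp_apply, List.cons_append, List.map_cons]
      rw [listSign_cons_of_lt]
      intro y hy
      exact hw.1 y ((perm_of_mem_splits hs).subset hy)
    · refine List.map_congr_left fun s hs => ?_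
      simp only [Function.comp_apply, List.map_cons]
      rw [listSign_append_cons_of_lt n ξ, mul_comm (n x), smul_smul, mul_comm (listSign _ _)]
      · exact fun y hy => hw.1 y ((sublist_of_mem_splits hs).1.subset hy)
      · exact fun y hy => hw.1 y ((sublist_of_mem_splits hs).2.subset hy)

/-- An unshuffle is the same as the pair of its increasing blocks, which is a splitting of the index
list. Splittings whose first block does not have length `p` also occur on the right; `h0` makes them
vanish, so the sum need not mention block lengths. -/
theorem unshuffleSum_eq_splitSum (p q : ℕ) (n : Fin (p + q) → ℤ) (ξ : Fin (p + q) → L)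
    (F : (Fin p → ℤ) → (Fin p → L) → (Fin q → L) → M) (G : List (ℤ × L) → List (ℤ × L) → M)
    (h : ∀ (n₁ : Fin p → ℤ) (ξ₁ : Fin p → L) (n₂ : Fin q → ℤ) (ξ₂ : Fin q → L),
      G (List.ofFn fun i => (n₁ i, ξ₁ i)) (List.ofFn fun i => (n₂ i, ξ₂ i)) = F n₁ ξ₁ ξ₂)
    (h0 : ∀ l₁ l₂, l₁.length + l₂.length = p + q → l₁.length ≠ p → G l₁ l₂ = 0) :
    unshuffleSum p q n ξ F = splitSum G (List.ofFn fun i => (n i, ξ i)) := by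
  classical
  have hfr := List.pairwise_lt_finRange (p + q)
  rw [List.ofFn_eq_map, splitSum_map G n ξ hfr,
    ← List.sum_toFinset _ (nodup_splits (List.nodup_finRange _))]
  refine Finset.sum_of_injOn (fun σ => (List.ofFn fun i => σ (Fin.castAdd q i),
    List.ofFn fun j => σ (Fin.natAdd p j))) ?_ ?_ ?_ ?_
  · intro σ _ τ _ hστ
    simp only [Prod.mk.injEq, List.ofFn_inj] at hστ
    refine Equiv.ext fun i => Fin.addCases (fun i => congrFun hστ.1 i)
      (fun i => congrFun hστ.2 i) i
  · intro σ hσ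
    simp only [unshuffles, Finset.coe_filter, Finset.mem_univ, true_and, Set.mem_ofPred_eq] at hσ
    simp only [Finset.mem_coe, List.mem_toFinset]
    refine mem_splits hfr (List.pairwise_ofFn.2 hσ.1) (List.pairwise_ofFn.2 hσ.2) ?_
    rw [← List.ofFn_fin_append]
    have : (Fin.append (fun i => σ (Fin.castAdd q i)) fun j => σ (Fin.natAdd p j)) = σ :=
      funext fun i => Fin.addCases (fun i => by simp) (fun i => by simp) i
    rw [this, List.ofFn_eq_map]
    exact Equiv.Perm.map_finRange_perm σ
  · intro s hs hns
    simp only [List.mem_toFinset] at hs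
    have hperm := perm_of_mem_splits hs
    by_cases hp : s.1.length = p
    · exfalso
      refine hns ?_
      have hq : s.2.length = q := by
        have := hperm.length_eq
        simp at this
        omega
      obtain ⟨l, r⟩ := s
      simp only at hp hq hperm
      obtain ⟨f, rfl⟩ : ∃ f : Fin p → Fin (p + q), l = List.ofFn f :=
        exists_list_eq_ofFn hp
      obtain ⟨g, rfl⟩ : ∃ g : Fin q → Fin (p + q), r = List.ofFn g :=
        exists_list_eq_ofFn hq
      have hnd := hperm.symm.nodup (List.nodup_finRange _)
      rw [← List.ofFn_fin_append, List.nodup_ofFn] at hnd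
      refine ⟨Equiv.ofBijective _ (Finite.injective_iff_bijective.1 hnd), ?_, ?_⟩
      · have h1 := hfr.sublist (sublist_of_mem_splits hs).1
        have h2 := hfr.sublist (sublist_of_mem_splits hs).2
        rw [List.pairwise_ofFn] at h1 h2
        simpa [unshuffles] using ⟨h1, h2⟩
      · simp
    · rw [h0, smul_zero]
      · have := hperm.length_eq
        simpa using this
      · simpa using hp
  · intro σ _
    simp only [List.map_ofFn, Function.comp_def]
    rw [h, koszulSign_eq_listSign, ← List.ofFn_fin_append]
    congr 3
    exact funext fun i => Fin.addCases (fun i => by simp) (fun i => by simp) i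

end Unshuffles

/-! ### The graded structure of the symmetric algebra -/

section SymmetricAlgebraStructure

variable {K A L : Type*} [Field K] [Ring A] [Algebra K A] [AddCommGroup L] [Module K L]
  [Module A L] {𝒜 : ℤ → Submodule K A} {ℒ : ℤ → Submodule K L}

theorem ofA_one : ofA 𝒜 ℒ 1 = 1 := by
  have := RingQuot.mkAlgHom_rel K (SymRel.one (𝒜 := 𝒜) (ℒ := ℒ))
  rw [map_one] at this
  exact this

theorem ofA_mul (a b : A) : ofA 𝒜 ℒ (a * b) = ofA 𝒜 ℒ a * ofA 𝒜 ℒ b := by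
  have := RingQuot.mkAlgHom_rel K (SymRel.mul (𝒜 := 𝒜) (ℒ := ℒ) a b)
  rw [map_mul] at this
  exact this.symm

theorem ofA_mul_ofL (a : A) (ξ : L) : ofA 𝒜 ℒ a * ofL 𝒜 ℒ ξ = ofL 𝒜 ℒ (a • ξ) := by
  have := RingQuot.mkAlgHom_rel K (SymRel.smul (𝒜 := 𝒜) (ℒ := ℒ) a ξ)
  rw [map_mul] at this
  exact this

theorem ofA_mul_ofL_comm {i j : ℤ} {a : A} {ξ : L} (ha : a ∈ 𝒜 i) (hξ : ξ ∈ ℒ j) :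
    ofA 𝒜 ℒ a * ofL 𝒜 ℒ ξ = (i * j).negOnePow • (ofL 𝒜 ℒ ξ * ofA 𝒜 ℒ a) := by
  have := RingQuot.mkAlgHom_rel K (SymRel.comm_left (𝒜 := 𝒜) (ℒ := ℒ) ha hξ)
  rw [Units.smul_def, map_zsmul, map_mul, map_mul] at this
  exact this

theorem ofL_mul_ofL_comm {i j : ℤ} {ξ ζ : L} (hξ : ξ ∈ ℒ i) (hζ : ζ ∈ ℒ j) :
    ofL 𝒜 ℒ ξ * ofL 𝒜 ℒ ζ = (i * j).negOnePow • (ofL 𝒜 ℒ ζ * ofL 𝒜 ℒ ξ) := by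
  have := RingQuot.mkAlgHom_rel K (SymRel.comm (𝒜 := 𝒜) (ℒ := ℒ) hξ hζ)
  rw [Units.smul_def, map_zsmul, map_mul, map_mul] at this
  exact this

theorem symAlg_induction {C : SymAlg 𝒜 ℒ → Prop} (ofA : ∀ a, C (ofA 𝒜 ℒ a))
    (ofL : ∀ ξ, C (ofL 𝒜 ℒ ξ)) (mul : ∀ u v, C u → C v → C (u * v))
    (add : ∀ u v, C u → C v → C (u + v)) (u : SymAlg 𝒜 ℒ) : C u := by
  obtain ⟨x, rfl⟩ := RingQuot.mkAlgHom_surjective K (SymRel 𝒜 ℒ) u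
  induction x using TensorAlgebra.induction with
  | algebraMap r =>
    -- A scalar `r` is the image of `r • 1 ∈ A`, so constants need no separate case.
    rw [AlgHom.commutes, Algebra.algebraMap_eq_smul_one, ← ofA_one, ← map_smul]
    exact ofA _
  | ι x =>
    have : RingQuot.mkAlgHom K (SymRel 𝒜 ℒ) (TensorAlgebra.ι K x) =
        SHLR.ofA 𝒜 ℒ x.1 + SHLR.ofL 𝒜 ℒ x.2 := by
      simp only [SHLR.ofA, SHLR.ofL, LinearMap.comp_apply, AlgHom.toLinearMap_apply,
        LinearMap.inl_apply, LinearMap.inr_apply, ← map_add]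
      simp
    rw [this]
    exact add _ _ (ofA _) (ofL _)
  | mul x y hx hy => rw [map_mul]; exact mul _ _ hx hy
  | add x y hx hy => rw [map_add]; exact add _ _ hx hy

/-- The universal property of the graded symmetric algebra. -/
theorem exists_symAlg_lift [Decomposition 𝒜] [Decomposition ℒ]
    {R : Type*} [Ring R] [Algebra K R] (fA : A →ₗ[K] R) (fL : L →ₗ[K] R)
    (one : fA 1 = 1)
    (mul : ∀ e a e' b, a ∈ 𝒜 e → b ∈ 𝒜 e' → fA (a * b) = fA a * fA b)
    (smul : ∀ e a e' ξ, a ∈ 𝒜 e → ξ ∈ ℒ e' → fL (a • ξ) = fA a * fL ξ)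
    (comm_left : ∀ e a e' ξ, a ∈ 𝒜 e → ξ ∈ ℒ e' →
      fA a * fL ξ = (e * e').negOnePow • (fL ξ * fA a))
    (comm : ∀ e ξ e' ζ, ξ ∈ ℒ e → ζ ∈ ℒ e' →
      fL ξ * fL ζ = (e * e').negOnePow • (fL ζ * fL ξ)) :
    ∃ φ : SymAlg 𝒜 ℒ →ₐ[K] R, (∀ a, φ (ofA 𝒜 ℒ a) = fA a) ∧ ∀ ξ, φ (ofL 𝒜 ℒ ξ) = fL ξ := by
  have mul' : ∀ a b, fA (a * b) = fA a * fA b := by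
    intro a b
    induction a using Decomposition.inductionOn 𝒜 with
    | zero => simp
    | add x y hx hy => rw [add_mul, map_add, hx, hy, map_add, add_mul]
    | homogeneous a =>
      induction b using Decomposition.inductionOn 𝒜 with
      | zero => simp
      | add x y hx hy => rw [mul_add, map_add, hx, hy, map_add, mul_add]
      | homogeneous b => exact mul _ _ _ _ a.2 b.2
  have smul' : ∀ a ξ, fL (a • ξ) = fA a * fL ξ := by
    intro a ξ
    induction a using Decomposition.inductionOn 𝒜 with
    | zero => simp
    | add x y hx hy => rw [add_smul, map_add, hx, hy, map_add, add_mul]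
    | homogeneous a =>
      induction ξ using Decomposition.inductionOn ℒ with
      | zero => simp
      | add x y hx hy => rw [smul_add, map_add, hx, hy, map_add, mul_add]
      | homogeneous ξ => exact smul _ _ _ _ a.2 ξ.2
  have h : ∀ ⦃x y : TensorAlgebra K (A × L)⦄, SymRel 𝒜 ℒ x y →
      TensorAlgebra.lift K (fA.coprod fL) x = TensorAlgebra.lift K (fA.coprod fL) y := by
    intro x y h
    cases h with
    | one => simp [one]
    | mul a b => simp [mul']
    | smul a ξ => simp [smul']
    | comm_left ha hξ =>
      rw [Units.smul_def, map_zsmul, ← Units.smul_def]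
      simpa using comm_left _ _ _ _ ha hξ
    | comm hξ hζ =>
      rw [Units.smul_def, map_zsmul, ← Units.smul_def]
      simpa using comm _ _ _ _ hξ hζ
  refine ⟨RingQuot.liftAlgHom K ⟨_, h⟩, fun a => ?_, fun ξ => ?_⟩
  · simp only [ofA, LinearMap.comp_apply, AlgHom.toLinearMap_apply]
    rw [RingQuot.liftAlgHom_mkAlgHom_apply]
    simp
  · simp only [ofL, LinearMap.comp_apply, AlgHom.toLinearMap_apply]
    rw [RingQuot.liftAlgHom_mkAlgHom_apply]
    simp

end SymmetricAlgebraStructure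

universe w

/-- An algebra `S` with maps `iA : A → S` and `iL : L → S` which has the universal property of the
graded symmetric algebra. -/
class IsSymAlg {K A L : Type*} {S : Type w} [Field K] [Ring A] [Algebra K A]
    [AddCommGroup L] [Module K L] [Module A L] [Ring S] [Algebra K S] (𝒜 : ℤ → Submodule K A)
    (ℒ : ℤ → Submodule K L) (iA : A →ₗ[K] S) (iL : L →ₗ[K] S) : Prop where
  one : iA 1 = 1
  mul : ∀ a b, iA (a * b) = iA a * iA b
  smul : ∀ a ξ, iA a * iL ξ = iL (a • ξ)
  comm_left : ∀ {i j : ℤ} {a : A} {ξ : L}, a ∈ 𝒜 i → ξ ∈ ℒ j →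
    iA a * iL ξ = (i * j).negOnePow • (iL ξ * iA a)
  comm : ∀ {i j : ℤ} {ξ ζ : L}, ξ ∈ ℒ i → ζ ∈ ℒ j →
    iL ξ * iL ζ = (i * j).negOnePow • (iL ζ * iL ξ)
  induction : ∀ {C : S → Prop}, (∀ a, C (iA a)) → (∀ ξ, C (iL ξ)) →
    (∀ u v, C u → C v → C (u * v)) → (∀ u v, C u → C v → C (u + v)) → ∀ u, C u
  lift : ∀ {R : Type w} [Ring R] [Algebra K R] (fA : A →ₗ[K] R) (fL : L →ₗ[K] R), fA 1 = 1 →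
    (∀ e a e' b, a ∈ 𝒜 e → b ∈ 𝒜 e' → fA (a * b) = fA a * fA b) →
    (∀ e a e' ξ, a ∈ 𝒜 e → ξ ∈ ℒ e' → fL (a • ξ) = fA a * fL ξ) →
    (∀ e a e' ξ, a ∈ 𝒜 e → ξ ∈ ℒ e' → fA a * fL ξ = (e * e').negOnePow • (fL ξ * fA a)) →
    (∀ e ξ e' ζ, ξ ∈ ℒ e → ζ ∈ ℒ e' → fL ξ * fL ζ = (e * e').negOnePow • (fL ζ * fL ξ)) →
    ∃ φ : S →ₐ[K] R, (∀ a, φ (iA a) = fA a) ∧ ∀ ξ, φ (iL ξ) = fL ξ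

/-- The grading and the extension theorem below use only this interface. Lifting within the universe
of `S` suffices, since the targets are `AddMonoidAlgebra S ℤ` and the `2 × 2` matrices over `S`. -/
instance isSymAlg_symAlg {K A L : Type*} [Field K] [Ring A] [Algebra K A]
    [AddCommGroup L] [Module K L] [Module A L] (𝒜 : ℤ → Submodule K A)
    (ℒ : ℤ → Submodule K L) [Decomposition 𝒜] [Decomposition ℒ] :
    IsSymAlg 𝒜 ℒ (ofA 𝒜 ℒ) (ofL 𝒜 ℒ) where
  one := ofA_one
  mul := ofA_mul
  smul := ofA_mul_ofL
  comm_left := ofA_mul_ofL_comm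
  comm := ofL_mul_ofL_comm
  induction := symAlg_induction
  lift := exists_symAlg_lift

/-! ### The grading of the symmetric algebra and its twisted derivations. -/

section SymAlgTheory

variable {K A L S : Type*} [Field K] [Ring A] [Algebra K A] [AddCommGroup L] [Module K L]
  [Module A L] [Ring S] [Algebra K S]

/-- The elements of degree `d`: sums of products `a ζ_1 ⋯ ζ_k` of homogeneous elements with
`|a| + |ζ_1| + ⋯ + |ζ_k| = d`. -/
def genDeg (𝒜 : ℤ → Submodule K A) (ℒ : ℤ → Submodule K L) (iA : A →ₗ[K] S) (iL : L →ₗ[K] S)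
    (d : ℤ) : Submodule K S :=
  Submodule.span K {u | ∃ (e : ℤ) (a : A) (k : ℕ) (n : Fin k → ℤ) (ζ : Fin k → L),
    a ∈ 𝒜 e ∧ (∀ i, ζ i ∈ ℒ (n i)) ∧ e + ∑ i, n i = d ∧
      u = iA a * (List.ofFn fun i => iL (ζ i)).prod}

variable (𝒜 : ℤ → Submodule K A) (ℒ : ℤ → Submodule K L) (iA : A →ₗ[K] S) (iL : L →ₗ[K] S)

local notation "𝒮" => genDeg 𝒜 ℒ iA iL

/-- The homogeneous generators of degree `d` of the graded symmetric algebra. -/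
inductive IsGen (d : ℤ) : S → Prop
  | ofA {a : A} (ha : a ∈ 𝒜 d) : IsGen d (iA a)
  | ofL {ξ : L} (hξ : ξ ∈ ℒ d) : IsGen d (iL ξ)

variable {𝒜 ℒ iA iL} [IsSymAlg 𝒜 ℒ iA iL]
  [GradedAlgebra 𝒜] [GradedCommutative 𝒜] [Decomposition ℒ] [SetLike.GradedSMul 𝒜 ℒ]

theorem ofA_mem_genDeg {e : ℤ} {a : A} (ha : a ∈ 𝒜 e) : iA a ∈ 𝒮 e :=
  Submodule.subset_span ⟨e, a, 0, Fin.elim0, Fin.elim0, ha, fun i => i.elim0, by simp, by simp⟩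

theorem one_mem_genDeg : (1 : S) ∈ 𝒮 0 := by
  rw [← IsSymAlg.one (iA := iA) (iL := iL) (𝒜 := 𝒜) (ℒ := ℒ)]
  exact ofA_mem_genDeg (SetLike.GradedOne.one_mem (A := 𝒜))

theorem ofL_mem_genDeg {e : ℤ} {ξ : L} (hξ : ξ ∈ ℒ e) : iL ξ ∈ 𝒮 e :=
  Submodule.subset_span ⟨0, 1, 1, fun _ => e, fun _ => ξ, SetLike.GradedOne.one_mem,
    fun _ => hξ, by simp, by simp [IsSymAlg.one (iA := iA) (iL := iL) (𝒜 := 𝒜) (ℒ := ℒ)]⟩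

theorem IsGen.mem {d : ℤ} {g : S} (hg : IsGen 𝒜 ℒ iA iL d g) : g ∈ 𝒮 d := by
  cases hg with
  | ofA ha => exact ofA_mem_genDeg ha
  | ofL hξ => exact ofL_mem_genDeg hξ

theorem IsGen.mul_mem {e d : ℤ} {g u : S} (hg : IsGen 𝒜 ℒ iA iL e g)
    (hu : u ∈ 𝒮 d) : g * u ∈ 𝒮 (e + d) := by
  induction hu using Submodule.span_induction with
  | zero => simp
  | add x y _ _ hx hy => rw [mul_add]; exact add_mem hx hy
  | smul c x _ hx => rw [mul_smul_comm]; exact Submodule.smul_mem _ c hx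
  | mem u hu =>
    obtain ⟨i, a, k, n, ζ, ha, hζ, rfl, rfl⟩ := hu
    cases hg with
    | @ofA b hb =>
      rw [← mul_assoc, ← IsSymAlg.mul (iA := iA) (iL := iL) (𝒜 := 𝒜) (ℒ := ℒ), ← add_assoc]
      exact Submodule.subset_span ⟨_, _, k, n, ζ, SetLike.GradedMul.mul_mem hb ha, hζ, rfl, rfl⟩
    | @ofL ξ hξ =>
      -- In the spanning products the factor from `A` stands first, so `ξ` has to be moved across
      -- `a`.
      have h : iL ξ * iA a = (i * e).negOnePow • (iA a * iL ξ) := by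
        rw [IsSymAlg.comm_left (iA := iA) (iL := iL) ha hξ, smul_smul, ← Int.negOnePow_add, negOnePow_congr (n := 0)]
        · simp
        · grind
      rw [← mul_assoc, h, smul_mul_assoc, mul_assoc, Units.smul_def]
      have hm : iA a * (iL ξ * (List.ofFn fun i => iL (ζ i)).prod) ∈ 𝒮 (e + (i + ∑ j, n j)) := by
        refine Submodule.subset_span ⟨i, a, k + 1, Fin.cons e n, Fin.cons ξ ζ, ha,
          homog_fin_cons hζ hξ, ?_, ?_⟩
        · rw [Fin.sum_univ_succ]; simp [add_left_comm]
        · simp [List.ofFn_succ]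
      exact zsmul_mem hm _

theorem prod_mul_mem_genDeg {k : ℕ} {n : Fin k → ℤ} {ζ : Fin k → L} (hζ : ∀ i, ζ i ∈ ℒ (n i))
    {d : ℤ} {u : S} (hu : u ∈ 𝒮 d) :
    (List.ofFn fun i => iL (ζ i)).prod * u ∈ 𝒮 (∑ i, n i + d) := by
  induction k with
  | zero => simpa using hu
  | succ k ih =>
    rw [List.ofFn_succ, List.prod_cons, Fin.sum_univ_succ, mul_assoc, add_assoc]
    exact (IsGen.ofL (hζ 0)).mul_mem (ih fun i => hζ i.succ)

theorem mul_mem_genDeg {d e : ℤ} {u v : S} (hu : u ∈ 𝒮 d)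
    (hv : v ∈ 𝒮 e) : u * v ∈ 𝒮 (d + e) := by
  induction hu using Submodule.span_induction with
  | zero => simp
  | add x y _ _ hx hy => rw [add_mul]; exact add_mem hx hy
  | smul c x _ hx => rw [smul_mul_assoc]; exact Submodule.smul_mem _ c hx
  | mem u hu =>
    obtain ⟨i, a, k, n, ζ, ha, hζ, rfl, rfl⟩ := hu
    rw [mul_assoc, add_assoc]
    exact (IsGen.ofA ha).mul_mem (prod_mul_mem_genDeg hζ hv)

/-- The degree belongs to the motive because the statements proved in this way carry signs depending
on it. -/
theorem genDeg_induction {C : ℤ → S → Prop} (gen : ∀ d g, IsGen 𝒜 ℒ iA iL d g → C d g)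
    (zero : ∀ d, C d 0)
    (add : ∀ d x y, x ∈ 𝒮 d → y ∈ 𝒮 d → C d x → C d y → C d (x + y))
    (smul : ∀ d (c : K) x, x ∈ 𝒮 d → C d x → C d (c • x))
    (mul : ∀ d x e y, x ∈ 𝒮 d → y ∈ 𝒮 e → C d x → C e y → C (d + e) (x * y))
    {d : ℤ} {u : S} (hu : u ∈ 𝒮 d) : C d u := by
  have hprod : ∀ (k : ℕ) (n : Fin k → ℤ) (ζ : Fin k → L), (∀ i, ζ i ∈ ℒ (n i)) →
      (List.ofFn fun i => iL (ζ i)).prod ∈ 𝒮 (∑ i, n i) ∧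
      C (∑ i, n i) (List.ofFn fun i => iL (ζ i)).prod := by
    intro k n ζ hζ
    refine ⟨by simpa using prod_mul_mem_genDeg hζ (one_mem_genDeg (iA := iA)), ?_⟩
    induction k with
    | zero => simpa [IsSymAlg.one (iA := iA) (iL := iL) (𝒜 := 𝒜) (ℒ := ℒ)] using gen 0 _ (.ofA (SetLike.GradedOne.one_mem (A := 𝒜)))
    | succ k ih =>
      rw [List.ofFn_succ, List.prod_cons, Fin.sum_univ_succ]
      refine mul _ _ _ _ (ofL_mem_genDeg (hζ 0)) ?_ (gen _ _ (.ofL (hζ 0)))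
        (ih _ _ fun i => hζ i.succ)
      simpa using prod_mul_mem_genDeg (fun i => hζ i.succ) (one_mem_genDeg (iA := iA))
  induction hu using Submodule.span_induction with
  | zero => exact zero d
  | add x y hx hy h h' => exact add d x y hx hy h h'
  | smul c x hx h => exact smul d c x hx h
  | mem u hu =>
    obtain ⟨i, a, k, n, ζ, ha, hζ, rfl, rfl⟩ := hu
    exact mul _ _ _ _ (ofA_mem_genDeg ha) (hprod k n ζ hζ).1 (gen _ _ (.ofA ha))
      (hprod k n ζ hζ).2

theorem symAlg_mul_comm {i j : ℤ} {u v : S} (hu : u ∈ 𝒮 i)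
    (hv : v ∈ 𝒮 j) : u * v = (i * j).negOnePow • (v * u) := by
  refine genDeg_induction (C := fun i u => u * v = (i * j).negOnePow • (v * u))
    ?_ (fun _ => by simp) ?_ ?_ ?_ hu
  · intro i g hg
    refine genDeg_induction (C := fun j v => g * v = (i * j).negOnePow • (v * g))
      ?_ (fun _ => by simp) ?_ ?_ ?_ hv
    · intro j g' hg'
      cases hg with
      | @ofA a ha =>
        cases hg' with
        | @ofA b hb =>
          rw [← IsSymAlg.mul (iA := iA) (iL := iL) (𝒜 := 𝒜) (ℒ := ℒ), ← IsSymAlg.mul (iA := iA) (iL := iL) (𝒜 := 𝒜) (ℒ := ℒ), GradedCommutative.comm ha hb, Units.smul_def, map_zsmul,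
            ← Units.smul_def]
        | @ofL ξ hξ => exact IsSymAlg.comm_left (iA := iA) (iL := iL) ha hξ
      | @ofL ξ hξ =>
        cases hg' with
        | @ofA b hb =>
          rw [IsSymAlg.comm_left (iA := iA) (iL := iL) hb hξ, smul_smul, ← Int.negOnePow_add, negOnePow_congr (n := 0)]
          · simp
          · grind
        | @ofL ζ hζ => exact IsSymAlg.comm (𝒜 := 𝒜) (iA := iA) hξ hζ
    · intro d x y _ _ hx hy
      rw [mul_add, add_mul, hx, hy, smul_add]
    · intro d c x _ hx
      rw [mul_smul_comm, smul_mul_assoc, hx, smul_comm]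
    · intro d x e y _ _ hx hy
      rw [← mul_assoc, hx, smul_mul_assoc, mul_assoc, hy, mul_smul_comm, smul_smul,
        ← Int.negOnePow_add, mul_assoc, mul_add]
  · intro d x y _ _ hx hy
    rw [mul_add, add_mul, hx, hy, smul_add]
  · intro d c x _ hx
    rw [mul_smul_comm, smul_mul_assoc, hx, smul_comm]
  · intro d x e y _ _ hx hy
    rw [mul_assoc, hy, mul_smul_comm, ← mul_assoc, hx, smul_mul_assoc, mul_assoc, smul_smul,
      ← Int.negOnePow_add, add_mul, add_comm]

/-- The grading is encoded as the coaction `u ↦ u t^d` of the Laurent polynomials. It exists by the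
universal property, because all defining relations are homogeneous. -/
theorem exists_coaction : ∃ φ : S →ₐ[K] AddMonoidAlgebra (S) ℤ,
    ∀ d u, u ∈ 𝒮 d → φ u = AddMonoidAlgebra.single d u := by
  obtain ⟨fA, hA⟩ := exists_linearMap_of_homog (K := K) (ℳ := 𝒜)
    (fun e a => (AddMonoidAlgebra.single e (iA a) : AddMonoidAlgebra (S) ℤ))
    (fun e x y _ _ => by rw [map_add, AddMonoidAlgebra.single_add])
    (fun e c x _ => by rw [map_smul, AddMonoidAlgebra.smul_single])
  obtain ⟨fL, hL⟩ := exists_linearMap_of_homog (K := K) (ℳ := ℒ)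
    (fun e a => (AddMonoidAlgebra.single e (iL a) : AddMonoidAlgebra (S) ℤ))
    (fun e x y _ _ => by rw [map_add, AddMonoidAlgebra.single_add])
    (fun e c x _ => by rw [map_smul, AddMonoidAlgebra.smul_single])
  obtain ⟨φ, hφA, hφL⟩ := IsSymAlg.lift (iA := iA) (iL := iL) (𝒜 := 𝒜) (ℒ := ℒ) (R := AddMonoidAlgebra S ℤ) fA fL
    (by rw [hA 0 1 SetLike.GradedOne.one_mem, IsSymAlg.one (iA := iA) (iL := iL) (𝒜 := 𝒜) (ℒ := ℒ)]; rfl)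
    (fun e a e' b ha hb => by
      rw [hA _ _ ha, hA _ _ hb, hA _ _ (SetLike.GradedMul.mul_mem ha hb),
        AddMonoidAlgebra.single_mul_single, IsSymAlg.mul (iA := iA) (iL := iL) (𝒜 := 𝒜) (ℒ := ℒ)])
    (fun e a e' ξ ha hξ => by
      rw [hA _ _ ha, hL _ _ hξ, hL _ _ (SetLike.GradedSMul.smul_mem ha hξ),
        AddMonoidAlgebra.single_mul_single, IsSymAlg.smul (iA := iA) (iL := iL) (𝒜 := 𝒜) (ℒ := ℒ)]; rfl)
    (fun e a e' ξ ha hξ => by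
      rw [hA _ _ ha, hL _ _ hξ, AddMonoidAlgebra.single_mul_single,
        AddMonoidAlgebra.single_mul_single, IsSymAlg.comm_left (iA := iA) (iL := iL) ha hξ, add_comm e',
        Units.smul_def, Units.smul_def, AddMonoidAlgebra.smul_single])
    (fun e a e' ξ ha hξ => by
      rw [hL _ _ ha, hL _ _ hξ, AddMonoidAlgebra.single_mul_single,
        AddMonoidAlgebra.single_mul_single, IsSymAlg.comm (𝒜 := 𝒜) (iA := iA) ha hξ, add_comm e',
        Units.smul_def, Units.smul_def, AddMonoidAlgebra.smul_single])
  refine ⟨φ, fun d u hu => genDeg_induction (C := fun d u => φ u = AddMonoidAlgebra.single d u)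
    ?_ (fun _ => by simp) ?_ ?_ ?_ hu⟩
  · intro d g hg
    cases hg with
    | ofA ha => rw [hφA, hA _ _ ha]
    | ofL hξ => rw [hφL, hL _ _ hξ]
  · intro d x y _ _ hx hy
    rw [map_add, hx, hy, AddMonoidAlgebra.single_add]
  · intro d c x _ hx
    rw [map_smul, hx, AddMonoidAlgebra.smul_single]
  · intro d x e y _ _ hx hy
    rw [map_mul, hx, hy, AddMonoidAlgebra.single_mul_single]

theorem iSup_genDeg : ⨆ d, 𝒮 d = ⊤ := by
  rw [eq_top_iff]
  intro u _
  refine IsSymAlg.induction (𝒜 := 𝒜) (ℒ := ℒ) (iA := iA) (iL := iL)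
    (C := fun u => u ∈ (⊤ : Submodule K S) → u ∈ ⨆ d, 𝒮 d) ?_ ?_ ?_ ?_ u trivial
  · intro a _
    induction a using Decomposition.inductionOn 𝒜 with
    | zero => simp
    | add x y hx hy => rw [map_add]; exact add_mem (hx trivial) (hy trivial)
    | homogeneous a => exact Submodule.mem_iSup_of_mem _ (ofA_mem_genDeg a.2)
  · intro ξ _
    induction ξ using Decomposition.inductionOn ℒ with
    | zero => simp
    | add x y hx hy => rw [map_add]; exact add_mem (hx trivial) (hy trivial)
    | homogeneous ξ => exact Submodule.mem_iSup_of_mem _ (ofL_mem_genDeg ξ.2)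
  · intro u v hu hv _
    refine Submodule.iSup_induction (motive := fun u => u * v ∈ _) _ (hu trivial) ?_ (by simp)
      fun x y hx hy => by rw [add_mul]; exact add_mem hx hy
    intro i x hx
    refine Submodule.iSup_induction (motive := fun v => x * v ∈ _) _ (hv trivial) ?_ (by simp)
      fun y z hy hz => by rw [mul_add]; exact add_mem hy hz
    exact fun j y hy => Submodule.mem_iSup_of_mem _ (mul_mem_genDeg hx hy)
  · exact fun u v hu hv _ => add_mem (hu trivial) (hv trivial)

/-- The coefficient of `t^d` in the coaction recovers the component of degree `d`, so a
decomposition into homogeneous parts is unique. Existence is `iSup_genDeg`. -/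
theorem isInternal_genDeg : DirectSum.IsInternal (𝒮) := by
  obtain ⟨φ, hφ⟩ := exists_coaction (𝒜 := 𝒜) (ℒ := ℒ) (iA := iA) (iL := iL)
  constructor
  · have key : ∀ (z : ⨁ d, 𝒮 d) (d : ℤ),
        (φ (DirectSum.coeAddMonoidHom (𝒮) z)).coeff d = z d := by
      intro z d
      induction z using DirectSum.induction_on with
      | zero => simp
      | of i x =>
        rw [DirectSum.coeAddMonoidHom_of, hφ _ _ x.2, DirectSum.coe_of_apply]
        rw [AddMonoidAlgebra.coeff_single, Finsupp.single_apply]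
        split_ifs with h <;> simp
      | add x y hx hy => simp [hx, hy]
    intro z z' h
    refine DFinsupp.ext fun d => Subtype.ext ?_
    rw [← key z d, ← key z' d, h]
  · intro u
    have hu : u ∈ ⨆ d, 𝒮 d := by rw [iSup_genDeg]; trivial
    refine Submodule.iSup_induction
      (motive := fun u => ∃ z, DirectSum.coeAddMonoidHom (𝒮) z = u) _ hu ?_
      ⟨0, map_zero _⟩ ?_
    · exact fun i x hx => ⟨DirectSum.of _ i ⟨x, hx⟩, DirectSum.coeAddMonoidHom_of _ _ _⟩
    · rintro _ _ ⟨x, rfl⟩ ⟨y, rfl⟩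
      exact ⟨x + y, map_add _ _ _⟩

noncomputable instance genDegDecomposition : Decomposition (𝒮) :=
  isInternal_genDeg.chooseDecomposition _

/-- The sign is multiplicative in `d`, so the parity twist is an algebra homomorphism. Such twists
are the diagonal entries of the matrices used for twisted derivations. -/
theorem exists_twist (δ : ℤ) : ∃ α : S →ₐ[K] S,
    ∀ d u, u ∈ 𝒮 d → α u = (δ * d).negOnePow • u := by
  obtain ⟨α, hα⟩ := exists_linearMap_of_homog (K := K) (ℳ := 𝒮)
    (fun d u => (δ * d).negOnePow • u) (fun _ _ _ _ _ => smul_add _ _ _)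
    (fun _ _ _ _ => smul_comm _ _ _)
  refine ⟨AlgHom.ofLinearMap α ?_ ?_, hα⟩
  · rw [hα 0 1 one_mem_genDeg]
    simp
  · intro u v
    induction u using Decomposition.inductionOn (𝒮) with
    | zero => simp
    | add x y hx hy => rw [add_mul, map_add, hx, hy, map_add, add_mul]
    | @homogeneous i u =>
      induction v using Decomposition.inductionOn (𝒮) with
      | zero => simp
      | add x y hx hy => rw [mul_add, map_add, hx, hy, map_add, mul_add]
      | @homogeneous j v =>
        rw [hα _ _ u.2, hα _ _ v.2, hα _ _ (mul_mem_genDeg u.2 v.2), smul_mul_assoc,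
          mul_smul_comm, smul_smul, ← Int.negOnePow_add, mul_add]

/-- Extension of a pair of maps on generators to a twisted derivation of the graded symmetric
algebra. -/
theorem exists_twistedDerivation (δ ρ : ℤ) (dA : ℤ → A → S) (dL : ℤ → L → S)
    (dA_add : ∀ e a b, a ∈ 𝒜 e → b ∈ 𝒜 e → dA e (a + b) = dA e a + dA e b)
    (dA_smul : ∀ e (c : K) a, a ∈ 𝒜 e → dA e (c • a) = c • dA e a)
    (dL_add : ∀ e ξ ζ, ξ ∈ ℒ e → ζ ∈ ℒ e → dL e (ξ + ζ) = dL e ξ + dL e ζ)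
    (dL_smul : ∀ e (c : K) ξ, ξ ∈ ℒ e → dL e (c • ξ) = c • dL e ξ)
    (dA_mem : ∀ e a, a ∈ 𝒜 e → dA e a ∈ 𝒮 (δ + e + ρ))
    (dL_mem : ∀ e ξ, ξ ∈ ℒ e → dL e ξ ∈ 𝒮 (δ + e + ρ))
    (mul : ∀ e a e' b, a ∈ 𝒜 e → b ∈ 𝒜 e' → dA (e + e') (a * b) =
      (δ * e).negOnePow • (iA a * dA e' b) + (ρ * e').negOnePow • (dA e a * iA b))
    (smul : ∀ e a e' ξ, a ∈ 𝒜 e → ξ ∈ ℒ e' → dL (e + e') (a • ξ) =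
      (δ * e).negOnePow • (iA a * dL e' ξ) + (ρ * e').negOnePow • (dA e a * iL ξ)) :
    ∃ D : S →ₗ[K] S, (∀ e a, a ∈ 𝒜 e → D (iA a) = dA e a) ∧
      (∀ e ξ, ξ ∈ ℒ e → D (iL ξ) = dL e ξ) ∧
      ∀ d x e y, x ∈ 𝒮 d → y ∈ 𝒮 e → D (x * y) =
        (δ * d).negOnePow • (x * D y) + (ρ * e).negOnePow • (D x * y) := by
  obtain ⟨α, hα⟩ := exists_twist (𝒜 := 𝒜) (ℒ := ℒ) (iA := iA) (iL := iL) δ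
  obtain ⟨β, hβ⟩ := exists_twist (𝒜 := 𝒜) (ℒ := ℒ) (iA := iA) (iL := iL) ρ
  obtain ⟨DA, hDA⟩ := exists_linearMap_of_homog (K := K) (ℳ := 𝒜) dA dA_add dA_smul
  obtain ⟨DL, hDL⟩ := exists_linearMap_of_homog (K := K) (ℳ := ℒ) dL dL_add dL_smul
  -- For an algebra homomorphism into upper triangular matrices with diagonal `(α, β)`,
  -- multiplicativity of the off-diagonal entry `D` reads `D(xy) = α(x) D(y) + D(x) β(y)`, which is
  -- the twisted Leibniz rule. The universal property therefore produces `D` from its values on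
  -- generators.
  let ΦA : A →ₗ[K] Matrix (Fin 2) (Fin 2) S :=
    { toFun := fun x => !![α (iA x), DA x; 0, β (iA x)]
      map_add' := fun x y => by simp
      map_smul' := fun c x => by simp }
  let ΦL : L →ₗ[K] Matrix (Fin 2) (Fin 2) S :=
    { toFun := fun x => !![α (iL x), DL x; 0, β (iL x)]
      map_add' := fun x y => by simp
      map_smul' := fun c x => by simp }
  -- The matrices satisfy the same graded commutation relations as the generators precisely because
  -- the off-diagonal entries have degree `δ + e + ρ`, in accordance with both twists.
  have hcomm : ∀ (e e' : ℤ) (u v u' v' : S), u ∈ 𝒮 e → v ∈ 𝒮 e' →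
      u' ∈ 𝒮 (δ + e + ρ) → v' ∈ 𝒮 (δ + e' + ρ) →
      !![α u, u'; 0, β u] * !![α v, v'; 0, β v] =
        (e * e').negOnePow • (!![α v, v'; 0, β v] * !![α u, u'; 0, β u]) := by
    intro e e' u v u' v' hu hv hu' hv'
    have hoff : α u * v' + u' * β v = (e * e').negOnePow • (α v * u' + v' * β u) := by
      rw [hα _ _ hu, hα _ _ hv, hβ _ _ hu, hβ _ _ hv, smul_mul_assoc, smul_mul_assoc,
        mul_smul_comm, mul_smul_comm, symAlg_mul_comm hu hv', symAlg_mul_comm hu' hv, smul_add,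
        add_comm]
      simp only [smul_smul, ← Int.negOnePow_add]
      rw [negOnePow_congr (m := ρ * e' + (δ + e + ρ) * e') (n := e * e' + δ * e') (by grind),
        negOnePow_congr (m := δ * e + e * (δ + e' + ρ)) (n := e * e' + ρ * e) (by grind)]
    have hd : ∀ γ : S →ₐ[K] S, γ u * γ v = (e * e').negOnePow • (γ v * γ u) := fun γ => by
      rw [← map_mul, symAlg_mul_comm hu hv, Units.smul_def, map_zsmul, map_mul, Units.smul_def]
    rw [Matrix.mul_fin_two, Matrix.mul_fin_two]
    simp only [zero_mul, mul_zero, add_zero, zero_add]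
    rw [hoff, hd, hd]
    ext i j
    fin_cases i <;> fin_cases j <;> simp
  obtain ⟨φ, hφA, hφL⟩ : ∃ φ : S →ₐ[K] Matrix (Fin 2) (Fin 2) S,
      (∀ a, φ (iA a) = ΦA a) ∧ ∀ ξ, φ (iL ξ) = ΦL ξ := by
    refine IsSymAlg.lift (iA := iA) (iL := iL) (𝒜 := 𝒜) (ℒ := ℒ) ΦA ΦL ?_ ?_ ?_ ?_ ?_
    -- The product rule at `1 * 1` gives `dA 0 1 = dA 0 1 + dA 0 1`.
    · have h1 : dA 0 1 = 0 := by
        have := mul 0 1 0 1 SetLike.GradedOne.one_mem SetLike.GradedOne.one_mem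
        simpa [IsSymAlg.one (iA := iA) (iL := iL) (𝒜 := 𝒜) (ℒ := ℒ)] using this
      change !![α (iA 1), DA 1; 0, β (iA 1)] = 1
      rw [hDA _ _ SetLike.GradedOne.one_mem, h1, IsSymAlg.one (iA := iA) (iL := iL) (𝒜 := 𝒜) (ℒ := ℒ), map_one, map_one, Matrix.one_fin_two]
    · intro e a e' b ha hb
      change !![α (iA (a * b)), DA (a * b); 0, β (iA (a * b))] =
        !![α (iA a), DA a; 0, β (iA a)] * !![α (iA b), DA b; 0, β (iA b)]
      rw [hDA _ _ ha, hDA _ _ hb, hDA _ _ (SetLike.GradedMul.mul_mem ha hb),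
        mul _ _ _ _ ha hb, Matrix.mul_fin_two, IsSymAlg.mul (iA := iA) (iL := iL) (𝒜 := 𝒜) (ℒ := ℒ)]
      simp [hα _ _ (ofA_mem_genDeg ha), hβ _ _ (ofA_mem_genDeg hb), smul_mul_assoc, mul_smul_comm]
    · intro e a e' ξ ha hξ
      change !![α (iL (a • ξ)), DL (a • ξ); 0, β (iL (a • ξ))] =
        !![α (iA a), DA a; 0, β (iA a)] * !![α (iL ξ), DL ξ; 0, β (iL ξ)]
      rw [hDA _ _ ha, hDL _ _ hξ, hDL (e + e') _ (SetLike.GradedSMul.smul_mem ha hξ),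
        smul _ _ _ _ ha hξ, Matrix.mul_fin_two, ← IsSymAlg.smul (iA := iA) (iL := iL) (𝒜 := 𝒜) (ℒ := ℒ)]
      simp [hα _ _ (ofA_mem_genDeg ha), hβ _ _ (ofL_mem_genDeg hξ), smul_mul_assoc, mul_smul_comm]
    · intro e a e' ξ ha hξ
      refine hcomm e e' _ _ _ _ (ofA_mem_genDeg ha) (ofL_mem_genDeg hξ) ?_ ?_
      · rw [hDA _ _ ha]; exact dA_mem _ _ ha
      · rw [hDL _ _ hξ]; exact dL_mem _ _ hξ
    · intro e a e' ξ ha hξ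
      refine hcomm e e' _ _ _ _ (ofL_mem_genDeg ha) (ofL_mem_genDeg hξ) ?_ ?_
      · rw [hDL _ _ ha]; exact dL_mem _ _ ha
      · rw [hDL _ _ hξ]; exact dL_mem _ _ hξ
  -- The triangular shape and the diagonal are known on generators and pass to sums and products;
  -- only then can the Leibniz rule be read off the corner entry.
  have htri : ∀ u, φ u = !![α u, φ u 0 1; 0, β u] := by
    refine IsSymAlg.induction (𝒜 := 𝒜) (ℒ := ℒ) (iA := iA) (iL := iL) ?_ ?_ ?_ ?_
    · intro a; rw [hφA]; rfl
    · intro ξ; rw [hφL]; rfl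
    · intro u v hu hv; rw [map_mul, hu, hv, Matrix.mul_fin_two]; simp
    · intro u v hu hv; rw [map_add, hu, hv]; simp
  refine ⟨{ toFun := fun u => φ u 0 1, map_add' := fun x y => by simp,
            map_smul' := fun c x => by simp }, fun e a ha => ?_, fun e ξ hξ => ?_,
            fun d x e y hx hy => ?_⟩
  · change φ (iA a) 0 1 = _
    rw [hφA, ← hDA _ _ ha]; rfl
  · change φ (iL ξ) 0 1 = _
    rw [hφL, ← hDL _ _ hξ]; rfl
  · change φ (x * y) 0 1 = (δ * d).negOnePow • (x * φ y 0 1) +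
      (ρ * e).negOnePow • (φ x 0 1 * y)
    rw [map_mul, htri x, htri y, Matrix.mul_fin_two]
    simp only [Matrix.cons_val', Matrix.cons_val_zero, Matrix.cons_val_one, Matrix.of_apply,
      hα _ _ hx, hβ _ _ hy, smul_mul_assoc, mul_smul_comm, Matrix.cons_val_fin_one]

instance genDeg_gradedMonoid : SetLike.GradedMonoid (𝒮) where
  one_mem := one_mem_genDeg
  mul_mem _ _ _ _ hu hv := mul_mem_genDeg hu hv

instance genDeg_gradedCommutative : GradedCommutative (𝒮) := ⟨fun hu hv => symAlg_mul_comm hu hv⟩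

end SymAlgTheory

theorem negOnePow_smul_congr {M : Type*} [AddCommGroup M] {m n : ℤ} (h : Even (m - n)) {x : M} :
    m.negOnePow • x = n.negOnePow • x := by rw [negOnePow_congr h]

/-! ### Multiderivations of graded algebras -/

section MultiderivationTheory

variable {K S R : Type*} [Field K] [Ring S] [Algebra K S] [Ring R] [Algebra K R]

/-- A function of lists of `k` homogeneous elements of the graded algebra `S`, with values in the
`S`-algebra `R`, is a graded symmetric multiderivation of degree `δ`. -/
structure IsMultiDer (ℳ : ℤ → Submodule K S) (ρ : S →ₐ[K] R) (k : ℕ) (δ : ℤ)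
    (F : List (ℤ × S) → R) : Prop where
  lin : SlotLinear ℳ k F
  symm : SwapSymm ℳ k F
  leib : ∀ (d : ℤ) (x : S) (e : ℤ) (y : S) (r : List (ℤ × S)), r.length + 1 = k →
    x ∈ ℳ d → y ∈ ℳ e → Homog ℳ r → F ((d + e, x * y) :: r) =
      (d * δ).negOnePow • (ρ x * F ((e, y) :: r)) +
        (e * dg r).negOnePow • (F ((d, x) :: r) * ρ y)

variable {ℳ : ℤ → Submodule K S} {ρ : S →ₐ[K] R} {k : ℕ} {δ : ℤ} {F G : List (ℤ × S) → R}

theorem SlotLinear.addFun {M N : Type*} [AddCommGroup M] [Module K M] [AddCommGroup N]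
    [Module K N] {ℳ : ℤ → Submodule K M} {f g : List (ℤ × M) → N}
    (hf : SlotLinear ℳ k f) (hg : SlotLinear ℳ k g) : SlotLinear ℳ k (fun l => f l + g l) :=
  ⟨fun l r e x y h1 h2 h3 h4 h5 => by
      rw [hf.add l r e x y h1 h2 h3 h4 h5, hg.add l r e x y h1 h2 h3 h4 h5, add_add_add_comm],
    fun l r e c x h1 h2 h3 h4 => by
      rw [hf.smul l r e c x h1 h2 h3 h4, hg.smul l r e c x h1 h2 h3 h4, smul_add]⟩

theorem SlotLinear.comp {M N N' : Type*} [AddCommGroup M] [Module K M] [AddCommGroup N]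
    [Module K N] [AddCommGroup N'] [Module K N'] {ℳ : ℤ → Submodule K M} {f : List (ℤ × M) → N}
    (hf : SlotLinear ℳ k f) (φ : N →ₗ[K] N') : SlotLinear ℳ k (fun l => φ (f l)) :=
  ⟨fun l r e x y h1 h2 h3 h4 h5 => by rw [hf.add l r e x y h1 h2 h3 h4 h5, map_add],
    fun l r e c x h1 h2 h3 h4 => by rw [hf.smul l r e c x h1 h2 h3 h4, map_smul]⟩

theorem SlotLinear.zero_slot {M N : Type*} [AddCommGroup M] [Module K M] [AddCommGroup N]
    [Module K N] {ℳ : ℤ → Submodule K M} {f : List (ℤ × M) → N} (hf : SlotLinear ℳ k f)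
    (l r : List (ℤ × M)) (e : ℤ) (hk : l.length + r.length + 1 = k) (hl : Homog ℳ l)
    (hr : Homog ℳ r) : f (l ++ (e, 0) :: r) = 0 := by
  simpa using hf.smul l r e 0 0 hk hl hr (zero_mem _)

theorem SlotLinear.dg_smul {M N : Type*} [AddCommGroup M] [Module K M] [AddCommGroup N]
    [Module K N] {ℳ : ℤ → Submodule K M} {f : List (ℤ × M) → N}
    (hf : SlotLinear ℳ k f) (c : ℤ) :
    SlotLinear ℳ k (fun l => (c * dg l).negOnePow • f l) :=
  ⟨fun l r e x y h1 h2 h3 h4 h5 => by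
      simp only [hf.add l r e x y h1 h2 h3 h4 h5, dg_append, dg_cons, smul_add],
    fun l r e c x h1 h2 h3 h4 => by
      simp only [hf.smul l r e c x h1 h2 h3 h4, dg_append, dg_cons, smul_comm c]⟩

theorem SwapSymm.dg_smul {M N : Type*} [AddCommGroup M] [Module K M] [AddCommGroup N]
    [Module K N] {ℳ : ℤ → Submodule K M} {f : List (ℤ × M) → N}
    (hf : SwapSymm ℳ k f) (c : ℤ) :
    SwapSymm ℳ k (fun l => (c * dg l).negOnePow • f l) := fun l h h' r h1 h2 h3 h4 h5 => by
  simp only [hf l h h' r h1 h2 h3 h4 h5, dg_append, dg_cons]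
  rw [smul_comm, add_left_comm h.1]

theorem SwapSymm.addFun {M N : Type*} [AddCommGroup M] [Module K M] [AddCommGroup N]
    [Module K N] {ℳ : ℤ → Submodule K M} {f g : List (ℤ × M) → N}
    (hf : SwapSymm ℳ k f) (hg : SwapSymm ℳ k g) : SwapSymm ℳ k (fun l => f l + g l) :=
  fun l h h' r h1 h2 h3 h4 h5 => by
    beta_reduce
    rw [hf l h h' r h1 h2 h3 h4 h5, hg l h h' r h1 h2 h3 h4 h5, smul_add]

theorem SwapSymm.comp {M N N' : Type*} [AddCommGroup M] [Module K M] [AddCommGroup N]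
    [Module K N] [AddCommGroup N'] [Module K N'] {ℳ : ℤ → Submodule K M} {f : List (ℤ × M) → N}
    (hf : SwapSymm ℳ k f) (φ : N →ₗ[K] N') : SwapSymm ℳ k (fun l => φ (f l)) :=
  fun l h h' r h1 h2 h3 h4 h5 => by
    beta_reduce
    rw [hf l h h' r h1 h2 h3 h4 h5, Units.smul_def, map_zsmul, ← Units.smul_def]

theorem IsMultiDer.zero : IsMultiDer ℳ ρ k δ fun _ => 0 :=
  ⟨⟨by simp, by simp⟩, fun _ _ _ _ _ _ _ _ _ => by simp, fun _ _ _ _ _ _ _ _ _ => by simp⟩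

theorem IsMultiDer.add (hF : IsMultiDer ℳ ρ k δ F) (hG : IsMultiDer ℳ ρ k δ G) :
    IsMultiDer ℳ ρ k δ fun l => F l + G l where
  lin := hF.lin.addFun hG.lin
  symm := hF.symm.addFun hG.symm
  leib d x e y r hk hx hy hr := by
    simp only [hF.leib d x e y r hk hx hy hr, hG.leib d x e y r hk hx hy hr, mul_add, add_mul,
      smul_add]
    abel

theorem IsMultiDer.smul (hF : IsMultiDer ℳ ρ k δ F) (c : K) :
    IsMultiDer ℳ ρ k δ fun l => c • F l where
  lin := hF.lin.comp (LinearMap.lsmul K R c)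
  symm := hF.symm.comp (LinearMap.lsmul K R c)
  leib d x e y r hk hx hy hr := by
    rw [hF.leib d x e y r hk hx hy hr, smul_add, smul_comm c, smul_comm c, mul_smul_comm,
      smul_mul_assoc]

theorem IsMultiDer.negOnePow_smul (hF : IsMultiDer ℳ ρ k δ F) (n : ℤ) :
    IsMultiDer ℳ ρ k δ fun l => n.negOnePow • F l := by
  rcases Int.units_eq_one_or n.negOnePow with h | h
  · simpa [h] using hF
  · simpa [h] using hF.smul (-1)

theorem IsMultiDer.congr_degree {δ' : ℤ} (h : δ = δ') (hF : IsMultiDer ℳ ρ k δ F) :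
    IsMultiDer ℳ ρ k δ' F := h ▸ hF

/-- The Leibniz rule concerns the head entry, so the fixed entry `h` is exchanged with its neighbour
before and after applying it. The crossing makes `h` count towards the degree of the operation. -/
theorem IsMultiDer.cons [SetLike.GradedMonoid ℳ] (hF : IsMultiDer ℳ ρ (k + 1) δ F) {h : ℤ × S}
    (hh : h.2 ∈ ℳ h.1) :
    IsMultiDer ℳ ρ k (δ + h.1) fun l => F (h :: l) where
  lin := hF.lin.cons hh
  symm := hF.symm.cons hh
  leib d x e y r hk hx hy hr := by
    have s := fun (e : ℤ) (x : S) (hx : x ∈ ℳ e) =>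
      hF.symm [] h (e, x) r (by simpa using hk) (homog_nil ℳ) hh hx hr
    simp only [List.nil_append] at s
    rw [s _ _ (SetLike.GradedMul.mul_mem hx hy), s _ _ hx, s _ _ hy,
      hF.leib d x e y (h :: r) (by simpa using hk) hx hy ((homog_cons ℳ _ _).2 ⟨hh, hr⟩)]
    simp only [smul_add, smul_smul, ← Int.negOnePow_add, mul_smul_comm, smul_mul_assoc, dg_cons]
    refine congrArg₂ _ (negOnePow_smul_congr ?_) (negOnePow_smul_congr ?_) <;> grind

theorem IsMultiDer.map {F : List (ℤ × S) → S} (hF : IsMultiDer ℳ (AlgHom.id K S) k δ F)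
    (ρ : S →ₐ[K] R) : IsMultiDer ℳ ρ k δ fun l => ρ (F l) where
  lin := hF.lin.comp ρ.toLinearMap
  symm := hF.symm.comp ρ.toLinearMap
  leib d x e y r hk hx hy hr := by
    rw [hF.leib d x e y r hk hx hy hr, map_add, Units.smul_def, Units.smul_def, map_zsmul,
      map_zsmul, map_mul, map_mul]
    rfl

theorem map_mul_comm [GradedCommutative ℳ] (ρ : S →ₐ[K] R) {d e : ℤ} {x y : S} (hx : x ∈ ℳ d)
    (hy : y ∈ ℳ e) : ρ x * ρ y = (d * e).negOnePow • (ρ y * ρ x) := by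
  rw [← map_mul, GradedCommutative.comm hx hy, Units.smul_def, map_zsmul, map_mul, Units.smul_def]

/-- Left and right multiples are the two terms of the Leibniz rule in an entry preceding those of
`l`. Hence both sides of such a rule can be compared as multiderivations in the remaining entries.
-/
theorem IsMultiDer.mul_left [GradedCommutative ℳ]
    (hF : IsMultiDer ℳ ρ k δ F) {γ : ℤ} {c : S} (hc : c ∈ ℳ γ) :
    IsMultiDer ℳ ρ k (δ + γ) fun l => ρ c * F l where
  lin := hF.lin.comp (LinearMap.mulLeft K (ρ c))
  symm := hF.symm.comp (LinearMap.mulLeft K (ρ c))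
  leib d x e y r hk hx hy hr := by
    rw [hF.leib d x e y r hk hx hy hr, mul_add, mul_smul_comm, mul_smul_comm, ← mul_assoc, map_mul_comm ρ hc hx]
    simp only [smul_smul, ← Int.negOnePow_add, smul_mul_assoc, mul_assoc]
    refine congrArg₂ _ (negOnePow_smul_congr ?_) rfl
    grind

theorem IsMultiDer.mul_right [GradedCommutative ℳ]
    (hF : IsMultiDer ℳ ρ k δ F) {γ : ℤ} {c : S} (hc : c ∈ ℳ γ) :
    IsMultiDer ℳ ρ k (δ + γ) fun l => (γ * dg l).negOnePow • (F l * ρ c) where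
  lin := (hF.lin.comp (LinearMap.mulRight K (ρ c))).dg_smul γ
  symm := (hF.symm.comp (LinearMap.mulRight K (ρ c))).dg_smul γ
  leib d x e y r hk hx hy hr := by
    rw [hF.leib d x e y r hk hx hy hr, add_mul, smul_mul_assoc, smul_mul_assoc,
      mul_assoc (F _), map_mul_comm ρ hy hc]
    simp only [smul_add, smul_smul, ← Int.negOnePow_add, smul_mul_assoc, mul_smul_comm, mul_assoc,
      dg_cons]
    refine congrArg₂ _ (negOnePow_smul_congr ?_) (negOnePow_smul_congr ?_) <;> grind

end MultiderivationTheory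

/-! ### Nested commutators -/

section Nest

variable {K S V : Type*} [Field K] [Ring S] [Algebra K S] [AddCommGroup V] [Module K V]
  {ℳ : ℤ → Submodule K S} {ρ : S →ₐ[K] Module.End K V}

/-- The nested graded commutator `[⋯[[F, ρ u_0], ρ u_1]⋯]` of an operator `F` of degree `δ`. -/
def nest (ρ : S →ₐ[K] Module.End K V) : Module.End K V → ℤ → List (ℤ × S) → Module.End K V
  | F, _, [] => F
  | F, δ, h :: l => nest ρ (gradedComm δ h.1 F (ρ h.2)) (δ + h.1) l

theorem nest_append (F : Module.End K V) (δ : ℤ) (l r : List (ℤ × S)) :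
    nest ρ F δ (l ++ r) = nest ρ (nest ρ F δ l) (δ + dg l) r := by
  induction l generalizing F δ with
  | nil => simp [nest]
  | cons h l ih => simp only [List.cons_append, nest, ih, dg_cons, add_assoc]

theorem nestedComm_eq_nest (F : Module.End K V) (δ : ℤ) (k : ℕ) (n : Fin k → ℤ) (u : Fin k → S) :
    nestedComm F δ k n (fun i => ρ (u i)) = nest ρ F δ (List.ofFn fun i => (n i, u i)) := by
  induction k with
  | zero => simp [nestedComm, nest]
  | succ k ih => rw [nestedComm, ih, List.ofFn_succ', List.concat_eq_append, nest_append, dg_ofFn,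
      nest, nest]

theorem gradedComm_add_left (d e : ℤ) (F F' G : Module.End K V) :
    gradedComm d e (F + F') G = gradedComm d e F G + gradedComm d e F' G := by
  simp only [gradedComm, add_mul, mul_add, smul_add]
  abel

theorem gradedComm_add_right (d e : ℤ) (F G G' : Module.End K V) :
    gradedComm d e F (G + G') = gradedComm d e F G + gradedComm d e F G' := by
  simp only [gradedComm, add_mul, mul_add, smul_add]
  abel

theorem gradedComm_smul_left (d e : ℤ) (c : K) (F G : Module.End K V) :
    gradedComm d e (c • F) G = c • gradedComm d e F G := by
  simp only [gradedComm, smul_mul_assoc, mul_smul_comm, smul_sub, smul_comm c]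

theorem gradedComm_smul_right (d e : ℤ) (c : K) (F G : Module.End K V) :
    gradedComm d e F (c • G) = c • gradedComm d e F G := by
  simp only [gradedComm, smul_mul_assoc, mul_smul_comm, smul_sub, smul_comm c]

theorem nest_add (F F' : Module.End K V) (δ : ℤ) (l : List (ℤ × S)) :
    nest ρ (F + F') δ l = nest ρ F δ l + nest ρ F' δ l := by
  induction l generalizing F F' δ with
  | nil => simp [nest]
  | cons h l ih => simp only [nest, gradedComm_add_left, ih]

theorem nest_smul (c : K) (F : Module.End K V) (δ : ℤ) (l : List (ℤ × S)) :
    nest ρ (c • F) δ l = c • nest ρ F δ l := by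
  induction l generalizing F δ with
  | nil => simp [nest]
  | cons h l ih => simp only [nest, gradedComm_smul_left, ih]

theorem nest_negOnePow_smul (n : ℤ) (F : Module.End K V) (δ : ℤ) (l : List (ℤ × S)) :
    nest ρ (n.negOnePow • F) δ l = n.negOnePow • nest ρ F δ l := by
  rcases Int.units_eq_one_or n.negOnePow with h | h
  · simp [h]
  · simpa [h] using nest_smul (ρ := ρ) (-1) F δ l

variable [GradedCommutative ℳ]

/-- `ρ x` supercommutes with every `ρ u`, so it passes through all the commutators. -/
theorem nest_mul_left {d : ℤ} {x : S} (hx : x ∈ ℳ d) (F : Module.End K V) (δ : ℤ)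
    {l : List (ℤ × S)} (hl : Homog ℳ l) : nest ρ (ρ x * F) (δ + d) l = ρ x * nest ρ F δ l := by
  induction l generalizing F δ with
  | nil => simp [nest]
  | cons h l ih =>
    rw [homog_cons] at hl
    have : gradedComm (δ + d) h.1 (ρ x * F) (ρ h.2) = ρ x * gradedComm δ h.1 F (ρ h.2) := by
      rw [gradedComm, gradedComm, mul_sub, mul_smul_comm, ← mul_assoc (ρ h.2),
        map_mul_comm ρ hl.1 hx, smul_mul_assoc, smul_smul, ← Int.negOnePow_add, mul_assoc,
        mul_assoc]
      refine congrArg₂ _ rfl (negOnePow_smul_congr ?_)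
      grind
    rw [nest, nest, this, add_right_comm, ih _ _ hl.2]

theorem nest_mul_right {e : ℤ} {y : S} (hy : y ∈ ℳ e) (F : Module.End K V) (δ : ℤ)
    {l : List (ℤ × S)} (hl : Homog ℳ l) :
    nest ρ (F * ρ y) (δ + e) l = (e * dg l).negOnePow • (nest ρ F δ l * ρ y) := by
  induction l generalizing F δ with
  | nil => simp [nest]
  | cons h l ih =>
    rw [homog_cons] at hl
    have : gradedComm (δ + e) h.1 (F * ρ y) (ρ h.2) =
        (e * h.1).negOnePow • (gradedComm δ h.1 F (ρ h.2) * ρ y) := by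
      rw [gradedComm, gradedComm, sub_mul, mul_assoc, map_mul_comm ρ hy hl.1, mul_smul_comm,
        smul_sub, smul_mul_assoc, smul_smul, ← Int.negOnePow_add, mul_assoc, mul_assoc]
      refine congrArg₂ _ rfl (negOnePow_smul_congr ?_)
      grind
    rw [nest, nest, this, nest_negOnePow_smul, add_right_comm, ih _ _ hl.2, smul_smul,
      ← Int.negOnePow_add, dg_cons, mul_add]

theorem gradedComm_mul_right (F : Module.End K V) (δ d e : ℤ) (x y : S) :
    gradedComm δ (d + e) F (ρ (x * y)) =
      (d * δ).negOnePow • (ρ x * gradedComm δ e F (ρ y)) + gradedComm δ d F (ρ x) * ρ y := by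
  simp only [gradedComm, map_mul, mul_sub, sub_mul, smul_sub, smul_smul, mul_smul_comm,
    smul_mul_assoc, ← Int.negOnePow_add, mul_assoc]
  rw [mul_comm d δ, mul_add]
  abel

/-- This is the graded Jacobi identity; the term with `[ρ x, ρ y]` is zero. -/
theorem gradedComm_swap (F : Module.End K V) (δ : ℤ) {d e : ℤ} {x y : S} (hx : x ∈ ℳ d)
    (hy : y ∈ ℳ e) : gradedComm (δ + d) e (gradedComm δ d F (ρ x)) (ρ y) =
      (d * e).negOnePow • gradedComm (δ + e) d (gradedComm δ e F (ρ y)) (ρ x) := by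
  have h1 : F * ρ x * ρ y = (d * e).negOnePow • (F * ρ y * ρ x) := by
    rw [mul_assoc, map_mul_comm ρ hx hy, mul_smul_comm, mul_assoc]
  have h2 : ρ y * (ρ x * F) = (e * d).negOnePow • (ρ x * (ρ y * F)) := by
    rw [← mul_assoc, map_mul_comm ρ hy hx, smul_mul_assoc, mul_assoc]
  simp only [gradedComm, mul_sub, sub_mul, smul_sub, mul_smul_comm, smul_mul_assoc, h1, h2,
    smul_smul, ← Int.negOnePow_add, mul_assoc]
  rw [negOnePow_congr (m := (δ + d) * e + (δ * d + e * d)) (n := δ * e + δ * d) (by grind),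
    negOnePow_congr (m := (δ + d) * e) (n := d * e + δ * e) (by grind),
    negOnePow_congr (m := d * e + (δ + e) * d) (n := δ * d) (by grind),
    negOnePow_congr (m := d * e + ((δ + e) * d + δ * e)) (n := δ * e + δ * d) (by grind)]
  abel

/-- The first commutator obeys the Leibniz rule (`gradedComm_mul_right`), and the later ones respect
it, being linear over the image of `ρ` on either side (`nest_mul_left`, `nest_mul_right`). Nothing
is assumed of `F`. -/
theorem isMultiDer_nest (F : Module.End K V) (δ : ℤ) (k : ℕ) :
    IsMultiDer ℳ ρ k δ (nest ρ F δ) where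
  lin := by
    constructor
    · intro l r e x y _ _ _ _ _
      simp only [nest_append, nest, map_add, gradedComm_add_right, nest_add]
    · intro l r e c x _ _ _ _
      simp only [nest_append, nest, map_smul, gradedComm_smul_right, nest_smul]
  symm l h h' r _ _ h1 h2 _ := by
    rw [nest_append, nest_append, nest, nest, nest, nest, gradedComm_swap _ _ h1 h2,
      nest_negOnePow_smul, add_right_comm (δ + dg l) h.1 h'.1]
  leib d x e y r _ hx hy hr := by
    rw [nest, gradedComm_mul_right, nest_add, nest_negOnePow_smul, nest, nest,
      ← nest_mul_left hx _ _ hr, ← nest_mul_right hy _ _ hr, add_assoc, add_assoc, add_comm e d]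

end Nest

/-! ### Multiderivations are determined by their values on generators -/

section Generators

variable {K A L S R : Type*} [Field K] [Ring A] [Algebra K A] [AddCommGroup L] [Module K L]
  [Module A L] [Ring S] [Algebra K S] [Ring R] [Algebra K R]
  {𝒜 : ℤ → Submodule K A} {ℒ : ℤ → Submodule K L} {iA : A →ₗ[K] S} {iL : L →ₗ[K] S}

/-- The image of a list of elements of `L` in the symmetric algebra. -/
def liftL (iL : L →ₗ[K] S) (l : List (ℤ × L)) : List (ℤ × S) := l.map fun h => (h.1, iL h.2)

@[simp] theorem liftL_nil : liftL iL [] = [] := rfl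

@[simp] theorem liftL_cons (h : ℤ × L) (l : List (ℤ × L)) :
    liftL iL (h :: l) = (h.1, iL h.2) :: liftL iL l := rfl

@[simp] theorem length_liftL (l : List (ℤ × L)) : (liftL iL l).length = l.length := by
  simp [liftL]

@[simp] theorem dg_liftL (l : List (ℤ × L)) : dg (liftL iL l) = dg l := by
  simp [liftL, dg, Function.comp_def]

variable (𝒜 ℒ iA iL) in
/-- A list of homogeneous generators of the symmetric algebra. -/
def GenList (l : List (ℤ × S)) : Prop := ∀ h ∈ l, IsGen 𝒜 ℒ iA iL h.1 h.2

@[simp] theorem genList_nil : GenList 𝒜 ℒ iA iL [] := by simp [GenList]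

@[simp] theorem genList_cons (h : ℤ × S) (l : List (ℤ × S)) :
    GenList 𝒜 ℒ iA iL (h :: l) ↔ IsGen 𝒜 ℒ iA iL h.1 h.2 ∧ GenList 𝒜 ℒ iA iL l := by
  simp [GenList]

@[simp] theorem genList_append (l r : List (ℤ × S)) :
    GenList 𝒜 ℒ iA iL (l ++ r) ↔ GenList 𝒜 ℒ iA iL l ∧ GenList 𝒜 ℒ iA iL r := by
  simp [GenList, or_imp, forall_and]

theorem Homog.genList_liftL {l : List (ℤ × L)} (hl : Homog ℒ l) :
    GenList 𝒜 ℒ iA iL (liftL iL l) := by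
  induction l with
  | nil => simp
  | cons h l ih =>
    rw [homog_cons] at hl
    simp [ih hl.2, IsGen.ofL hl.1]

theorem GenList.cases {l : List (ℤ × S)} (hl : GenList 𝒜 ℒ iA iL l) :
    (∃ g, Homog ℒ g ∧ l = liftL iL g) ∨ ∃ p e a r, a ∈ 𝒜 e ∧ GenList 𝒜 ℒ iA iL p ∧
      GenList 𝒜 ℒ iA iL r ∧ l = p ++ (e, iA a) :: r := by
  induction l with
  | nil => exact Or.inl ⟨[], by simp, rfl⟩
  | cons h l ih =>
    rw [genList_cons] at hl
    obtain ⟨e, u⟩ := h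
    obtain ⟨hu, hl⟩ := hl
    cases hu with
    | @ofA a ha => exact Or.inr ⟨[], e, a, l, ha, by simp, hl, rfl⟩
    | @ofL ξ hξ =>
      rcases ih hl with ⟨g, hg, rfl⟩ | ⟨p, e', a, r, ha, hp, hr, rfl⟩
      · exact Or.inl ⟨(e, ξ) :: g, by simp [hg, hξ], rfl⟩
      · exact Or.inr ⟨(e, iL ξ) :: p, e', a, r, ha, by simp [hp, IsGen.ofL hξ], hr, rfl⟩

variable [IsSymAlg 𝒜 ℒ iA iL] [GradedAlgebra 𝒜] [GradedCommutative 𝒜] [Decomposition ℒ]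
  [SetLike.GradedSMul 𝒜 ℒ]

local notation "𝒮" => genDeg 𝒜 ℒ iA iL

theorem GenList.homog {l : List (ℤ × S)} (hl : GenList 𝒜 ℒ iA iL l) : Homog 𝒮 l :=
  fun h hh => (hl h hh).mem

theorem Homog.liftL {l : List (ℤ × L)} (hl : Homog ℒ l) : Homog 𝒮 (liftL iL l) :=
  hl.genList_liftL.homog

/-- Two graded symmetric functions agree on lists of generators if they agree on the lists without
entries in `A`, with exactly one such entry in front, and with two such entries in front. -/
theorem SwapSymm.ext_genList {N : Type*} [AddCommGroup N] [Module K N] {k : ℕ}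
    {F G : List (ℤ × S) → N} (hF : SwapSymm 𝒮 k F) (hG : SwapSymm 𝒮 k G)
    (hL : ∀ g, Homog ℒ g → g.length = k → F (liftL iL g) = G (liftL iL g))
    (hA : ∀ e a g, a ∈ 𝒜 e → Homog ℒ g → g.length + 1 = k →
      F ((e, iA a) :: liftL iL g) = G ((e, iA a) :: liftL iL g))
    (hAA : ∀ e a e' b r, a ∈ 𝒜 e → b ∈ 𝒜 e' → GenList 𝒜 ℒ iA iL r → r.length + 2 = k →
      F ((e, iA a) :: (e', iA b) :: r) = G ((e, iA a) :: (e', iA b) :: r))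
    {l : List (ℤ × S)} (hl : GenList 𝒜 ℒ iA iL l) (hk : l.length = k) : F l = G l := by
  rcases hl.cases with ⟨g, hg, rfl⟩ | ⟨p, e, a, r, ha, hp, hr, rfl⟩
  · exact hL g hg (by simpa using hk)
  simp only [List.length_append, List.length_cons] at hk
  have hm : iA a ∈ 𝒮 e := ofA_mem_genDeg ha
  rw [hF.move_front (h := (e, iA a)) hm p r (by omega) hp.homog hr.homog,
    hG.move_front (h := (e, iA a)) hm p r (by omega) hp.homog hr.homog]
  congr 1
  have hpr : GenList 𝒜 ℒ iA iL (p ++ r) := by simp [hp, hr]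
  have hk' : (p ++ r).length + 1 = k := by simp; omega
  generalize p ++ r = q at hpr hk'
  rcases hpr.cases with ⟨g, hg, rfl⟩ | ⟨p, e', b, r, hb, hp, hr, rfl⟩
  · exact hA e a g ha hg (by simpa using hk')
  obtain _ | k := k
  · omega
  simp only [List.length_append, List.length_cons] at hk'
  have hm' : iA b ∈ 𝒮 e' := ofA_mem_genDeg hb
  have h1 := (hF.cons (h := (e, iA a)) hm).move_front (h := (e', iA b)) hm' p r (by omega) hp.homog
    hr.homog
  have h2 := (hG.cons (h := (e, iA a)) hm).move_front (h := (e', iA b)) hm' p r (by omega) hp.homog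
    hr.homog
  rw [h1, h2, hAA e a e' b (p ++ r) ha hb (by simp [hp, hr]) (by simp; omega)]

variable {ρ : S →ₐ[K] R} {k : ℕ} {δ : ℤ} {F G : List (ℤ × S) → R}

/-- One entry at a time is brought to the front, where the Leibniz rule reduces it to generators,
and is then put back. -/
theorem IsMultiDer.ext_of_genList (hF : IsMultiDer 𝒮 ρ k δ F) (hG : IsMultiDer 𝒮 ρ k δ G)
    (h : ∀ l, GenList 𝒜 ℒ iA iL l → l.length = k → F l = G l) {l : List (ℤ × S)}
    (hl : Homog 𝒮 l) (hk : l.length = k) : F l = G l := by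
  -- `l₁` collects the entries already reduced to generators; `l₂` holds those still arbitrary.
  suffices H : ∀ l₂ l₁, GenList 𝒜 ℒ iA iL l₁ → Homog 𝒮 l₂ → l₁.length + l₂.length = k →
      F (l₁ ++ l₂) = G (l₁ ++ l₂) by simpa using H l [] (by simp) hl (by simpa using hk)
  intro l₂
  induction l₂ with
  | nil =>
    intro l₁ h1 _ hk
    simpa using h l₁ h1 (by simpa using hk)
  | cons x t ih =>
    intro l₁ h1 ht hk
    obtain ⟨d, u⟩ := x
    rw [homog_cons] at ht
    obtain ⟨hu, ht⟩ := ht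
    rw [List.length_cons] at hk
    rw [hF.symm.move_front (h := (d, u)) hu l₁ t (by omega) h1.homog ht,
      hG.symm.move_front (h := (d, u)) hu l₁ t (by omega) h1.homog ht]
    congr 1
    have hh : Homog 𝒮 (l₁ ++ t) := by simp [h1.homog, ht]
    have hlen : (l₁ ++ t).length + 1 = k := by simp; omega
    refine genDeg_induction (C := fun d u => F ((d, u) :: (l₁ ++ t)) = G ((d, u) :: (l₁ ++ t)))
      ?_ ?_ ?_ ?_ ?_ hu
    · intro d g hg
      have := ih (l₁ ++ [(d, g)]) (by simp [h1, hg]) ht (by simp; omega)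
      simp only [List.append_assoc, List.singleton_append] at this
      rw [hF.symm.move_front (h := (d, g)) hg.mem l₁ t (by omega) h1.homog ht,
        hG.symm.move_front (h := (d, g)) hg.mem l₁ t (by omega) h1.homog ht] at this
      exact (smul_left_cancel _ this)
    · intro d
      have h1 := hF.lin.zero_slot [] (l₁ ++ t) d (by simpa using hlen) (by simp) hh
      have h2 := hG.lin.zero_slot [] (l₁ ++ t) d (by simpa using hlen) (by simp) hh
      exact h1.trans h2.symm
    · intro d x y hx hy h1 h2
      have e1 := hF.lin.add [] (l₁ ++ t) d x y (by simpa using hlen) (by simp) hh hx hy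
      have e2 := hG.lin.add [] (l₁ ++ t) d x y (by simpa using hlen) (by simp) hh hx hy
      simp only [List.nil_append] at e1 e2
      rw [e1, e2, h1, h2]
    · intro d c x hx h1
      have e1 := hF.lin.smul [] (l₁ ++ t) d c x (by simpa using hlen) (by simp) hh hx
      have e2 := hG.lin.smul [] (l₁ ++ t) d c x (by simpa using hlen) (by simp) hh hx
      simp only [List.nil_append] at e1 e2
      rw [e1, e2, h1]
    · intro d x e y hx hy h1 h2
      rw [hF.leib d x e y _ hlen hx hy hh, hG.leib d x e y _ hlen hx hy hh, h1, h2]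

theorem IsMultiDer.ext_gens (hF : IsMultiDer 𝒮 ρ k δ F) (hG : IsMultiDer 𝒮 ρ k δ G)
    (hL : ∀ g, Homog ℒ g → g.length = k → F (SHLR.liftL iL g) = G (SHLR.liftL iL g))
    (hA : ∀ e a g, a ∈ 𝒜 e → Homog ℒ g → g.length + 1 = k →
      F ((e, iA a) :: SHLR.liftL iL g) = G ((e, iA a) :: SHLR.liftL iL g))
    (hAA : ∀ e a e' b r, a ∈ 𝒜 e → b ∈ 𝒜 e' → GenList 𝒜 ℒ iA iL r → r.length + 2 = k →
      F ((e, iA a) :: (e', iA b) :: r) = G ((e, iA a) :: (e', iA b) :: r))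
    {l : List (ℤ × S)} (hl : Homog 𝒮 l) (hk : l.length = k) : F l = G l :=
  hF.ext_of_genList hG (fun _ h1 h2 => hF.symm.ext_genList hG.symm hL hA hAA h1 h2) hl hk

end Generators

/-! ### Twisted derivations -/

section Twisted

variable {K A L S : Type*} [Field K] [Ring A] [Algebra K A] [AddCommGroup L] [Module K L]
  [Module A L] [Ring S] [Algebra K S]
  {𝒜 : ℤ → Submodule K A} {ℒ : ℤ → Submodule K L} {iA : A →ₗ[K] S} {iL : L →ₗ[K] S}

/-- `D` is a derivation of the graded algebra `S`, twisted by the signs `(-1)^{δ|x|}` on the left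
and `(-1)^{ρ|y|}` on the right. -/
def IsTwistedDer (ℳ : ℤ → Submodule K S) (δ ρ : ℤ) (D : S →ₗ[K] S) : Prop :=
  ∀ d x e y, x ∈ ℳ d → y ∈ ℳ e →
    D (x * y) = (δ * d).negOnePow • (x * D y) + (ρ * e).negOnePow • (D x * y)

theorem IsTwistedDer.add {ℳ : ℤ → Submodule K S} {δ ρ : ℤ} {D D' : S →ₗ[K] S}
    (h : IsTwistedDer ℳ δ ρ D) (h' : IsTwistedDer ℳ δ ρ D') : IsTwistedDer ℳ δ ρ (D + D') := by
  intro d x e y hx hy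
  simp only [LinearMap.add_apply, h d x e y hx hy, h' d x e y hx hy, mul_add, add_mul, smul_add]
  abel

theorem IsTwistedDer.smul {ℳ : ℤ → Submodule K S} {δ ρ : ℤ} {D : S →ₗ[K] S}
    (h : IsTwistedDer ℳ δ ρ D) (c : K) : IsTwistedDer ℳ δ ρ (c • D) := by
  intro d x e y hx hy
  simp only [LinearMap.smul_apply, h d x e y hx hy, smul_add, mul_smul_comm, smul_mul_assoc,
    smul_comm c]

theorem IsTwistedDer.ext [IsSymAlg 𝒜 ℒ iA iL] [GradedAlgebra 𝒜] [GradedCommutative 𝒜]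
    [Decomposition ℒ] [SetLike.GradedSMul 𝒜 ℒ] {δ ρ : ℤ} {D D' : S →ₗ[K] S}
    (h : IsTwistedDer (genDeg 𝒜 ℒ iA iL) δ ρ D) (h' : IsTwistedDer (genDeg 𝒜 ℒ iA iL) δ ρ D')
    (hg : ∀ e v, IsGen 𝒜 ℒ iA iL e v → D v = D' v) {d : ℤ} {u : S}
    (hu : u ∈ genDeg 𝒜 ℒ iA iL d) : D u = D' u := by
  refine genDeg_induction (C := fun _ u => D u = D' u) hg (by simp) ?_ ?_ ?_ hu
  · intro d x y _ _ hx hy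
    rw [map_add, map_add, hx, hy]
  · intro d c x _ hx
    rw [map_smul, map_smul, hx]
  · intro d x e y h1 h2 hx hy
    rw [h d x e y h1 h2, h' d x e y h1 h2, hx, hy]

end Twisted

/-! ### Extension of brackets and anchors to multiderivations -/

section Extension

variable {K A L S : Type*} [Field K] [Ring A] [Algebra K A] [AddCommGroup L] [Module K L]
  [Module A L] [Ring S] [Algebra K S]
  {𝒜 : ℤ → Submodule K A} {ℒ : ℤ → Submodule K L} {iA : A →ₗ[K] S} {iL : L →ₗ[K] S}

local notation "𝒮" => genDeg 𝒜 ℒ iA iL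

variable (𝒜 ℒ iA iL) in
/-- The restriction of a multiderivation of degree `δ` to lists of `k` generators: `Z` is its value
on lists of elements of `L`, `T e a` is its value when the first entry is `a ∈ A`, of degree `e`,
and the other ones are in `L`. -/
structure IsGenData (k : ℕ) (δ : ℤ) (Z : List (ℤ × L) → S) (T : ℤ → A → List (ℤ × L) → S) :
    Prop where
  Z_lin : SlotLinear ℒ k Z
  Z_symm : SwapSymm ℒ k Z
  T_lin : ∀ e a, a ∈ 𝒜 e → ∀ j, j + 1 = k → SlotLinear ℒ j (T e a)
  T_symm : ∀ e a, a ∈ 𝒜 e → ∀ j, j + 1 = k → SwapSymm ℒ j (T e a)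
  T_add : ∀ e a b g, a ∈ 𝒜 e → b ∈ 𝒜 e → Homog ℒ g → g.length + 1 = k →
    T e (a + b) g = T e a g + T e b g
  T_smul : ∀ e (c : K) a g, a ∈ 𝒜 e → Homog ℒ g → g.length + 1 = k →
    T e (c • a) g = c • T e a g
  T_mul : ∀ e a e' b g, a ∈ 𝒜 e → b ∈ 𝒜 e' → Homog ℒ g → g.length + 1 = k →
    T (e + e') (a * b) g = (δ * e).negOnePow • (iA a * T e' b g) +
      (dg g * e').negOnePow • (T e a g * iA b)
  T_left : ∀ e a e₁ b e₂ ξ g, a ∈ 𝒜 e → b ∈ 𝒜 e₁ → ξ ∈ ℒ e₂ → Homog ℒ g → g.length + 2 = k →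
    T e a ((e₁ + e₂, b • ξ) :: g) =
      ((δ + e) * e₁).negOnePow • (iA b * T e a ((e₂, ξ) :: g))
  Z_left : ∀ e a e' ξ g, a ∈ 𝒜 e → ξ ∈ ℒ e' → Homog ℒ g → g.length + 1 = k →
    Z ((e + e', a • ξ) :: g) = (δ * e).negOnePow • (iA a * Z ((e', ξ) :: g)) +
      (dg g * e').negOnePow • (T e a g * iL ξ)
  Z_mem : ∀ g, Homog ℒ g → g.length = k → Z g ∈ 𝒮 (δ + dg g)
  T_mem : ∀ e a g, a ∈ 𝒜 e → Homog ℒ g → g.length + 1 = k → T e a g ∈ 𝒮 (δ + e + dg g)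

variable (𝒜 ℒ iA iL) in
/-- `F` is a multiderivation of the symmetric algebra with the prescribed values on generators which
vanishes on lists with two entries in `A`. -/
structure IsExtension (k : ℕ) (δ : ℤ) (Z : List (ℤ × L) → S) (T : ℤ → A → List (ℤ × L) → S)
    (F : List (ℤ × S) → S) : Prop where
  der : IsMultiDer 𝒮 (AlgHom.id K S) k δ F
  mem : ∀ l, Homog 𝒮 l → l.length = k → F l ∈ 𝒮 (δ + dg l)
  onL : ∀ g, Homog ℒ g → g.length = k → F (liftL iL g) = Z g
  onA : ∀ e a g, a ∈ 𝒜 e → Homog ℒ g → g.length + 1 = k → F ((e, iA a) :: liftL iL g) = T e a g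
  onAA : ∀ e a e' b r, a ∈ 𝒜 e → b ∈ 𝒜 e' → GenList 𝒜 ℒ iA iL r → r.length + 2 = k →
    F ((e, iA a) :: (e', iA b) :: r) = 0

variable {k : ℕ} {δ : ℤ} {Z : List (ℤ × L) → S} {T : ℤ → A → List (ℤ × L) → S}

/-- Once an entry from `A` is fixed, any further one gives zero, so the new anchor is `0`. The new
bracket is then `A`-linear, as `T_left` provides. -/
theorem IsGenData.insA (h : IsGenData 𝒜 ℒ iA iL (k + 1) δ Z T) {e : ℤ} {a : A} (ha : a ∈ 𝒜 e) :
    IsGenData 𝒜 ℒ iA iL k (δ + e) (T e a) fun _ _ _ => 0 where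
  Z_lin := h.T_lin e a ha k rfl
  Z_symm := h.T_symm e a ha k rfl
  T_lin _ _ _ _ _ := ⟨by simp, by simp⟩
  T_symm _ _ _ _ _ _ _ _ _ _ _ _ _ _ := by simp
  T_add := by simp
  T_smul := by simp
  T_mul := by simp
  T_left := by simp
  Z_left e₁ b e₂ ξ g hb hξ hg hk := by
    rw [h.T_left e a e₁ b e₂ ξ g ha hb hξ hg (by omega), zero_mul, smul_zero, add_zero]
  Z_mem g hg hk := h.T_mem e a g ha hg (by omega)
  T_mem _ _ _ _ _ _ := zero_mem _

variable [IsSymAlg 𝒜 ℒ iA iL] [GradedAlgebra 𝒜] [GradedCommutative 𝒜] [Decomposition ℒ]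
  [SetLike.GradedSMul 𝒜 ℒ]

/-- `T` expects its entry from `A` in front, whereas here `ξ` comes first; the sign `(-1)^{e e'}` is
that of exchanging the two. -/
theorem IsGenData.insL (h : IsGenData 𝒜 ℒ iA iL (k + 1) δ Z T) {e : ℤ} {ξ : L} (hξ : ξ ∈ ℒ e) :
    IsGenData 𝒜 ℒ iA iL k (δ + e) (fun g => Z ((e, ξ) :: g))
      fun e' a g => (e * e').negOnePow • T e' a ((e, ξ) :: g) where
  Z_lin := h.Z_lin.cons (h := (e, ξ)) hξ
  Z_symm := h.Z_symm.cons (h := (e, ξ)) hξ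
  T_lin e' a ha j hj := by
    have := (h.T_lin e' a ha (j + 1) (by omega)).cons (h := (e, ξ)) hξ
    exact ⟨fun l r e x y h1 h2 h3 h4 h5 => by rw [this.add l r e x y h1 h2 h3 h4 h5, smul_add],
      fun l r e c x h1 h2 h3 h4 => by rw [this.smul l r e c x h1 h2 h3 h4, smul_comm]⟩
  T_symm e' a ha j hj :=
    ((h.T_symm e' a ha (j + 1) (by omega)).cons (h := (e, ξ)) hξ).smul_unit _
  T_add e' a b g ha hb hg hk := by
    rw [h.T_add e' a b _ ha hb ((homog_cons ℒ _ _).2 ⟨hξ, hg⟩) (by simpa using hk), smul_add]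
  T_smul e' c a g ha hg hk := by
    rw [h.T_smul e' c a _ ha ((homog_cons ℒ _ _).2 ⟨hξ, hg⟩) (by simpa using hk), smul_comm]
  T_mul e₁ a e₂ b g ha hb hg hk := by
    rw [h.T_mul e₁ a e₂ b _ ha hb ((homog_cons ℒ _ _).2 ⟨hξ, hg⟩) (by simpa using hk)]
    simp only [smul_add, smul_smul, ← Int.negOnePow_add, mul_smul_comm, smul_mul_assoc, dg_cons]
    refine congrArg₂ _ (negOnePow_smul_congr ?_) (negOnePow_smul_congr ?_) <;> grind
  T_left e' a e₁ b e₂ ζ g ha hb hζ hg hk := by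
    have hbζ : b • ζ ∈ ℒ (e₁ + e₂) := SetLike.GradedSMul.smul_mem hb hζ
    have s := fun e₂ ζ (hζ : ζ ∈ ℒ e₂) => h.T_symm e' a ha (g.length + 2) (by omega) []
      (e, ξ) (e₂, ζ) g (by simp) (by simp) hξ hζ hg
    simp only [List.nil_append] at s
    rw [s _ _ hbζ, s _ _ hζ, h.T_left e' a e₁ b e₂ ζ _ ha hb hζ
      ((homog_cons ℒ _ _).2 ⟨hξ, hg⟩) (by simpa using hk)]
    simp only [smul_smul, ← Int.negOnePow_add, mul_smul_comm]
    refine negOnePow_smul_congr ?_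
    grind
  Z_left e₁ a e₂ ζ g ha hζ hg hk := by
    have haζ : a • ζ ∈ ℒ (e₁ + e₂) := SetLike.GradedSMul.smul_mem ha hζ
    have s := fun e₂ ζ (hζ : ζ ∈ ℒ e₂) => h.Z_symm [] (e, ξ) (e₂, ζ) g (by simp; omega) (by simp)
      hξ hζ hg
    simp only [List.nil_append] at s
    rw [s _ _ haζ, s _ _ hζ, h.Z_left e₁ a e₂ ζ _ ha hζ
      ((homog_cons ℒ _ _).2 ⟨hξ, hg⟩) (by simpa using hk)]
    simp only [smul_add, smul_smul, ← Int.negOnePow_add, mul_smul_comm, smul_mul_assoc, dg_cons]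
    refine congrArg₂ _ (negOnePow_smul_congr ?_) (negOnePow_smul_congr ?_) <;> grind
  Z_mem g hg hk := by
    have := h.Z_mem ((e, ξ) :: g) ((homog_cons ℒ _ _).2 ⟨hξ, hg⟩) (by simpa using hk)
    simpa [add_assoc] using this
  T_mem e' a g ha hg hk := by
    have := h.T_mem e' a ((e, ξ) :: g) ha ((homog_cons ℒ _ _).2 ⟨hξ, hg⟩) (by simpa using hk)
    rw [dg_cons, ← add_assoc, add_right_comm δ] at this
    rw [Units.smul_def]
    exact zsmul_mem this _

/-- A family of twisted derivations which is given by multiderivations on generators and symmetric on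
pairs of generators is a multiderivation. -/
theorem isMultiDer_of_twistedDer {F : List (ℤ × S) → S} (D : List (ℤ × S) → S →ₗ[K] S)
    (hF : ∀ h r, F (h :: r) = D r h.2)
    (hD : ∀ r, Homog 𝒮 r → r.length = k → IsTwistedDer 𝒮 δ (dg r) (D r))
    (hgen : ∀ e v, IsGen 𝒜 ℒ iA iL e v → ∃ G : List (ℤ × S) → S,
      IsMultiDer 𝒮 (AlgHom.id K S) k (δ + e) G ∧
        ∀ r, Homog 𝒮 r → r.length = k → D r v = G r)
    (hswap : ∀ e v e' w r, IsGen 𝒜 ℒ iA iL e v → IsGen 𝒜 ℒ iA iL e' w → Homog 𝒮 r →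
      r.length + 1 = k → D ((e', w) :: r) v = (e * e').negOnePow • D ((e, v) :: r) w) :
    IsMultiDer 𝒮 (AlgHom.id K S) (k + 1) δ F := by
  -- Leibniz rule in the second entry, by induction on the first: for a generator it is the rule for
  -- `G`, and the twisted Leibniz rule of `D` carries it to products.
  have slot2 : ∀ d x e y r, r.length + 1 = k → x ∈ 𝒮 d → y ∈ 𝒮 e → Homog 𝒮 r →
      ∀ c u, u ∈ 𝒮 c → D ((d + e, x * y) :: r) u =
        (d * (δ + c)).negOnePow • (x * D ((e, y) :: r) u) +
          (e * dg r).negOnePow • (D ((d, x) :: r) u * y) := by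
    intro d x e y r hk hx hy hr c u hu
    have hxy : x * y ∈ 𝒮 (d + e) := mul_mem_genDeg hx hy
    have Hxy : Homog 𝒮 ((d + e, x * y) :: r) := (homog_cons _ _ _).2 ⟨hxy, hr⟩
    have Hx : Homog 𝒮 ((d, x) :: r) := (homog_cons _ _ _).2 ⟨hx, hr⟩
    have Hy : Homog 𝒮 ((e, y) :: r) := (homog_cons _ _ _).2 ⟨hy, hr⟩
    refine genDeg_induction (C := fun c u => D ((d + e, x * y) :: r) u =
        (d * (δ + c)).negOnePow • (x * D ((e, y) :: r) u) +
          (e * dg r).negOnePow • (D ((d, x) :: r) u * y)) ?_ (by simp) ?_ ?_ ?_ hu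
    · intro c v hv
      obtain ⟨G, hG, hGD⟩ := hgen c v hv
      rw [hGD _ Hxy (by simpa using hk), hGD _ Hx (by simpa using hk),
        hGD _ Hy (by simpa using hk), hG.leib d x e y r hk hx hy hr]
      rfl
    · intro c u u' _ _ h h'
      simp only [map_add, h, h', mul_add, add_mul, smul_add]
      abel
    · intro c t u _ h
      simp only [map_smul, h, smul_add, mul_smul_comm, smul_mul_assoc, smul_comm t]
    · intro c u c' u' hu hu' h h'
      have hux : ∀ z, u * (x * z) = (c * d).negOnePow • (x * (u * z)) := fun z => by
        rw [← mul_assoc, symAlg_mul_comm hu hx, smul_mul_assoc, mul_assoc]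
      rw [hD _ Hxy (by simpa using hk) c u c' u' hu hu', hD _ Hx (by simpa using hk) c u c' u' hu hu',
        hD _ Hy (by simpa using hk) c u c' u' hu hu', h, h']
      simp only [mul_add, add_mul, mul_smul_comm, smul_mul_assoc, smul_add, smul_smul, mul_assoc,
        ← Int.negOnePow_add, dg_cons, hux, symAlg_mul_comm hy hu']
      rw [add_add_add_comm]
      refine congrArg₂ _ (congrArg₂ _ (negOnePow_smul_congr ?_) (negOnePow_smul_congr ?_))
        (congrArg₂ _ (negOnePow_smul_congr ?_) (negOnePow_smul_congr ?_)) <;> grind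
  -- Symmetry in the first two entries when the second is a generator `v`. Both sides are twisted
  -- derivations in `u`, and for `u` a generator the claim is `hswap`.
  have swap1 : ∀ e v c u r, IsGen 𝒜 ℒ iA iL e v → u ∈ 𝒮 c → Homog 𝒮 r → r.length + 1 = k →
      D ((e, v) :: r) u = (c * e).negOnePow • D ((c, u) :: r) v := by
    intro e v c u r hv hu hr hk
    obtain ⟨G, hG, hGD⟩ := hgen e v hv
    have Hv : Homog 𝒮 ((e, v) :: r) := (homog_cons _ _ _).2 ⟨hv.mem, hr⟩
    have hGD' : ∀ c u, u ∈ 𝒮 c → D ((c, u) :: r) v = G ((c, u) :: r) := fun c u hu =>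
      hGD _ ((homog_cons _ _ _).2 ⟨hu, hr⟩) (by simpa using hk)
    rw [hGD' c u hu]
    refine genDeg_induction (C := fun c u => D ((e, v) :: r) u =
      (c * e).negOnePow • G ((c, u) :: r)) ?_ ?_ ?_ ?_ ?_ hu
    · intro c w hw
      rw [hswap c w e v r hw hv hr hk, hGD' _ _ hw.mem]
    · intro c
      have := hG.lin.zero_slot [] r c (by simpa using hk) (by simp) hr
      rw [List.nil_append] at this
      rw [this]
      simp
    · intro c u u' hu hu' h h'
      have := hG.lin.add [] r c u u' (by simpa using hk) (by simp) hr hu hu'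
      simp only [List.nil_append] at this
      rw [this, map_add, h, h', smul_add]
    · intro c t u hu h
      have := hG.lin.smul [] r c t u (by simpa using hk) (by simp) hr hu
      simp only [List.nil_append] at this
      rw [this, map_smul, h, smul_comm]
    · intro c u c' u' hu hu' h h'
      rw [hD _ Hv (by simpa using hk) c u c' u' hu hu', hG.leib c u c' u' r hk hu hu' hr, h, h']
      simp only [AlgHom.coe_id, id_eq, mul_smul_comm, smul_mul_assoc, smul_add, smul_smul,
        ← Int.negOnePow_add, dg_cons]
      refine congrArg₂ _ (negOnePow_smul_congr ?_) (negOnePow_smul_congr ?_) <;> grind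
  -- The tail enters the twist only through its degree. Hence the derivations for the three tails
  -- have the same twist, and it suffices to compare them on generators, where `G` is linear.
  have lin_add : ∀ l r e x y, l.length + r.length + 1 = k → Homog 𝒮 l → Homog 𝒮 r → x ∈ 𝒮 e →
      y ∈ 𝒮 e → ∀ c u, u ∈ 𝒮 c → D (l ++ (e, x + y) :: r) u =
        D (l ++ (e, x) :: r) u + D (l ++ (e, y) :: r) u := by
    intro l r e x y hk hl hr hx hy c u hu
    have H : ∀ z, z ∈ 𝒮 e → Homog 𝒮 (l ++ (e, z) :: r) := fun z hz => by simp [hl, hr, hz]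
    have hlen : ∀ z, (l ++ (e, z) :: r).length = k := fun z => by simp; omega
    have hdg : ∀ z z' : S, dg (l ++ (e, z) :: r) = dg (l ++ (e, z') :: r) := by simp
    have h1 := hD _ (H _ (add_mem hx hy)) (hlen _)
    have h2 := hD _ (H _ hx) (hlen _)
    have h3 := hD _ (H _ hy) (hlen _)
    rw [hdg _ (x + y)] at h2 h3
    refine h1.ext (h2.add h3) (fun e' v hv => ?_) hu
    obtain ⟨G, hG, hGD⟩ := hgen e' v hv
    rw [LinearMap.add_apply, hGD _ (H _ (add_mem hx hy)) (hlen _), hGD _ (H _ hx) (hlen _),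
      hGD _ (H _ hy) (hlen _), hG.lin.add l r e x y hk hl hr hx hy]
  have lin_smul : ∀ l r e (t : K) x, l.length + r.length + 1 = k → Homog 𝒮 l → Homog 𝒮 r →
      x ∈ 𝒮 e → ∀ c u, u ∈ 𝒮 c → D (l ++ (e, t • x) :: r) u = t • D (l ++ (e, x) :: r) u := by
    intro l r e t x hk hl hr hx c u hu
    have H : ∀ z, z ∈ 𝒮 e → Homog 𝒮 (l ++ (e, z) :: r) := fun z hz => by simp [hl, hr, hz]
    have hlen : ∀ z, (l ++ (e, z) :: r).length = k := fun z => by simp; omega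
    have hdg : ∀ z z' : S, dg (l ++ (e, z) :: r) = dg (l ++ (e, z') :: r) := by simp
    have h1 := hD _ (H _ (Submodule.smul_mem _ t hx)) (hlen _)
    have h2 := hD _ (H _ hx) (hlen _)
    rw [hdg _ (t • x)] at h2
    refine h1.ext (h2.smul t) (fun e' v hv => ?_) hu
    obtain ⟨G, hG, hGD⟩ := hgen e' v hv
    rw [LinearMap.smul_apply, hGD _ (H _ (Submodule.smul_mem _ t hx)) (hlen _),
      hGD _ (H _ hx) (hlen _), hG.lin.smul l r e t x hk hl hr hx]
  have lin_swap : ∀ l (h h' : ℤ × S) r, l.length + r.length + 2 = k → Homog 𝒮 l → h.2 ∈ 𝒮 h.1 →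
      h'.2 ∈ 𝒮 h'.1 → Homog 𝒮 r → ∀ c u, u ∈ 𝒮 c → D (l ++ h :: h' :: r) u =
        (h.1 * h'.1).negOnePow • D (l ++ h' :: h :: r) u := by
    intro l h h' r hk hl hh hh' hr c u hu
    have H1 : Homog 𝒮 (l ++ h :: h' :: r) := by simp [hl, hr, hh, hh']
    have H2 : Homog 𝒮 (l ++ h' :: h :: r) := by simp [hl, hr, hh, hh']
    have h1 := hD _ H1 (by simp; omega)
    have h2 := hD _ H2 (by simp; omega)
    rw [show dg (l ++ h' :: h :: r) = dg (l ++ h :: h' :: r) by simp [add_left_comm]] at h2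
    -- Twisted derivations are closed under multiplication by scalars from `K`, so the sign is
    -- treated as a scalar `t = ± 1`.
    have key : ∀ t : K, (∀ G : S, t • G = (h.1 * h'.1).negOnePow • G) →
        D (l ++ h :: h' :: r) u = t • D (l ++ h' :: h :: r) u := by
      intro t ht
      refine h1.ext (h2.smul t) (fun e' v hv => ?_) hu
      obtain ⟨G, hG, hGD⟩ := hgen e' v hv
      rw [LinearMap.smul_apply, hGD _ H1 (by simp; omega), hGD _ H2 (by simp; omega), ht,
        hG.symm l h h' r hk hl hh hh' hr]
    rcases Int.units_eq_one_or (h.1 * h'.1).negOnePow with hs | hs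
    · simpa [hs] using key 1 (by simp [hs])
    · simpa [hs] using key (-1) (by simp [hs])
  -- The general case by induction on the second entry: `slot2` matches the twisted Leibniz rule of
  -- `D` in the first.
  have swap2 : ∀ e v c u r, v ∈ 𝒮 e → u ∈ 𝒮 c → Homog 𝒮 r → r.length + 1 = k →
      D ((e, v) :: r) u = (c * e).negOnePow • D ((c, u) :: r) v := by
    intro e v c u r hv hu hr hk
    have Hu : Homog 𝒮 ((c, u) :: r) := (homog_cons _ _ _).2 ⟨hu, hr⟩
    refine genDeg_induction (C := fun e v => D ((e, v) :: r) u =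
      (c * e).negOnePow • D ((c, u) :: r) v) ?_ ?_ ?_ ?_ ?_ hv
    · exact fun e v hv => swap1 e v c u r hv hu hr hk
    · intro e
      have := lin_smul [] r e 0 0 (by simpa using hk) (by simp) hr (zero_mem _) c u hu
      simp only [List.nil_append, zero_smul] at this
      rw [this, map_zero, smul_zero]
    · intro e x y hx hy h h'
      have := lin_add [] r e x y (by simpa using hk) (by simp) hr hx hy c u hu
      simp only [List.nil_append] at this
      rw [this, map_add, h, h', smul_add]
    · intro e t x hx h
      have := lin_smul [] r e t x (by simpa using hk) (by simp) hr hx c u hu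
      simp only [List.nil_append] at this
      rw [this, map_smul, h, smul_comm]
    · intro d x e y hx hy h h'
      rw [slot2 d x e y r hk hx hy hr c u hu, h, h', hD _ Hu (by simpa using hk) d x e y hx hy]
      simp only [mul_smul_comm, smul_mul_assoc, smul_add, smul_smul, ← Int.negOnePow_add, dg_cons]
      refine congrArg₂ _ (negOnePow_smul_congr ?_) (negOnePow_smul_congr ?_) <;> grind
  refine ⟨⟨?_, ?_⟩, ?_, ?_⟩
  · intro l r e x y hk hl hr hx hy
    cases l with
    | nil => simp only [List.nil_append, hF, map_add]
    | cons z l =>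
      rw [homog_cons] at hl
      simp only [List.cons_append, hF]
      exact lin_add l r e x y (by simp at hk; omega) hl.2 hr hx hy _ _ hl.1
  · intro l r e t x hk hl hr hx
    cases l with
    | nil => simp only [List.nil_append, hF, map_smul]
    | cons z l =>
      rw [homog_cons] at hl
      simp only [List.cons_append, hF]
      exact lin_smul l r e t x (by simp at hk; omega) hl.2 hr hx _ _ hl.1
  · intro l h h' r hk hl hh hh' hr
    cases l with
    | nil =>
      simp only [List.nil_append, hF]
      exact swap2 h'.1 h'.2 h.1 h.2 r hh' hh hr (by simp at hk; omega)
    | cons z l =>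
      rw [homog_cons] at hl
      simp only [List.cons_append, hF]
      exact lin_swap l h h' r (by simp at hk; omega) hl.2 hh hh' hr _ _ hl.1
  · intro d x e y r hk hx hy hr
    simp only [hF]
    rw [hD r hr (by omega) d x e y hx hy, mul_comm δ, mul_comm e]
    rfl

end Extension

/-! ### Existence of the multiderivation with prescribed values on generators. -/

section ExtensionExistence

variable {K A L S : Type*} [Field K] [Ring A] [Algebra K A] [AddCommGroup L] [Module K L]
  [Module A L] [Ring S] [Algebra K S]
  {𝒜 : ℤ → Submodule K A} {ℒ : ℤ → Submodule K L} {iA : A →ₗ[K] S} {iL : L →ₗ[K] S}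

local notation "𝒮" => genDeg 𝒜 ℒ iA iL

variable {k : ℕ} {δ : ℤ} {Z : List (ℤ × L) → S} {T : ℤ → A → List (ℤ × L) → S}
  [IsSymAlg 𝒜 ℒ iA iL] [GradedAlgebra 𝒜] [GradedCommutative 𝒜] [Decomposition ℒ]
  [SetLike.GradedSMul 𝒜 ℒ] {F : List (ℤ × S) → S}

theorem IsExtension.eq_zero (hF : IsExtension 𝒜 ℒ iA iL k δ Z T F) {e e' : ℤ} {a b : A}
    (ha : a ∈ 𝒜 e) (hb : b ∈ 𝒜 e') {u : ℤ × S} (hu : IsGen 𝒜 ℒ iA iL u.1 u.2)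
    {r : List (ℤ × S)} (hr : GenList 𝒜 ℒ iA iL r) (hk : r.length + 3 = k) :
    F (u :: (e, iA a) :: (e', iA b) :: r) = 0 := by
  have hm : iA a ∈ 𝒮 e := ofA_mem_genDeg ha
  have hm' : iA b ∈ 𝒮 e' := ofA_mem_genDeg hb
  have h1 := hF.der.symm [] u (e, iA a) ((e', iA b) :: r) (by simp; omega) (by simp) hu.mem hm
    (by simp [hr.homog, hm'])
  have h2 := hF.der.symm [(e, iA a)] u (e', iA b) r (by simp; omega) (by simp [hm]) hu.mem hm'
    hr.homog
  simp only [List.nil_append, List.singleton_append] at h1 h2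
  rw [h1, h2, hF.onAA e a e' b (u :: r) ha hb (by simp [hu, hr]) (by simp; omega), smul_zero,
    smul_zero]

/-- Consistency of the construction: fixing `ξ` and inserting `ζ` must agree with fixing `ζ` and
inserting `ξ`. Both sides are multiderivations in `r`, so the symmetry of `Z` and `T` on generators
suffices. -/
theorem swap_LL (h : IsGenData 𝒜 ℒ iA iL (k + 2) δ Z T) {e e' : ℤ} {ξ ζ : L} (hξ : ξ ∈ ℒ e)
    (hζ : ζ ∈ ℒ e') {G G' : List (ℤ × S) → S}
    (hG : IsExtension 𝒜 ℒ iA iL (k + 1) (δ + e) (fun g => Z ((e, ξ) :: g))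
      (fun e' a g => (e * e').negOnePow • T e' a ((e, ξ) :: g)) G)
    (hG' : IsExtension 𝒜 ℒ iA iL (k + 1) (δ + e') (fun g => Z ((e', ζ) :: g))
      (fun e a g => (e' * e).negOnePow • T e a ((e', ζ) :: g)) G') {r : List (ℤ × S)}
    (hr : Homog 𝒮 r) (hk : r.length = k) :
    G ((e', iL ζ) :: r) = (e * e').negOnePow • G' ((e, iL ξ) :: r) := by
  have hx : iL ξ ∈ 𝒮 e := ofL_mem_genDeg hξ
  have hz : iL ζ ∈ 𝒮 e' := ofL_mem_genDeg hζ
  refine IsMultiDer.ext_gens (hG.der.cons (h := (e', iL ζ)) hz)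
    (((hG'.der.cons (h := (e, iL ξ)) hx).negOnePow_smul (e * e')).congr_degree
      (add_right_comm δ e' e)) ?_ ?_ ?_ hr hk
  · intro g hg hk
    have h1 := hG.onL ((e', ζ) :: g) (by simp [hζ, hg]) (by simpa using hk)
    have h2 := hG'.onL ((e, ξ) :: g) (by simp [hξ, hg]) (by simpa using hk)
    rw [liftL_cons] at h1 h2
    rw [h1, h2]
    exact h.Z_symm [] (e, ξ) (e', ζ) g (by simp; omega) (by simp) hξ hζ hg
  · intro c a g ha hg hk
    have hm : iA a ∈ 𝒮 c := ofA_mem_genDeg ha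
    have h1 := hG.onA c a ((e', ζ) :: g) ha (by simp [hζ, hg]) (by simpa using hk)
    have h2 := hG'.onA c a ((e, ξ) :: g) ha (by simp [hξ, hg]) (by simpa using hk)
    have s1 := hG.der.symm [] (e', iL ζ) (c, iA a) (liftL iL g) (by simp; omega) (by simp) hz hm
      hg.liftL
    have s2 := hG'.der.symm [] (e, iL ξ) (c, iA a) (liftL iL g) (by simp; omega) (by simp) hx hm
      hg.liftL
    have s3 := h.T_symm c a ha (k + 1) rfl [] (e, ξ) (e', ζ) g (by simp; omega) (by simp) hξ hζ hg
    rw [liftL_cons] at h1 h2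
    simp only [List.nil_append] at s1 s2 s3
    rw [s1, s2, h1, h2, s3]
    simp only [smul_smul, ← Int.negOnePow_add]
    refine negOnePow_smul_congr ?_
    grind
  · intro c a c' b r ha hb hr hk
    rw [hG.eq_zero ha hb (u := (e', iL ζ)) (.ofL hζ) hr (by omega),
      hG'.eq_zero ha hb (u := (e, iL ξ)) (.ofL hξ) hr (by omega), smul_zero]

theorem swap_LA {e e' : ℤ} {ξ : L} {a : A} (hξ : ξ ∈ ℒ e)
    (ha : a ∈ 𝒜 e') {G G' : List (ℤ × S) → S}
    (hG : IsExtension 𝒜 ℒ iA iL (k + 1) (δ + e) (fun g => Z ((e, ξ) :: g))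
      (fun e' a g => (e * e').negOnePow • T e' a ((e, ξ) :: g)) G)
    (hG' : IsExtension 𝒜 ℒ iA iL (k + 1) (δ + e') (T e' a) (fun _ _ _ => 0) G')
    {r : List (ℤ × S)} (hr : Homog 𝒮 r) (hk : r.length = k) :
    G ((e', iA a) :: r) = (e * e').negOnePow • G' ((e, iL ξ) :: r) := by
  have hx : iL ξ ∈ 𝒮 e := ofL_mem_genDeg hξ
  have hz : iA a ∈ 𝒮 e' := ofA_mem_genDeg ha
  refine IsMultiDer.ext_gens (hG.der.cons (h := (e', iA a)) hz)
    (((hG'.der.cons (h := (e, iL ξ)) hx).negOnePow_smul (e * e')).congr_degree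
      (add_right_comm δ e' e)) ?_ ?_ ?_ hr hk
  · intro g hg hk
    have h1 := hG.onA e' a g ha hg (by simpa using hk)
    have h2 := hG'.onL ((e, ξ) :: g) (by simp [hξ, hg]) (by simpa using hk)
    rw [liftL_cons] at h2
    rw [h1, h2]
  · intro c b g hb hg hk
    have hm : iA b ∈ 𝒮 c := ofA_mem_genDeg hb
    have h2 := hG'.onA c b ((e, ξ) :: g) hb (by simp [hξ, hg]) (by simpa using hk)
    have s2 := hG'.der.symm [] (e, iL ξ) (c, iA b) (liftL iL g) (by simp; omega) (by simp) hx hm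
      hg.liftL
    rw [liftL_cons] at h2
    simp only [List.nil_append] at s2
    rw [s2, h2, hG.onAA e' a c b (liftL iL g) ha hb hg.genList_liftL (by simp; omega), smul_zero,
      smul_zero]
  · intro c b c' b' r hb hb' hr hk
    rw [hG.eq_zero hb hb' (u := (e', iA a)) (.ofA ha) hr (by omega),
      hG'.eq_zero hb hb' (u := (e, iL ξ)) (.ofL hξ) hr (by omega), smul_zero]

/-- With zero anchor, the bracket having one entry in `A` is a multiderivation that vanishes on all
generators. -/
theorem swap_AA {e' : ℤ} {b : A} (hb : b ∈ 𝒜 e') {G : List (ℤ × S) → S}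
    (hG : IsExtension 𝒜 ℒ iA iL (k + 1) δ Z (fun _ _ _ => 0) G)
    {r : List (ℤ × S)} (hr : Homog 𝒮 r) (hk : r.length = k) :
    G ((e', iA b) :: r) = 0 := by
  have hz : iA b ∈ 𝒮 e' := ofA_mem_genDeg hb
  refine IsMultiDer.ext_gens (hG.der.cons (h := (e', iA b)) hz) .zero ?_ ?_ ?_ hr hk
  · exact fun g hg hk => hG.onA e' b g hb hg (by omega)
  · exact fun c a g ha hg hk => hG.onAA e' b c a _ hb ha hg.genList_liftL (by simp; omega)
  · exact fun c a c' a' r ha ha' hr hk =>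
      hG.onAA e' b c a _ hb ha (by simp [hr, IsGen.ofA ha']) (by simp; omega)

/-- Induction on the number of entries. A fixed generator in front leaves generator data with one
entry fewer (`insA`, `insL`), which extend by induction. For a fixed tail `r`, the values obtained
are the values on generators of a twisted derivation in the first entry. With no entries, the
constant `Z []` is the answer. -/
theorem exists_isExtension (k : ℕ) (δ : ℤ) (Z : List (ℤ × L) → S) (T : ℤ → A → List (ℤ × L) → S)
    (h : IsGenData 𝒜 ℒ iA iL k δ Z T) : ∃ F, IsExtension 𝒜 ℒ iA iL k δ Z T F := by
  induction k generalizing δ Z T with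
  | zero =>
    refine ⟨fun _ => Z [], ⟨⟨?_, ?_⟩, ?_, ?_⟩, ?_, ?_, ?_, ?_⟩
    · intro l r _ _ _ hk; omega
    · intro l r _ _ _ hk; omega
    · intro l _ _ r hk; omega
    · intro _ _ _ _ r hk; omega
    · intro l _ hk
      rw [List.length_eq_zero_iff.1 hk]
      exact h.Z_mem [] (by simp) rfl
    · intro l _ hk
      rw [List.length_eq_zero_iff.1 hk]
    · intro _ _ g _ _ hk; omega
    · intro _ _ _ _ r _ _ _ hk; omega
  | succ k ih =>
    have hFA : ∀ e a, ∃ F, a ∈ 𝒜 e →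
        IsExtension 𝒜 ℒ iA iL k (δ + e) (T e a) (fun _ _ _ => 0) F := by
      intro e a
      by_cases ha : a ∈ 𝒜 e
      · obtain ⟨F, hF⟩ := ih _ _ _ (h.insA ha)
        exact ⟨F, fun _ => hF⟩
      · exact ⟨0, fun h => absurd h ha⟩
    have hFL : ∀ e ξ, ∃ F, ξ ∈ ℒ e →
        IsExtension 𝒜 ℒ iA iL k (δ + e) (fun g => Z ((e, ξ) :: g))
          (fun e' a g => (e * e').negOnePow • T e' a ((e, ξ) :: g)) F := by
      intro e ξ
      by_cases hξ : ξ ∈ ℒ e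
      · obtain ⟨F, hF⟩ := ih _ _ _ (h.insL hξ)
        exact ⟨F, fun _ => hF⟩
      · exact ⟨0, fun h => absurd h hξ⟩
    choose FA hFA using hFA
    choose FL hFL using hFL
    -- The first entry crosses the operation on its left, whence the twist `δ`, and the tail on its
    -- right, whence the twist `dg r`. Each condition for the derivation to exist is an identity
    -- between multiderivations in `r`.
    have hD : ∀ r, ∃ D : S →ₗ[K] S, Homog 𝒮 r → r.length = k →
        (∀ e a, a ∈ 𝒜 e → D (iA a) = FA e a r) ∧ (∀ e ξ, ξ ∈ ℒ e → D (iL ξ) = FL e ξ r) ∧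
          IsTwistedDer 𝒮 δ (dg r) D := by
      intro r
      by_cases hr : Homog 𝒮 r ∧ r.length = k
      swap
      · exact ⟨0, fun h1 h2 => absurd ⟨h1, h2⟩ hr⟩
      obtain ⟨hr, hk⟩ := hr
      refine (exists_twistedDerivation (𝒜 := 𝒜) (ℒ := ℒ) (iA := iA) (iL := iL) δ (dg r)
        (fun e a => FA e a r) (fun e ξ => FL e ξ r) ?_ ?_ ?_ ?_ ?_ ?_ ?_ ?_).imp
        fun D hD _ _ => hD
      · intro e a b ha hb
        have h1 := hFA _ _ ha
        have h2 := hFA _ _ hb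
        have h3 := hFA _ _ (add_mem ha hb)
        refine h3.der.ext_gens (h1.der.add h2.der) ?_ ?_ ?_ hr hk
        · intro g hg hk
          rw [h1.onL g hg hk, h2.onL g hg hk, h3.onL g hg hk, h.T_add e a b g ha hb hg (by omega)]
        · intro c t g ht hg hk
          rw [h1.onA c t g ht hg hk, h2.onA c t g ht hg hk, h3.onA c t g ht hg hk, add_zero]
        · intro c t c' t' r ht ht' hr hk
          rw [h1.onAA c t c' t' r ht ht' hr hk, h2.onAA c t c' t' r ht ht' hr hk,
            h3.onAA c t c' t' r ht ht' hr hk, add_zero]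
      · intro e x a ha
        have h1 := hFA _ _ ha
        have h3 := hFA _ _ (Submodule.smul_mem _ x ha)
        refine h3.der.ext_gens (h1.der.smul x) ?_ ?_ ?_ hr hk
        · intro g hg hk
          rw [h1.onL g hg hk, h3.onL g hg hk, h.T_smul e x a g ha hg (by omega)]
        · intro c t g ht hg hk
          rw [h1.onA c t g ht hg hk, h3.onA c t g ht hg hk, smul_zero]
        · intro c t c' t' r ht ht' hr hk
          rw [h1.onAA c t c' t' r ht ht' hr hk, h3.onAA c t c' t' r ht ht' hr hk, smul_zero]
      · intro e ξ ζ hξ hζ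
        have h1 := hFL _ _ hξ
        have h2 := hFL _ _ hζ
        have h3 := hFL _ _ (add_mem hξ hζ)
        refine h3.der.ext_gens (h1.der.add h2.der) ?_ ?_ ?_ hr hk
        · intro g hg hk
          rw [h1.onL g hg hk, h2.onL g hg hk, h3.onL g hg hk]
          exact h.Z_lin.add [] g e ξ ζ (by simpa using hk) (by simp) hg hξ hζ
        · intro c t g ht hg hk
          have := (h.T_lin c t ht k rfl).add [] g e ξ ζ (by simpa using hk) (by simp) hg hξ hζ
          simp only [List.nil_append] at this
          rw [h1.onA c t g ht hg hk, h2.onA c t g ht hg hk, h3.onA c t g ht hg hk, this, smul_add]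
        · intro c t c' t' r ht ht' hr hk
          rw [h1.onAA c t c' t' r ht ht' hr hk, h2.onAA c t c' t' r ht ht' hr hk,
            h3.onAA c t c' t' r ht ht' hr hk, add_zero]
      · intro e x ξ hξ
        have h1 := hFL _ _ hξ
        have h3 := hFL _ _ (Submodule.smul_mem _ x hξ)
        refine h3.der.ext_gens (h1.der.smul x) ?_ ?_ ?_ hr hk
        · intro g hg hk
          rw [h1.onL g hg hk, h3.onL g hg hk]
          exact h.Z_lin.smul [] g e x ξ (by simpa using hk) (by simp) hg hξ
        · intro c t g ht hg hk
          have := (h.T_lin c t ht k rfl).smul [] g e x ξ (by simpa using hk) (by simp) hg hξ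
          simp only [List.nil_append] at this
          rw [h1.onA c t g ht hg hk, h3.onA c t g ht hg hk, this, smul_comm]
        · intro c t c' t' r ht ht' hr hk
          rw [h1.onAA c t c' t' r ht ht' hr hk, h3.onAA c t c' t' r ht ht' hr hk, smul_zero]
      · exact fun e a ha => (hFA e a ha).mem r hr hk
      · exact fun e ξ hξ => (hFL e ξ hξ).mem r hr hk
      -- As functions of `r`, the two terms of the Leibniz rule for `a * b` are a left multiple and
      -- a right multiple of lower extensions; on generators the identity is `T_mul`.
      · intro e a e' b ha hb
        have h1 := hFA _ _ ha
        have h2 := hFA _ _ hb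
        have h3 := hFA _ _ (SetLike.GradedMul.mul_mem ha hb)
        have ma : iA a ∈ 𝒮 e := ofA_mem_genDeg ha
        have mb : iA b ∈ 𝒮 e' := ofA_mem_genDeg hb
        have d2 := ((h2.der.mul_left ma).negOnePow_smul (δ * e)).congr_degree
          (δ' := δ + (e + e')) (by ring)
        have d1 := (h1.der.mul_right mb).congr_degree (δ' := δ + (e + e')) (by ring)
        have key := h3.der.ext_gens (d2.add d1) ?_ ?_ ?_ hr hk
        · simpa [mul_comm e'] using key
        · intro g hg hk
          rw [h1.onL g hg hk, h2.onL g hg hk, h3.onL g hg hk, dg_liftL, mul_comm e',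
            h.T_mul e a e' b g ha hb hg (by omega)]
          rfl
        · intro c t g ht hg hk
          rw [h1.onA c t g ht hg hk, h2.onA c t g ht hg hk, h3.onA c t g ht hg hk]
          simp
        · intro c t c' t' r ht ht' hr hk
          rw [h1.onAA c t c' t' r ht ht' hr hk, h2.onAA c t c' t' r ht ht' hr hk,
            h3.onAA c t c' t' r ht ht' hr hk]
          simp
      · intro e a e' ξ ha hξ
        have h1 := hFA _ _ ha
        have h2 := hFL _ _ hξ
        have hs : a • ξ ∈ ℒ (e + e') := SetLike.GradedSMul.smul_mem ha hξ
        have h3 := hFL _ _ hs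
        have ma : iA a ∈ 𝒮 e := ofA_mem_genDeg ha
        have mb : iL ξ ∈ 𝒮 e' := ofL_mem_genDeg hξ
        have d2 := ((h2.der.mul_left ma).negOnePow_smul (δ * e)).congr_degree
          (δ' := δ + (e + e')) (by ring)
        have d1 := (h1.der.mul_right mb).congr_degree (δ' := δ + (e + e')) (by ring)
        have key := h3.der.ext_gens (d2.add d1) ?_ ?_ ?_ hr hk
        · simpa [mul_comm e'] using key
        · intro g hg hk
          rw [h1.onL g hg hk, h2.onL g hg hk, h3.onL g hg hk, dg_liftL, mul_comm e',
            h.Z_left e a e' ξ g ha hξ hg (by omega)]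
          rfl
        · intro c t g ht hg hk
          rw [h1.onA c t g ht hg hk, h2.onA c t g ht hg hk, h3.onA c t g ht hg hk,
            h.T_left c t e a e' ξ g ht ha hξ hg (by omega), zero_mul, smul_zero, add_zero,
            AlgHom.coe_id, id_eq]
          simp only [smul_smul, ← Int.negOnePow_add, mul_smul_comm]
          refine negOnePow_smul_congr ?_
          grind
        · intro c t c' t' r ht ht' hr hk
          rw [h1.onAA c t c' t' r ht ht' hr hk, h2.onAA c t c' t' r ht ht' hr hk,
            h3.onAA c t c' t' r ht ht' hr hk]
          simp
    choose D hD using hD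
    let F : List (ℤ × S) → S := fun l => match l with
      | [] => 0
      | u :: r => D r u.2
    have hder : IsMultiDer 𝒮 (AlgHom.id K S) (k + 1) δ F := by
      refine isMultiDer_of_twistedDer D (fun _ _ => rfl) (fun r hr hk => (hD r hr hk).2.2) ?_ ?_
      · intro e v hv
        cases hv with
        | @ofA a ha => exact ⟨FA e a, (hFA e a ha).der, fun r hr hk => (hD r hr hk).1 e a ha⟩
        | @ofL ξ hξ => exact ⟨FL e ξ, (hFL e ξ hξ).der, fun r hr hk => (hD r hr hk).2.1 e ξ hξ⟩
      · intro e v e' w r hv hw hr hk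
        obtain ⟨k, rfl⟩ : ∃ j, k = j + 1 := ⟨r.length, hk.symm⟩
        have Hv := hD ((e, v) :: r) ((homog_cons _ _ _).2 ⟨hv.mem, hr⟩) (by simpa using hk)
        have Hw := hD ((e', w) :: r) ((homog_cons _ _ _).2 ⟨hw.mem, hr⟩) (by simpa using hk)
        have hk' : r.length = k := by omega
        cases hv with
        | @ofA a ha =>
          rw [Hw.1 e a ha]
          cases hw with
          | @ofA b hb =>
            rw [Hv.1 e' b hb, swap_AA hb (hFA e a ha) hr hk', swap_AA ha (hFA e' b hb) hr hk',
              smul_zero]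
          | @ofL ζ hζ =>
            rw [Hv.2.1 e' ζ hζ, swap_LA hζ ha (hFL e' ζ hζ) (hFA e a ha) hr hk', smul_smul,
              ← Int.negOnePow_add, negOnePow_congr (m := e * e' + e' * e) (n := 0) (by grind)]
            simp
        | @ofL ξ hξ =>
          rw [Hw.2.1 e ξ hξ]
          cases hw with
          | @ofA b hb =>
            rw [Hv.1 e' b hb, swap_LA hξ hb (hFL e ξ hξ) (hFA e' b hb) hr hk']
          | @ofL ζ hζ =>
            rw [Hv.2.1 e' ζ hζ, swap_LL h hξ hζ (hFL e ξ hξ) (hFL e' ζ hζ) hr hk']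
    refine ⟨F, hder, ?_, ?_, ?_, ?_⟩
    · intro l hl hk
      obtain _ | ⟨⟨c, u⟩, r⟩ := l
      · simp at hk
      rw [homog_cons] at hl
      have Hr := hD r hl.2 (by simpa using hk)
      change D r u ∈ 𝒮 (δ + (c + dg r))
      refine genDeg_induction (C := fun c u => D r u ∈ 𝒮 (δ + (c + dg r))) ?_ (by simp) ?_ ?_ ?_ hl.1
      · intro e v hv
        rw [← add_assoc]
        cases hv with
        | @ofA a ha => rw [Hr.1 e a ha]; exact (hFA e a ha).mem r hl.2 (by simpa using hk)
        | @ofL ξ hξ => rw [Hr.2.1 e ξ hξ]; exact (hFL e ξ hξ).mem r hl.2 (by simpa using hk)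
      · intro d x y _ _ hx hy
        rw [map_add]
        exact add_mem hx hy
      · intro d t x _ hx
        rw [map_smul]
        exact Submodule.smul_mem _ t hx
      · intro d x e y hx hy hDx hDy
        rw [Hr.2.2 d x e y hx hy, Units.smul_def, Units.smul_def]
        have e1 : δ + (d + e + dg r) = d + (δ + (e + dg r)) := by ring
        have e2 : d + (δ + (e + dg r)) = δ + (d + dg r) + e := by ring
        refine add_mem (zsmul_mem ?_ _) (zsmul_mem ?_ _)
        · rw [e1]; exact mul_mem_genDeg hx hDy
        · rw [e1, e2]; exact mul_mem_genDeg hDx hy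
    · intro g hg hk
      obtain _ | ⟨⟨e, ξ⟩, g⟩ := g
      · simp at hk
      rw [homog_cons] at hg
      exact ((hD _ hg.2.liftL (by simpa using hk)).2.1 e ξ hg.1).trans
        ((hFL e ξ hg.1).onL g hg.2 (by simpa using hk))
    · intro e a g ha hg hk
      exact ((hD _ hg.liftL (by simpa using hk)).1 e a ha).trans
        ((hFA e a ha).onL g hg (by simpa using hk))
    · intro e a e' b r ha hb hr hk
      have mb : iA b ∈ 𝒮 e' := ofA_mem_genDeg hb
      obtain ⟨k, rfl⟩ : ∃ j, k = j + 1 := ⟨r.length, by omega⟩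
      have hk : r.length = k := by omega
      exact ((hD ((e', iA b) :: r) ((homog_cons _ _ _).2 ⟨mb, hr.homog⟩) (by simpa using hk)).1
        e a ha).trans (swap_AA hb (hFA e a ha) hr.homog hk)

end ExtensionExistence

/-! ### The bracket and the anchor as generator data. -/

section MultiderivationData

variable {K A L S : Type*} [Field K] [Ring A] [Algebra K A] [AddCommGroup L] [Module K L]
  [Module A L] [Ring S] [Algebra K S]
  {𝒜 : ℤ → Submodule K A} {ℒ : ℤ → Submodule K L} {iA : A →ₗ[K] S} {iL : L →ₗ[K] S}

theorem cons_ofFn {M : Type*} (h : ℤ × M) {k : ℕ} (n : Fin k → ℤ) (ξ : Fin k → M) :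
    h :: List.ofFn (fun i => (n i, ξ i)) = List.ofFn fun i : Fin (k + 1) =>
      ((Fin.cons h.1 n : Fin (k + 1) → ℤ) i, (Fin.cons h.2 ξ : Fin (k + 1) → M) i) := by
  simp [List.ofFn_succ]

theorem ofFn_append_singleton {M : Type*} (h : ℤ × M) {k : ℕ} (n : Fin k → ℤ) (ξ : Fin k → M) :
    List.ofFn (fun i => (n i, ξ i)) ++ [h] = List.ofFn fun i : Fin (k + 1) =>
      ((Fin.snoc (α := fun _ => ℤ) n h.1) i, (Fin.snoc (α := fun _ => M) ξ h.2) i) := by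
  rw [List.ofFn_succ']
  simp [List.concat_eq_append]

theorem lf_mem {M N : Type*} [AddCommGroup M] [Module K M] [AddCommGroup N] [Module K N]
    {ℳ : ℤ → Submodule K M} {𝒩 : ℤ → Submodule K N} {k : ℕ} {d : ℤ}
    {Ω : MultilinearMap K (fun _ : Fin k => M) N} (hΩ : HasDegree ℳ 𝒩 d Ω) {l : List (ℤ × M)}
    (hl : Homog ℳ l) : lf Ω l ∈ 𝒩 (d + dg l) := by
  by_cases hk : l.length = k
  · obtain ⟨n, ξ, rfl⟩ := exists_eq_ofFn hk
    rw [lf_ofFn, dg_ofFn]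
    exact hΩ n ξ ((homog_ofFn ℳ).1 hl)
  · rw [lf_of_length_ne Ω hk]
    exact zero_mem _

theorem lf_op_mem {M N : Type*} [AddCommGroup M] [Module K M] [AddCommGroup N] [Module K N]
    {ℳ : ℤ → Submodule K M} {𝒩 : ℤ → Submodule K N} {k : ℕ} {d : ℤ}
    {Ω : MultilinearMap K (fun _ : Fin k => M) (N →ₗ[K] N)} (hΩ : HasOpDegree ℳ 𝒩 d Ω)
    {l : List (ℤ × M)} (hl : Homog ℳ l) {j : ℤ} {x : N} (hx : x ∈ 𝒩 j) :
    lf Ω l x ∈ 𝒩 (d + dg l + j) := by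
  by_cases hk : l.length = k
  · obtain ⟨n, ξ, rfl⟩ := exists_eq_ofFn hk
    rw [lf_ofFn, dg_ofFn]
    exact hΩ n ξ ((homog_ofFn ℳ).1 hl) j x hx
  · rw [lf_of_length_ne Ω hk]
    exact zero_mem _

theorem lf_smul_cons {M : Type*} [AddCommGroup M] [Module K M] [Module A M] {k : ℕ} {d : ℤ}
    {Ω : MultilinearMap K (fun _ : Fin k => L) M} (hΩ : IsGradedMultilinear 𝒜 ℒ d Ω)
    {e e' : ℤ} {a : A} {ξ : L} (ha : a ∈ 𝒜 e) (hξ : ξ ∈ ℒ e') {l : List (ℤ × L)}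
    (hl : Homog ℒ l) :
    lf Ω ((e + e', a • ξ) :: l) = (e * d).negOnePow • (a • lf Ω ((e', ξ) :: l)) := by
  by_cases hk : l.length + 1 = k
  · obtain ⟨k, rfl⟩ : ∃ j, k = j + 1 := ⟨_, hk.symm⟩
    obtain ⟨n, ζ, rfl⟩ := exists_eq_ofFn (k := k) (l := l) (by omega)
    have := hΩ (Fin.cons e' n) (Fin.cons ξ ζ)
      (fun i => homog_fin_cons ((homog_ofFn ℒ).1 hl) hξ i) e a ha 0
    rw [Fin.cons_zero, Fin.update_cons_zero] at this
    simp only [Fin.not_lt_zero, Finset.filter_false, Finset.sum_empty, add_zero] at this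
    rw [cons_ofFn, cons_ofFn, lf_ofFn, lf_ofFn, this]
  · rw [lf_of_length_ne, lf_of_length_ne, smul_zero, smul_zero] <;> simpa using hk

variable [IsSymAlg 𝒜 ℒ iA iL] [GradedAlgebra 𝒜] [GradedCommutative 𝒜] [Decomposition ℒ]
  [SetLike.GradedSMul 𝒜 ℒ]

/-- The Leibniz rule of a multiderivation concerns the last entry; graded symmetry carries it to the
first, which is where the list arguments use it. -/
theorem Multiderivation.X_smul_cons (𝕏 : Multiderivation 𝒜 ℒ) (m : ℕ) {e e' : ℤ} {a : A} {ξ : L}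
    (ha : a ∈ 𝒜 e) (hξ : ξ ∈ ℒ e') {g : List (ℤ × L)} (hg : Homog ℒ g) :
    lf (𝕏.X m) ((e + e', a • ξ) :: g) = e.negOnePow • (a • lf (𝕏.X m) ((e', ξ) :: g)) +
      (dg g * e' + e * dg g).negOnePow • (lf (𝕏.σ m) g a • ξ) := by
  by_cases hk : g.length = m
  swap
  · rw [lf_of_length_ne _ (by simpa using hk), lf_of_length_ne _ (by simpa using hk),
      lf_of_length_ne _ hk]
    simp
  obtain ⟨n, ζ, rfl⟩ := exists_eq_ofFn hk
  have hs : a • ξ ∈ ℒ (e + e') := SetLike.GradedSMul.smul_mem ha hξ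
  have := 𝕏.X_leibniz m n ζ ((homog_ofFn ℒ).1 hg) e a ξ ha
  rw [← lf_ofFn (𝕏.X m) (Fin.snoc (α := fun _ => ℤ) n (e + e')),
    ← lf_ofFn (𝕏.X m) (Fin.snoc (α := fun _ => ℤ) n e')] at this
  rw [← ofFn_append_singleton ((e + e' : ℤ), a • ξ), ← ofFn_append_singleton (e', ξ),
    SwapSymm.move_front (lf_swapSymm (𝕏.X_symm m)) (h := ((e + e' : ℤ), a • ξ)) hs _ [] rfl hg
      (by simp),
    SwapSymm.move_front (lf_swapSymm (𝕏.X_symm m)) (h := (e', ξ)) hξ _ [] rfl hg (by simp),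
    List.append_nil, ← lf_ofFn (𝕏.σ m) n ζ, ← dg_ofFn n ζ] at this
  generalize List.ofFn (fun i => (n i, ζ i)) = G at *
  -- Multiplying by the sign of moving `a • ξ` to the front frees the left-hand side of its sign.
  have key := congrArg (fun x => ((e + e') * dg G).negOnePow • x) this
  simp only [smul_add, smul_smul, ← Int.negOnePow_add, smul_comm a] at key
  rw [negOnePow_congr (m := (e + e') * dg G + (e + e') * dg G) (n := 0) (by grind),
    Int.negOnePow_zero, one_smul] at key
  rw [key, add_comm]
  refine congrArg₂ _ (negOnePow_smul_congr ?_) (negOnePow_smul_congr ?_) <;> grind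

/-- The anchor takes `a` as its last argument and `T` takes it first, hence the sign `(-1)^{e |g|}`.
-/
theorem Multiderivation.isGenData (𝕏 : Multiderivation 𝒜 ℒ) (m : ℕ) :
    IsGenData 𝒜 ℒ iA iL (m + 1) 1 (fun g => iL (lf (𝕏.X m) g))
      fun e a g => (e * dg g).negOnePow • iA (lf (𝕏.σ m) g a) where
  Z_lin := (lf_slotLinear (𝕏.X m)).comp iL
  Z_symm := (lf_swapSymm (𝕏.X_symm m)).comp iL
  T_lin e a _ j _ := ((lf_slotLinear (𝕏.σ m)).comp (iA ∘ₗ LinearMap.applyₗ a)).dg_smul e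
  T_symm e a _ j _ := ((lf_swapSymm (𝕏.σ_symm m)).comp (iA ∘ₗ LinearMap.applyₗ a)).dg_smul e
  T_add e a b g _ _ _ _ := by rw [map_add, map_add, smul_add]
  T_smul e c a g _ _ _ := by rw [map_smul, map_smul, smul_comm]
  T_mul e a e' b g ha hb hg hk := by
    obtain ⟨n, ξ, rfl⟩ := exists_eq_ofFn (k := m) (l := g) (by omega)
    have := 𝕏.σ_derivation m n ξ ((homog_ofFn ℒ).1 hg) e a b ha
    rw [lf_ofFn, dg_ofFn, this, map_add, IsSymAlg.mul (𝒜 := 𝒜) (ℒ := ℒ) (iA := iA) (iL := iL),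
      Units.smul_def ((1 + ∑ i, n i) * e).negOnePow, map_zsmul, ← Units.smul_def,
      IsSymAlg.mul (𝒜 := 𝒜) (ℒ := ℒ) (iA := iA) (iL := iL),
      add_comm (iA (𝕏.σ m ξ a) * iA b)]
    simp only [smul_add, smul_smul, ← Int.negOnePow_add, mul_smul_comm, smul_mul_assoc]
    refine congrArg₂ _ (negOnePow_smul_congr ?_) (negOnePow_smul_congr ?_) <;> grind
  T_left e a e₁ b e₂ ξ g ha hb hξ hg hk := by
    have h1 := lf_smul_cons (𝕏.σ_linear m) hb hξ hg
    rw [h1, Units.smul_def ((e₁ * 1).negOnePow), LinearMap.smul_apply, map_zsmul, ← Units.smul_def,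
      LinearMap.smul_apply, smul_eq_mul, IsSymAlg.mul (𝒜 := 𝒜) (ℒ := ℒ) (iA := iA) (iL := iL)]
    simp only [smul_smul, ← Int.negOnePow_add, mul_smul_comm, dg_cons]
    refine negOnePow_smul_congr ?_
    grind
  Z_left e a e' ξ g ha hξ hg hk := by
    rw [𝕏.X_smul_cons m ha hξ hg, map_add, Units.smul_def, Units.smul_def, map_zsmul,
      map_zsmul, ← IsSymAlg.smul (𝒜 := 𝒜) (ℒ := ℒ) (iA := iA) (iL := iL),
      ← IsSymAlg.smul (𝒜 := 𝒜) (ℒ := ℒ) (iA := iA) (iL := iL), ← Units.smul_def, ← Units.smul_def,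
      smul_mul_assoc, smul_smul, ← Int.negOnePow_add, one_mul]
  Z_mem g hg hk := ofL_mem_genDeg (lf_mem (𝕏.X_degree m) hg)
  T_mem e a g ha hg hk := by
    have : iA (lf (𝕏.σ m) g a) ∈ genDeg 𝒜 ℒ iA iL (1 + dg g + e) :=
      ofA_mem_genDeg (lf_op_mem (𝕏.σ_degree m) hg ha)
    rw [add_right_comm, Units.smul_def]
    exact zsmul_mem this _

end MultiderivationData

/-! ### Evaluation of symmetric forms on lists -/

section Evaluation

variable {K A L P : Type*} [Field K] [Ring A] [Algebra K A] [AddCommGroup L] [Module K L]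
  [Module A L] [AddCommGroup P] [Module K P] [Module A P] [IsScalarTower K A P]
  {𝒜 : ℤ → Submodule K A} {ℒ : ℤ → Submodule K L} {𝒲 : ℤ → Submodule K P}

/-- The values of an element of `Sym_A(L, P)` on lists of elements of `L`. -/
noncomputable def ev : Sym 𝒜 ℒ 𝒲 →ₗ[K] List (ℤ × L) → P :=
  symLift fun p =>
    { toFun := fun Ω => lf (Ω : MultilinearMap K (fun _ : Fin p.1 => L) P)
      map_add' := fun Ω Ω' => funext fun l => lf_add Ω.1 Ω'.1 l
      map_smul' := fun c Ω => funext fun l => lf_smul c Ω.1 l }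

theorem ev_formOf (ℓ : ℕ) (d : ℤ) (Ω : symForm 𝒜 ℒ 𝒲 ℓ d) :
    ev (formOf 𝒜 ℒ 𝒲 ℓ d Ω) = lf Ω.1 := symLift_formOf _ ℓ d Ω

variable (𝒜 ℒ 𝒲) in
/-- The forms of degree `d`, with any number of entries. -/
noncomputable def symPart (d : ℤ) : Submodule K (Sym 𝒜 ℒ 𝒲) := ⨆ ℓ, LinearMap.range (formOf 𝒜 ℒ 𝒲 ℓ d)

theorem formOf_mem (ℓ : ℕ) (d : ℤ) (Ω : symForm 𝒜 ℒ 𝒲 ℓ d) :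
    formOf 𝒜 ℒ 𝒲 ℓ d Ω ∈ symPart 𝒜 ℒ 𝒲 d :=
  Submodule.mem_iSup_of_mem ℓ ⟨Ω, rfl⟩

theorem symPart_induction {d : ℤ} {C : Sym 𝒜 ℒ 𝒲 → Prop}
    (form : ∀ ℓ (Ω : symForm 𝒜 ℒ 𝒲 ℓ d), C (formOf 𝒜 ℒ 𝒲 ℓ d Ω)) (zero : C 0)
    (add : ∀ x y, C x → C y → C (x + y)) {x : Sym 𝒜 ℒ 𝒲} (hx : x ∈ symPart 𝒜 ℒ 𝒲 d) : C x := by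
  refine Submodule.iSup_induction _ (motive := C) hx ?_ zero add
  rintro ℓ _ ⟨Ω, rfl⟩
  exact form ℓ Ω

/-- The number of entries of a component is visible from the length of the list, but its degree is
not: evaluation adds up the components of all degrees. Hence the restriction to one degree `d`. -/
theorem eq_zero_of_ev [Decomposition ℒ] {d : ℤ} {x : Sym 𝒜 ℒ 𝒲} (hx : x ∈ symPart 𝒜 ℒ 𝒲 d)
    (h : ∀ l, Homog ℒ l → ev x l = 0) : x = 0 := by
  let c : ∀ p : ℕ × ℤ, Sym 𝒜 ℒ 𝒲 →ₗ[K] symForm 𝒜 ℒ 𝒲 p.1 p.2 := fun p =>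
    DirectSum.component K (ℕ × ℤ) (fun p => symForm 𝒜 ℒ 𝒲 p.1 p.2) p
  have h1 : ∀ ℓ d', d' ≠ d → c (ℓ, d') x = 0 := by
    intro ℓ d' hd
    refine symPart_induction (C := fun x => c (ℓ, d') x = 0) ?_ (map_zero _) ?_ hx
    · intro ℓ' Ω
      exact DirectSum.of_eq_of_ne (β := fun p : ℕ × ℤ => symForm 𝒜 ℒ 𝒲 p.1 p.2) (ℓ', d) (ℓ, d') Ω
        (by simp [hd])
    · intro x y hx hy
      rw [map_add, hx, hy, add_zero]
  have h2 : ∀ ℓ l, l.length = ℓ → ev x l =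
      lf (c (ℓ, d) x : MultilinearMap K (fun _ : Fin ℓ => L) P) l := by
    intro ℓ l hl
    refine symPart_induction (C := fun x => ev x l =
      lf (c (ℓ, d) x : MultilinearMap K (fun _ : Fin ℓ => L) P) l) ?_ ?_ ?_ hx
    · intro ℓ' Ω
      rw [ev_formOf]
      by_cases h : ℓ' = ℓ
      · subst h
        have : c (ℓ', d) (formOf 𝒜 ℒ 𝒲 ℓ' d Ω) = Ω := DirectSum.of_eq_same (β := fun p : ℕ × ℤ => symForm 𝒜 ℒ 𝒲 p.1 p.2) (ℓ', d) Ω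
        rw [this]
      · have : c (ℓ, d) (formOf 𝒜 ℒ 𝒲 ℓ' d Ω) = 0 :=
          DirectSum.of_eq_of_ne (β := fun p : ℕ × ℤ => symForm 𝒜 ℒ 𝒲 p.1 p.2) (ℓ', d) (ℓ, d) Ω
            (by simp [Ne.symm h])
        rw [this, lf_of_length_ne _ (by omega)]
        have := lf_smul (0 : K) (0 : MultilinearMap K (fun _ : Fin ℓ => L) P) l
        rw [zero_smul, zero_smul] at this
        exact this.symm
    · have := lf_smul (0 : K) (0 : MultilinearMap K (fun _ : Fin ℓ => L) P) l
      rw [zero_smul, zero_smul] at this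
      rw [map_zero, map_zero]
      exact this.symm
    · intro x y hx hy
      rw [map_add, map_add, Pi.add_apply, hx, hy]
      exact (lf_add _ _ l).symm
  refine DFinsupp.ext fun p => ?_
  obtain ⟨ℓ, d'⟩ := p
  by_cases hd : d' = d
  · subst hd
    refine Subtype.ext (multilinear_ext ℒ fun n ξ hξ => ?_)
    have := h2 ℓ (List.ofFn fun i => (n i, ξ i)) (by simp)
    rw [h _ ((homog_ofFn ℒ).2 hξ), lf_ofFn] at this
    exact this.symm
  · exact h1 ℓ d' hd

variable {d : ℤ} {x : Sym 𝒜 ℒ 𝒲}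

theorem ev_slotLinear (hx : x ∈ symPart 𝒜 ℒ 𝒲 d) (j : ℕ) : SlotLinear ℒ j (ev x) := by
  refine symPart_induction (C := fun x => SlotLinear ℒ j (ev x)) ?_ ?_ ?_ hx
  · intro ℓ Ω
    rw [ev_formOf]
    exact lf_slotLinear Ω.1
  · exact ⟨by simp, by simp⟩
  · intro x y hx hy
    rw [map_add]
    exact hx.addFun hy

theorem ev_swapSymm (hx : x ∈ symPart 𝒜 ℒ 𝒲 d) (j : ℕ) : SwapSymm ℒ j (ev x) := by
  refine symPart_induction (C := fun x => SwapSymm ℒ j (ev x)) ?_ ?_ ?_ hx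
  · intro ℓ Ω
    rw [ev_formOf]
    exact lf_swapSymm Ω.2.2.1
  · intro l h h' r _ _ _ _ _
    simp
  · intro x y hx hy
    rw [map_add]
    exact hx.addFun hy

theorem ev_zero_cons (hx : x ∈ symPart 𝒜 ℒ 𝒲 d) (e : ℤ) {l : List (ℤ × L)} (hl : Homog ℒ l) :
    ev x ((e, 0) :: l) = 0 :=
  (ev_slotLinear hx _).zero_slot [] l e rfl (homog_nil ℒ) hl

theorem ev_neg_cons (hx : x ∈ symPart 𝒜 ℒ 𝒲 d) {e : ℤ} {ξ : L} (hξ : ξ ∈ ℒ e) {l : List (ℤ × L)}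
    (hl : Homog ℒ l) : ev x ((e, -ξ) :: l) = - ev x ((e, ξ) :: l) := by
  have := (ev_slotLinear hx _).smul [] l e (-1) ξ rfl (homog_nil ℒ) hl hξ
  simpa using this

section InsertA

variable [Decomposition 𝒜] [GradedCommutative 𝒜] [SetLike.GradedSMul 𝒜 𝒲]

theorem insertA_mem {e : ℤ} {a : A} (ha : a ∈ 𝒜 e) (hx : x ∈ symPart 𝒜 ℒ 𝒲 d) :
    insertA 𝒜 ℒ 𝒲 a x ∈ symPart 𝒜 ℒ 𝒲 (e + d) := by
  refine symPart_induction (C := fun x => insertA 𝒜 ℒ 𝒲 a x ∈ symPart 𝒜 ℒ 𝒲 (e + d)) ?_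
    (by simp) ?_ hx
  · intro ℓ Ω
    rw [insertA_apply _ _ _ ha]
    exact formOf_mem _ _ _
  · intro x y hx hy
    rw [map_add]
    exact add_mem hx hy

theorem ev_insertA {e : ℤ} {a : A} (ha : a ∈ 𝒜 e) (hx : x ∈ symPart 𝒜 ℒ 𝒲 d) (l : List (ℤ × L)) :
    ev (insertA 𝒜 ℒ 𝒲 a x) l = a • ev x l := by
  refine symPart_induction (C := fun x => ev (insertA 𝒜 ℒ 𝒲 a x) l = a • ev x l) ?_
    (by simp) ?_ hx
  · intro ℓ Ω
    rw [insertA_apply _ _ _ ha, ev_formOf, ev_formOf]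
    exact lf_smul a Ω.1 l
  · intro x y hx hy
    rw [map_add, map_add, map_add, Pi.add_apply, Pi.add_apply, hx, hy, smul_add]

end InsertA

section InsertL

variable [Decomposition ℒ]

theorem insertL_mem {e : ℤ} {ξ : L} (hξ : ξ ∈ ℒ e) (hx : x ∈ symPart 𝒜 ℒ 𝒲 d) :
    insertL 𝒜 ℒ 𝒲 ξ x ∈ symPart 𝒜 ℒ 𝒲 (e + d) := by
  refine symPart_induction (C := fun x => insertL 𝒜 ℒ 𝒲 ξ x ∈ symPart 𝒜 ℒ 𝒲 (e + d)) ?_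
    (by simp) ?_ hx
  · intro ℓ Ω
    cases ℓ with
    | zero => rw [insertL_zero _ _ _ hξ]; exact zero_mem _
    | succ ℓ => rw [insertL_succ _ _ _ hξ]; exact formOf_mem _ _ _
  · intro x y hx hy
    rw [map_add]
    exact add_mem hx hy

theorem ev_insertL {e : ℤ} {ξ : L} (hξ : ξ ∈ ℒ e) (hx : x ∈ symPart 𝒜 ℒ 𝒲 d)
    (l : List (ℤ × L)) :
    ev (insertL 𝒜 ℒ 𝒲 ξ x) l = (e * d).negOnePow • ev x ((e, ξ) :: l) := by
  refine symPart_induction (C := fun x => ev (insertL 𝒜 ℒ 𝒲 ξ x) l =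
    (e * d).negOnePow • ev x ((e, ξ) :: l)) ?_ (by simp) ?_ hx
  · intro ℓ Ω
    cases ℓ with
    | zero => rw [insertL_zero _ _ _ hξ, ev_formOf, lf_zero_cons, map_zero, smul_zero]; rfl
    | succ ℓ =>
      rw [insertL_succ _ _ _ hξ, ev_formOf, ev_formOf, lf_succ_cons]
      exact lf_smul _ _ l
  · intro x y hx hy
    rw [map_add, map_add, map_add, Pi.add_apply, Pi.add_apply, hx, hy, smul_add]

end InsertL

end Evaluation

/-! ### Operators of Chevalley-Eilenberg type -/

section Realization

variable {K A L P : Type*} [Field K] [Ring A] [Algebra K A] [AddCommGroup L] [Module K L]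
  [Module A L] [AddCommGroup P] [Module K P] [Module A P] [IsScalarTower K A P]
  {𝒜 : ℤ → Submodule K A} {ℒ : ℤ → Submodule K L} {𝒲 : ℤ → Submodule K P}

/-- The operator `F` on forms, of degree `δ`, is given by the Chevalley-Eilenberg formula for the
operators `N` on `P` and the bracket `X`. -/
structure Realizes (F : Module.End K (Sym 𝒜 ℒ 𝒲)) (δ : ℤ) (N : List (ℤ × L) → P →ₗ[K] P)
    (X : List (ℤ × L) → L) : Prop where
  X_mem : ∀ l, Homog ℒ l → X l ∈ ℒ (δ + dg l)
  mem : ∀ d x, x ∈ symPart 𝒜 ℒ 𝒲 d → F x ∈ symPart 𝒜 ℒ 𝒲 (δ + d)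
  ev_eq : ∀ d x l, x ∈ symPart 𝒜 ℒ 𝒲 d → Homog ℒ l → ev (F x) l =
    splitSum (fun l₁ l₂ => (d * dg l₁).negOnePow • N l₁ (ev x l₂)) l -
      (d * δ).negOnePow • splitSum (fun l₁ l₂ => ev x ((δ + dg l₁, X l₁) :: l₂)) l

variable {F G : Module.End K (Sym 𝒜 ℒ 𝒲)} {δ : ℤ} {N N' : List (ℤ × L) → P →ₗ[K] P}
  {X : List (ℤ × L) → L}

theorem eq_of_ev [Decomposition ℒ]
    (hF : ∀ d x, x ∈ symPart 𝒜 ℒ 𝒲 d → F x ∈ symPart 𝒜 ℒ 𝒲 (δ + d))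
    (hG : ∀ d x, x ∈ symPart 𝒜 ℒ 𝒲 d → G x ∈ symPart 𝒜 ℒ 𝒲 (δ + d))
    (h : ∀ d x l, x ∈ symPart 𝒜 ℒ 𝒲 d → Homog ℒ l → ev (F x) l = ev (G x) l) : F = G := by
  refine sym_ext fun ℓ d Ω => sub_eq_zero.1 ?_
  have hx := formOf_mem ℓ d Ω
  refine eq_zero_of_ev (sub_mem (hF d _ hx) (hG d _ hx)) fun l hl => ?_
  rw [map_sub, Pi.sub_apply, h d _ l hx hl, sub_self]

/-- With `N` absent and `X` living on the empty list only, the formula has the single term in which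
the constant `X []` is put in front of all arguments. -/
theorem Realizes.eq_insertL [Decomposition ℒ] (hF : Realizes F δ N X)
    (hN : ∀ l, Homog ℒ l → N l = 0) (hX : ∀ h l, Homog ℒ (h :: l) → X (h :: l) = 0) :
    F = - insertL 𝒜 ℒ 𝒲 (X []) := by
  have hm : X [] ∈ ℒ δ := by simpa using hF.X_mem [] (by simp)
  refine eq_of_ev hF.mem (fun d x hx => neg_mem (insertL_mem hm hx)) fun d x l hx hl => ?_
  rw [hF.ev_eq d x l hx hl, splitSum_congr (G' := fun _ _ => 0) hl (fun l₁ l₂ h1 _ _ _ => by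
      rw [hN l₁ h1, LinearMap.zero_apply, smul_zero]), splitSum_zero, zero_sub,
    splitSum_eq_of_ne_nil hl (fun h l₁ l₂ h1 h2 => by rw [hX h l₁ h1, ev_zero_cons hx _ h2]),
    LinearMap.neg_apply, map_neg, Pi.neg_apply, ev_insertL hm hx, dg_nil, add_zero, mul_comm]

theorem Realizes.eq_insertA [Decomposition ℒ] [Decomposition 𝒜] [GradedCommutative 𝒜]
    [SetLike.GradedSMul 𝒜 𝒲] (hF : Realizes F δ N X) {a : A} (ha : a ∈ 𝒜 δ)
    (hN0 : ∀ p, N [] p = a • p) (hN : ∀ h l, Homog ℒ (h :: l) → N (h :: l) = 0)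
    (hX : ∀ l, Homog ℒ l → X l = 0) : F = insertA 𝒜 ℒ 𝒲 a := by
  refine eq_of_ev hF.mem (fun d x hx => insertA_mem ha hx) fun d x l hx hl => ?_
  rw [hF.ev_eq d x l hx hl, splitSum_congr (G := fun l₁ l₂ => ev x ((δ + dg l₁, X l₁) :: l₂))
      (G' := fun _ _ => 0) hl (fun l₁ l₂ h1 h2 _ _ => by rw [hX l₁ h1, ev_zero_cons hx _ h2]),
    splitSum_zero, smul_zero, sub_zero,
    splitSum_eq_of_ne_nil hl (fun h l₁ l₂ h1 h2 => by
      rw [hN h l₁ h1, LinearMap.zero_apply, smul_zero]),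
    hN0, ev_insertA ha hx, dg_nil, mul_zero, Int.negOnePow_zero, one_smul]

theorem Realizes.eq_zero [Decomposition ℒ] (hF : Realizes F δ N X)
    (hN : ∀ l, Homog ℒ l → N l = 0) (hX : ∀ l, Homog ℒ l → X l = 0) : F = 0 := by
  rw [hF.eq_insertL hN fun h l => hX _, hX [] (by simp), map_zero, neg_zero]

/-- In a splitting of `ξ, ξ_1, …` the entry `ξ` lies either in the second block, where it remains an
argument of the form, or in the first, where it is absorbed by `N` or `X`. Terms of the first kind
also make up `F ∘ i_ξ` and cancel; those of the second kind survive, with a minus sign because they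
come from `i_ξ ∘ F`. -/
theorem Realizes.comm_insertL [Decomposition ℒ] (hF : Realizes F δ N X) {e : ℤ} {ξ : L}
    (hξ : ξ ∈ ℒ e) : Realizes (gradedComm δ e F (insertL 𝒜 ℒ 𝒲 ξ)) (δ + e)
      (fun l => - N ((e, ξ) :: l)) (fun l => - X ((e, ξ) :: l)) where
  X_mem l hl := by
    have := hF.X_mem ((e, ξ) :: l) ((homog_cons ℒ _ _).2 ⟨hξ, hl⟩)
    rw [dg_cons, ← add_assoc] at this
    exact neg_mem this
  mem d x hx := by
    have h1 := hF.mem _ _ (insertL_mem hξ hx)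
    have h2 := insertL_mem hξ (hF.mem _ _ hx)
    rw [← add_assoc] at h1
    rw [← add_assoc, add_comm e δ] at h2
    rw [gradedComm, LinearMap.sub_apply, Units.smul_def]
    exact sub_mem h1 (zsmul_mem h2 _)
  ev_eq d x l hx hl := by
    have hcons : Homog ℒ ((e, ξ) :: l) := (homog_cons ℒ _ _).2 ⟨hξ, hl⟩
    have e0 : ev (gradedComm δ e F (insertL 𝒜 ℒ 𝒲 ξ) x) l = ev (F (insertL 𝒜 ℒ 𝒲 ξ x)) l -
        (δ * e).negOnePow • ev (insertL 𝒜 ℒ 𝒲 ξ (F x)) l := by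
      rw [gradedComm, LinearMap.sub_apply, map_sub, Units.smul_def, LinearMap.smul_apply, map_zsmul]
      rfl
    rw [e0, hF.ev_eq _ _ l (insertL_mem hξ hx) hl, ev_insertL hξ (hF.mem d x hx),
      hF.ev_eq d x _ hx hcons, splitSum_cons, splitSum_cons]
    simp only [ev_insertL hξ hx, dg_cons]
    -- `c1` and `c2` bring the terms with `ξ` in the second block to a common form in both products,
    -- for `c2` by exchanging `ξ` with the value of `X`. `c3` and `c4` put the surviving terms into
    -- the form of the new data.
    have c1 := splitSum_congr (ℳ := ℒ) hl
      (G := fun l₁ l₂ => ((e + d) * dg l₁).negOnePow •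
        N l₁ ((e * d).negOnePow • ev x ((e, ξ) :: l₂)))
      (G' := fun l₁ l₂ => (e * d).negOnePow • (e * dg l₁).negOnePow • (d * dg l₁).negOnePow •
        N l₁ (ev x ((e, ξ) :: l₂))) (fun l₁ l₂ _ _ _ _ => by
          rw [Units.smul_def (e * d).negOnePow, map_zsmul, ← Units.smul_def]
          simp only [smul_smul, ← Int.negOnePow_add]
          refine negOnePow_smul_congr ?_
          grind)
    have c2 := splitSum_congr (ℳ := ℒ) hl
      (G := fun l₁ l₂ => (e * d).negOnePow • ev x ((e, ξ) :: (δ + dg l₁, X l₁) :: l₂))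
      (G' := fun l₁ l₂ => (e * d + e * δ).negOnePow • (e * dg l₁).negOnePow •
        ev x ((δ + dg l₁, X l₁) :: (e, ξ) :: l₂)) (fun l₁ l₂ h1 h2 _ _ => by
          have := ev_swapSymm hx _ [] (e, ξ) (δ + dg l₁, X l₁) l₂ rfl (by simp) hξ (hF.X_mem _ h1) h2
          simp only [List.nil_append] at this
          rw [this]
          simp only [smul_smul, ← Int.negOnePow_add]
          refine negOnePow_smul_congr ?_
          grind)
    have c3 := splitSum_congr (ℳ := ℒ) hl
      (G := fun l₁ l₂ => (d * (e + dg l₁)).negOnePow • N ((e, ξ) :: l₁) (ev x l₂))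
      (G' := fun l₁ l₂ => - ((d * e).negOnePow • (d * dg l₁).negOnePow •
        (- N ((e, ξ) :: l₁)) (ev x l₂))) (fun l₁ l₂ _ _ _ _ => by
          rw [LinearMap.neg_apply, smul_neg, smul_neg, neg_neg, smul_smul, ← Int.negOnePow_add,
            mul_add])
    have c4 := splitSum_congr (ℳ := ℒ) hl
      (G := fun l₁ l₂ => ev x ((δ + (e + dg l₁), X ((e, ξ) :: l₁)) :: l₂))
      (G' := fun l₁ l₂ => - ev x ((δ + e + dg l₁, - X ((e, ξ) :: l₁)) :: l₂))
      (fun l₁ l₂ h1 h2 _ _ => by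
        have := hF.X_mem ((e, ξ) :: l₁) ((homog_cons ℒ _ _).2 ⟨hξ, h1⟩)
        rw [dg_cons, ← add_assoc] at this
        rw [ev_neg_cons hx this h2, neg_neg, ← add_assoc])
    rw [c1, c2, c3, c4]
    simp only [splitSum_smul, splitSum_neg]
    simp only [smul_add, smul_sub, smul_neg, smul_smul, ← Int.negOnePow_add]
    rw [negOnePow_congr (m := (e + d) * δ + (e * d + e * δ)) (n := e * d + d * δ) (by grind),
      negOnePow_congr (m := δ * e + (e * (δ + d) + d * e)) (n := 0) (by grind),
      negOnePow_congr (m := δ * e + e * (δ + d)) (n := e * d) (by grind),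
      negOnePow_congr (m := δ * e + (e * (δ + d) + d * δ)) (n := e * d + d * δ) (by grind),
      negOnePow_congr (m := d * (δ + e)) (n := e * d + d * δ) (by grind)]
    simp only [Int.negOnePow_zero, one_smul]
    abel

/-- The bracket terms only evaluate the form, so they commute with multiplication by `a` up to sign
and drop out. What is left is the failure of `N` to be `A`-linear. -/
theorem Realizes.comm_insertA [Decomposition 𝒜] [GradedCommutative 𝒜] [SetLike.GradedSMul 𝒜 𝒲]
    (hF : Realizes F δ N X) {e : ℤ} {a : A} (ha : a ∈ 𝒜 e)
    (hN : ∀ l, Homog ℒ l → ∀ p, N' l p =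
      (e * dg l).negOnePow • (N l (a • p) - ((δ + dg l) * e).negOnePow • a • N l p)) :
    Realizes (gradedComm δ e F (insertA 𝒜 ℒ 𝒲 a)) (δ + e) N' (fun _ => 0) where
  X_mem l hl := zero_mem _
  mem d x hx := by
    have h1 := hF.mem _ _ (insertA_mem ha hx)
    have h2 := insertA_mem ha (hF.mem _ _ hx)
    rw [← add_assoc] at h1
    rw [← add_assoc, add_comm e δ] at h2
    rw [gradedComm, LinearMap.sub_apply, Units.smul_def]
    exact sub_mem h1 (zsmul_mem h2 _)
  ev_eq d x l hx hl := by
    have e0 : ev (gradedComm δ e F (insertA 𝒜 ℒ 𝒲 a) x) l = ev (F (insertA 𝒜 ℒ 𝒲 a x)) l -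
        (δ * e).negOnePow • ev (insertA 𝒜 ℒ 𝒲 a (F x)) l := by
      rw [gradedComm, LinearMap.sub_apply, map_sub, Units.smul_def, LinearMap.smul_apply, map_zsmul]
      rfl
    rw [e0, hF.ev_eq _ _ l (insertA_mem ha hx) hl, ev_insertA ha (hF.mem d x hx), hF.ev_eq d x l hx hl]
    simp only [ev_insertA ha hx]
    have c1 := splitSum_congr (ℳ := ℒ) hl
      (G := fun l₁ l₂ => (d * dg l₁).negOnePow • N' l₁ (ev x l₂))
      (G' := fun l₁ l₂ => ((e + d) * dg l₁).negOnePow • N l₁ (a • ev x l₂) -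
        (δ * e).negOnePow • a • (d * dg l₁).negOnePow • N l₁ (ev x l₂)) (fun l₁ l₂ h1 _ _ _ => by
          rw [hN l₁ h1, smul_comm a]
          simp only [smul_sub, smul_smul, ← Int.negOnePow_add]
          refine congrArg₂ _ (negOnePow_smul_congr ?_) (negOnePow_smul_congr ?_) <;> grind)
    have c2 := splitSum_congr (ℳ := ℒ) hl
      (G := fun l₁ l₂ => ev x ((δ + e + dg l₁, (0 : L)) :: l₂))
      (G' := fun _ _ => 0) (fun l₁ l₂ _ h2 _ _ => ev_zero_cons hx _ h2)
    rw [c1, c2, splitSum_zero, smul_zero, sub_zero, splitSum_sub]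
    simp only [splitSum_smul]
    simp only [smul_sub, smul_comm a, smul_smul, ← Int.negOnePow_add]
    rw [negOnePow_congr (m := (e + d) * δ) (n := δ * e + d * δ) (by grind)]
    abel

end Realization

/-! ### The Chevalley-Eilenberg operator of a connection -/

section GradedMultilinear

variable {K A L M : Type*} [Field K] [Ring A] [Algebra K A] [AddCommGroup L] [Module K L]
  [Module A L] [AddCommGroup M] [Module K M] [Module A M] [IsScalarTower K A M]
  {𝒜 : ℤ → Submodule K A} {ℒ : ℤ → Submodule K L}

theorem SwapSymm.smul_append_cons [SetLike.GradedSMul 𝒜 ℒ] {k : ℕ} {f : List (ℤ × L) → M}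
    (hf : SwapSymm ℒ k f) {d e e' : ℤ} {a : A} {ξ : L} (ha : a ∈ 𝒜 e) (hξ : ξ ∈ ℒ e')
    (h : ∀ l, Homog ℒ l → f ((e + e', a • ξ) :: l) = (e * d).negOnePow • (a • f ((e', ξ) :: l)))
    (l r : List (ℤ × L)) (hl : Homog ℒ l) (hr : Homog ℒ r) (hk : l.length + r.length + 1 = k) :
    f (l ++ (e + e', a • ξ) :: r) =
      (e * (d + dg l)).negOnePow • (a • f (l ++ (e', ξ) :: r)) := by
  have hs : a • ξ ∈ ℒ (e + e') := SetLike.GradedSMul.smul_mem ha hξ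
  rw [hf.move_front (h := ((e + e' : ℤ), a • ξ)) hs l r hk hl hr,
    hf.move_front (h := (e', ξ)) hξ l r hk hl hr, h _ (by simp [hl, hr])]
  simp only [smul_comm a, smul_smul, ← Int.negOnePow_add]
  refine negOnePow_smul_congr ?_
  grind

theorem update_succ {α : Type*} {k : ℕ} (g : Fin (k + 1) → α) (i : Fin k) (y : α) (j : Fin k) :
    Function.update g i.succ y j.succ = Function.update (fun j => g j.succ) i y j := by
  simp [Function.update_apply]

theorem smul_update_of_append_cons {k : ℕ} {f : List (ℤ × L) → M} {d e : ℤ} {a : A}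
    (h : ∀ l r e' ξ, ξ ∈ ℒ e' → Homog ℒ l → Homog ℒ r → l.length + r.length + 1 = k →
      f (l ++ (e + e', a • ξ) :: r) =
        (e * (d + dg l)).negOnePow • (a • f (l ++ (e', ξ) :: r)))
    (n : Fin k → ℤ) (ξ : Fin k → L) (hξ : ∀ i, ξ i ∈ ℒ (n i)) (i : Fin k) :
    f (List.ofFn fun j => (Function.update n i (e + n i) j, Function.update ξ i (a • ξ i) j)) =
      (e * (d + ∑ j ∈ Finset.univ.filter (· < i), n j)).negOnePow •
        (a • f (List.ofFn fun j => (n j, ξ j))) := by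
  induction k generalizing f d with
  | zero => exact i.elim0
  | succ k ih =>
    rw [List.ofFn_succ, List.ofFn_succ]
    refine Fin.cases ?_ (fun i => ?_) i
    · have := h [] (List.ofFn fun j : Fin k => (n j.succ, ξ j.succ)) (n 0) (ξ 0) (hξ 0) (by simp)
        ((homog_ofFn ℒ).2 fun j => hξ j.succ) (by simp)
      simpa using this
    · have := ih (f := fun l => f ((n 0, ξ 0) :: l)) (d := d + n 0)
        (fun l r e' ζ hζ hl hr hk => by
          have := h ((n 0, ξ 0) :: l) r e' ζ hζ (by simp [hl, hξ 0]) hr (by simp; omega)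
          simpa [add_assoc] using this)
        (fun j => n j.succ) (fun j => ξ j.succ) (fun j => hξ j.succ) i
      have h0 : (0 : Fin (k + 1)) ≠ i.succ := (Fin.succ_ne_zero i).symm
      simp only [Function.update_of_ne h0, update_succ]
      rw [this]
      congr 2
      rw [Finset.sum_filter, Finset.sum_filter, Fin.sum_univ_succ]
      simp [add_assoc]

/-- By symmetry, `A`-linearity has to be verified in the first entry only. -/
theorem isGradedMultilinear_of_list [SetLike.GradedSMul 𝒜 ℒ] {k : ℕ} {f : List (ℤ × L) → M}
    (hf : SwapSymm ℒ k f) {d : ℤ}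
    (h : ∀ e a e' ξ l, a ∈ 𝒜 e → ξ ∈ ℒ e' → Homog ℒ l →
      f ((e + e', a • ξ) :: l) = (e * d).negOnePow • (a • f ((e', ξ) :: l)))
    {Ω : MultilinearMap K (fun _ : Fin k => L) M}
    (hΩ : ∀ (n : Fin k → ℤ) (ξ : Fin k → L), (∀ i, ξ i ∈ ℒ (n i)) →
      Ω ξ = f (List.ofFn fun i => (n i, ξ i))) : IsGradedMultilinear 𝒜 ℒ d Ω := by
  intro n ξ hξ e a ha i
  have hu : ∀ j, Function.update ξ i (a • ξ i) j ∈ ℒ (Function.update n i (e + n i) j) := by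
    intro j
    by_cases hj : j = i
    · subst hj
      simpa using SetLike.GradedSMul.smul_mem ha (hξ j)
    · simpa [Function.update_of_ne hj] using hξ j
  rw [hΩ _ _ hu, hΩ n ξ hξ]
  exact smul_update_of_append_cons (fun l r e' ζ hζ hl hr hk =>
    hf.smul_append_cons ha hζ (fun l hl => h e a e' ζ l ha hζ hl) l r hl hr hk) n ξ hξ i

end GradedMultilinear

/-! ### The Chevalley-Eilenberg formula yields symmetric forms. -/

section CEOperator

variable {K A L P : Type*} [Field K] [Ring A] [Algebra K A] [AddCommGroup L] [Module K L]
  [Module A L] [AddCommGroup P] [Module K P] [Module A P] [IsScalarTower K A P]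
  {𝒜 : ℤ → Submodule K A} {ℒ : ℤ → Submodule K L} {𝒲 : ℤ → Submodule K P}
  {𝕏 : LRInfinity 𝒜 ℒ}

/-- The summand of the Chevalley-Eilenberg formula for an `ℓ`-form `Ω` of degree `d`. -/
def ceTerm (nabla : LeftConnection 𝕏 𝒲) (m : ℕ) {ℓ : ℕ} (d : ℤ)
    (Ω : MultilinearMap K (fun _ : Fin ℓ => L) P) (l₁ l₂ : List (ℤ × L)) : P :=
  (d * dg l₁).negOnePow • lf (nabla.conn m) l₁ (lf Ω l₂) -
    (d * 1).negOnePow • lf Ω ((1 + dg l₁, lf (𝕏.X m) l₁) :: l₂)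

variable (nabla : LeftConnection 𝕏 𝒲) (m : ℕ) {ℓ : ℕ} {d : ℤ}
  {Ω Ω' : MultilinearMap K (fun _ : Fin ℓ => L) P}

/-- `lf` ignores the degree labels, so one linear map serves every `e`. This matters because the
label `1 + dg l₁` of the inserted bracket varies with `l₁`. -/
theorem exists_linearMap_lf_cons {M N : Type*} [AddCommGroup M] [Module K M] [AddCommGroup N]
    [Module K N] {k : ℕ} (Ω : MultilinearMap K (fun _ : Fin k => M) N) (l : List (ℤ × M)) :
    ∃ φ : M →ₗ[K] N, ∀ e x, lf Ω ((e, x) :: l) = φ x := by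
  cases k with
  | zero => exact ⟨0, fun e x => lf_zero_cons Ω _ l⟩
  | succ k =>
    refine ⟨⟨⟨fun x => lf Ω ((0, x) :: l), fun x y => ?_⟩, fun c x => ?_⟩, fun e x => rfl⟩
    · exact lf_append_add Ω [] l 0 x y
    · exact lf_append_smul Ω [] l 0 c x

theorem ceTerm_add (l₁ l₂ : List (ℤ × L)) : ceTerm nabla m d (Ω + Ω') l₁ l₂ =
    ceTerm nabla m d Ω l₁ l₂ + ceTerm nabla m d Ω' l₁ l₂ := by
  simp only [ceTerm, lf_add, map_add, smul_add]
  abel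

theorem ceTerm_smul (c : K) (l₁ l₂ : List (ℤ × L)) :
    ceTerm nabla m d (c • Ω) l₁ l₂ = c • ceTerm nabla m d Ω l₁ l₂ := by
  simp only [ceTerm, lf_smul, map_smul, smul_sub, smul_comm c]

theorem SlotLinear.subFun {M N : Type*} [AddCommGroup M] [Module K M] [AddCommGroup N]
    [Module K N] {ℳ : ℤ → Submodule K M} {k : ℕ} {f g : List (ℤ × M) → N}
    (hf : SlotLinear ℳ k f) (hg : SlotLinear ℳ k g) : SlotLinear ℳ k (fun l => f l - g l) := by
  simpa only [sub_eq_add_neg, LinearMap.neg_apply, LinearMap.id_apply] using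
    hf.addFun (hg.comp (-LinearMap.id))

theorem SlotLinear.smul_unit {M N : Type*} [AddCommGroup M] [Module K M] [AddCommGroup N]
    [Module K N] {ℳ : ℤ → Submodule K M} {k : ℕ} {f : List (ℤ × M) → N}
    (hf : SlotLinear ℳ k f) (c : ℤˣ) : SlotLinear ℳ k (fun l => c • f l) := by
  rcases Int.units_eq_one_or c with rfl | rfl
  · simpa using hf
  · simpa using hf.comp (-LinearMap.id)

theorem SwapSymm.subFun {M N : Type*} [AddCommGroup M] [Module K M] [AddCommGroup N]
    [Module K N] {ℳ : ℤ → Submodule K M} {k : ℕ} {f g : List (ℤ × M) → N}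
    (hf : SwapSymm ℳ k f) (hg : SwapSymm ℳ k g) : SwapSymm ℳ k (fun l => f l - g l) := by
  simpa only [sub_eq_add_neg, LinearMap.neg_apply, LinearMap.id_apply] using
    hf.addFun (hg.comp (-LinearMap.id))

theorem ceTerm_slotLinear (k : ℕ) : SlotLinear ℒ k (splitSum (ceTerm nabla m d Ω)) := by
  refine splitSum_slotLinear (fun j l₂ _ => ?_) fun j l₁ hl₁ => ?_
  · refine SlotLinear.subFun ?_ (SlotLinear.smul_unit ?_ _)
    · exact ((lf_slotLinear (nabla.conn m)).comp (LinearMap.applyₗ (lf Ω l₂))).dg_smul d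
    · obtain ⟨φ, hφ⟩ := exists_linearMap_lf_cons Ω l₂
      simp only [hφ]
      exact (lf_slotLinear (𝕏.X m)).comp φ
  · refine SlotLinear.subFun (SlotLinear.smul_unit ?_ _) (SlotLinear.smul_unit ?_ _)
    · exact (lf_slotLinear Ω).comp (lf (nabla.conn m) l₁)
    · exact (lf_slotLinear (j := j + 1) Ω).cons (h := (1 + dg l₁, lf (𝕏.X m) l₁))
        (lf_mem (𝕏.X_degree m) hl₁)

theorem ceTerm_swapSymm (hΩ : IsGradedSymm ℒ Ω) (k : ℕ) :
    SwapSymm ℒ k (splitSum (ceTerm nabla m d Ω)) := by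
  refine splitSum_swapSymm (fun j l₂ _ => ?_) fun j l₁ hl₁ => ?_
  · refine SwapSymm.subFun ?_ (SwapSymm.smul_unit ?_ _)
    · exact ((lf_swapSymm (nabla.symm m)).comp (LinearMap.applyₗ (lf Ω l₂))).dg_smul d
    · obtain ⟨φ, hφ⟩ := exists_linearMap_lf_cons Ω l₂
      simp only [hφ]
      exact (lf_swapSymm (𝕏.X_symm m)).comp φ
  · refine SwapSymm.subFun (SwapSymm.smul_unit ?_ _) (SwapSymm.smul_unit ?_ _)
    · exact (lf_swapSymm hΩ).comp (lf (nabla.conn m) l₁)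
    · exact (lf_swapSymm (j := j + 1) hΩ).cons (h := (1 + dg l₁, lf (𝕏.X m) l₁))
        (lf_mem (𝕏.X_degree m) hl₁)

theorem ceTerm_mem (hΩ : HasDegree ℒ 𝒲 d Ω) {l : List (ℤ × L)} (hl : Homog ℒ l) :
    splitSum (ceTerm nabla m d Ω) l ∈ 𝒲 (1 + d + dg l) := by
  refine splitSum_mem hl _ fun l₁ l₂ h1 h2 hd _ => ?_
  have e1 : 1 + dg l₁ + (d + dg l₂) = 1 + d + dg l := by rw [← hd]; ring
  have e2 : d + (1 + dg l₁ + dg l₂) = 1 + d + dg l := by rw [← hd]; ring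
  have m1 := lf_op_mem (nabla.degree m) h1 (lf_mem hΩ h2)
  have m2 := lf_mem hΩ (l := (1 + dg l₁, lf (𝕏.X m) l₁) :: l₂)
    ((homog_cons ℒ _ _).2 ⟨lf_mem (𝕏.X_degree m) h1, h2⟩)
  rw [e1] at m1
  rw [dg_cons, e2] at m2
  rw [ceTerm, Units.smul_def, Units.smul_def]
  exact sub_mem (zsmul_mem m1 _) (zsmul_mem m2 _)

theorem ceTerm_eq_zero {l₁ l₂ : List (ℤ × L)} (h : l₁.length + l₂.length ≠ m + ℓ) :
    ceTerm nabla m d Ω l₁ l₂ = 0 := by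
  have h1 : lf (nabla.conn m) l₁ (lf Ω l₂) = 0 := by
    by_cases h1 : l₁.length = m
    · rw [lf_of_length_ne Ω (by omega), map_zero]
    · rw [lf_of_length_ne _ h1, LinearMap.zero_apply]
  have h2 : lf Ω ((1 + dg l₁, lf (𝕏.X m) l₁) :: l₂) = 0 := by
    by_cases h1 : l₁.length = m + 1
    · rw [lf_of_length_ne Ω (by simp; omega)]
    · obtain ⟨φ, hφ⟩ := exists_linearMap_lf_cons Ω l₂
      rw [lf_of_length_ne _ h1, hφ, map_zero]
  rw [ceTerm, h1, h2, smul_zero, smul_zero, sub_zero]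

variable [GradedAlgebra 𝒜] [GradedCommutative 𝒜] [Decomposition ℒ] [SetLike.GradedSMul 𝒜 ℒ]
  [SetLike.GradedSMul 𝒜 𝒲]

theorem LeftConnection.lf_leibniz {l : List (ℤ × L)} (hl : Homog ℒ l) {e : ℤ} {a : A}
    (ha : a ∈ 𝒜 e) (p : P) : lf (nabla.conn m) l (a • p) =
      ((1 + dg l) * e).negOnePow • (a • lf (nabla.conn m) l p) + lf (𝕏.σ m) l a • p := by
  by_cases hk : l.length = m
  · obtain ⟨n, ξ, rfl⟩ := exists_eq_ofFn hk
    rw [lf_ofFn, lf_ofFn, dg_ofFn]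
    exact nabla.leibniz m n ξ ((homog_ofFn ℒ).1 hl) e a p ha
  · rw [lf_of_length_ne _ hk, lf_of_length_ne _ hk]
    simp

/-- Two terms obstruct `A`-linearity, both proportional to `σ(l₁ | a) Ω(ξ, l₂)`: one from the
Leibniz rule of the connection, when `a ξ` is an argument of `Ω`, and one from the Leibniz rule of
the bracket, when `a ξ` is an argument of `X`. They cancel because the two anchors coincide. -/
theorem ceTerm_smul_cons (hΩ : Ω ∈ symForm 𝒜 ℒ 𝒲 ℓ d) {e e' : ℤ} {a : A} {ξ : L} (ha : a ∈ 𝒜 e)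
    (hξ : ξ ∈ ℒ e') {l : List (ℤ × L)} (hl : Homog ℒ l) :
    splitSum (ceTerm nabla m d Ω) ((e + e', a • ξ) :: l) =
      (e * (1 + d)).negOnePow • (a • splitSum (ceTerm nabla m d Ω) ((e', ξ) :: l)) := by
  have hs : a • ξ ∈ ℒ (e + e') := SetLike.GradedSMul.smul_mem ha hξ
  -- The terms with `ξ` in either block are collected under one sum over the splittings of the tail,
  -- since the cancellation takes place within each of these.
  rw [splitSum_cons, splitSum_cons, ← splitSum_add, ← splitSum_add, ← splitSum_smul, ← splitSum_smul]
  refine splitSum_congr (ℳ := ℒ) hl fun l₁ l₂ h1 h2 _ _ => ?_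
  have hX : lf (𝕏.X m) l₁ ∈ ℒ (1 + dg l₁) := lf_mem (𝕏.X_degree m) h1
  have hXξ : lf (𝕏.X m) ((e', ξ) :: l₁) ∈ ℒ (1 + (e' + dg l₁)) :=
    lf_mem (𝕏.X_degree m) (l := (e', ξ) :: l₁) ((homog_cons ℒ _ _).2 ⟨hξ, h1⟩)
  have hσ : lf (𝕏.σ m) l₁ a ∈ 𝒜 (1 + dg l₁ + e) := lf_op_mem (𝕏.σ_degree m) h1 ha
  have w := fun {e e' : ℤ} {a : A} {ξ : L} (ha : a ∈ 𝒜 e) (hξ : ξ ∈ ℒ e') {l : List (ℤ × L)}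
    (hl : Homog ℒ l) => lf_smul_cons hΩ.2.2 ha hξ hl
  obtain ⟨φ, hφ⟩ := exists_linearMap_lf_cons Ω l₂
  have t1 : lf Ω ((1 + (e + e' + dg l₁), lf (𝕏.X m) ((e + e', a • ξ) :: l₁)) :: l₂) =
      (e + e * d).negOnePow • (a • lf Ω ((1 + (e' + dg l₁), lf (𝕏.X m) ((e', ξ) :: l₁)) :: l₂)) +
        (dg l₁ * e' + e * dg l₁ + (1 + dg l₁ + e) * d).negOnePow •
          (lf (𝕏.σ m) l₁ a • lf Ω ((e', ξ) :: l₂)) := by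
    have w1 := w ha hXξ h2
    have w2 := w hσ hξ h2
    rw [hφ, hφ] at w1 w2
    rw [hφ, hφ, hφ, 𝕏.X_smul_cons m ha hξ h1, map_add, Units.smul_def, Units.smul_def, map_zsmul,
      map_zsmul, ← Units.smul_def, ← Units.smul_def, w1, w2]
    simp only [smul_smul, ← Int.negOnePow_add]
  have t2 : lf Ω ((1 + dg l₁, lf (𝕏.X m) l₁) :: (e + e', a • ξ) :: l₂) =
      ((1 + dg l₁) * e + e * d).negOnePow •
        (a • lf Ω ((1 + dg l₁, lf (𝕏.X m) l₁) :: (e', ξ) :: l₂)) := by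
    have s := fun e ζ (hζ : ζ ∈ ℒ e) => lf_swapSymm (ℳ := ℒ) (j := l₂.length + 2) hΩ.2.1 []
      (1 + dg l₁, lf (𝕏.X m) l₁) (e, ζ) l₂ (by simp) (by simp) hX hζ h2
    simp only [List.nil_append] at s
    rw [s _ _ hs, s _ _ hξ, w ha hξ ((homog_cons ℒ _ _).2 ⟨hX, h2⟩)]
    simp only [smul_comm a, smul_smul, ← Int.negOnePow_add]
    refine negOnePow_smul_congr ?_
    grind
  have t3 : lf (nabla.conn m) ((e + e', a • ξ) :: l₁) (lf Ω l₂) =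
      e.negOnePow • (a • lf (nabla.conn m) ((e', ξ) :: l₁) (lf Ω l₂)) := by
    rw [lf_smul_cons (nabla.linear m) ha hξ h1, Units.smul_def, LinearMap.smul_apply, mul_one]
    rfl
  have t4 : lf (nabla.conn m) l₁ (lf Ω ((e + e', a • ξ) :: l₂)) =
      (e * d + (1 + dg l₁) * e).negOnePow • (a • lf (nabla.conn m) l₁ (lf Ω ((e', ξ) :: l₂))) +
        (e * d).negOnePow • (lf (𝕏.σ m) l₁ a • lf Ω ((e', ξ) :: l₂)) := by
    rw [w ha hξ h2, Units.smul_def, map_zsmul, ← Units.smul_def, nabla.lf_leibniz m h1 ha, smul_add,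
      smul_smul, ← Int.negOnePow_add]
  simp only [ceTerm, t1, t2, t3, t4, dg_cons]
  simp only [smul_add, smul_sub, smul_comm a, smul_smul, ← Int.negOnePow_add]
  -- `p₁` is the anchor term. It occurs twice on the left, and the normalised signs below show that
  -- the two occurrences cancel.
  generalize lf (𝕏.σ m) l₁ a • lf Ω ((e', ξ) :: l₂) = p₁
  generalize a • lf (nabla.conn m) ((e', ξ) :: l₁) (lf Ω l₂) = p₂
  generalize a • lf (nabla.conn m) l₁ (lf Ω ((e', ξ) :: l₂)) = p₃
  generalize a • lf Ω ((1 + dg l₁, lf (𝕏.X m) l₁) :: (e', ξ) :: l₂) = p₄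
  generalize a • lf Ω ((1 + (e' + dg l₁), lf (𝕏.X m) ((e', ξ) :: l₁)) :: l₂) = p₅
  rw [negOnePow_congr (m := d * (e + e' + dg l₁) + e) (n := e * (1 + d) + d * (e' + dg l₁))
      (by grind),
    negOnePow_congr (m := d * 1 + (e + e * d)) (n := e * (1 + d) + d * 1) (by grind),
    negOnePow_congr (m := d * 1 + (dg l₁ * e' + e * dg l₁ + (1 + dg l₁ + e) * d))
      (n := (e + e') * dg l₁ + (d * dg l₁ + e * d)) (by grind),
    negOnePow_congr (m := (e + e') * dg l₁ + (d * dg l₁ + (e * d + (1 + dg l₁) * e)))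
      (n := e * (1 + d) + (e' * dg l₁ + d * dg l₁)) (by grind),
    negOnePow_congr (m := (e + e') * dg l₁ + (d * 1 + ((1 + dg l₁) * e + e * d)))
      (n := e * (1 + d) + (e' * dg l₁ + d * 1)) (by grind)]
  abel

end CEOperator

/-! ### Existence and uniqueness of the Chevalley-Eilenberg operator. -/

section CEOperator

variable {K A L P : Type*} [Field K] [Ring A] [Algebra K A] [AddCommGroup L] [Module K L]
  [Module A L] [AddCommGroup P] [Module K P] [Module A P] [IsScalarTower K A P]
  {𝒜 : ℤ → Submodule K A} {ℒ : ℤ → Submodule K L} {𝒲 : ℤ → Submodule K P}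
  {𝕏 : LRInfinity 𝒜 ℒ} (nabla : LeftConnection 𝕏 𝒲) (m : ℕ)

/-- The two sums run over unshuffles of different shapes. Since `lf` vanishes on lists of the wrong
length, both become sums over all splittings of the same list and merge into one. -/
theorem ceFormula_eq_splitSum {ℓ : ℕ} {d : ℤ} (Ω : MultilinearMap K (fun _ : Fin ℓ => L) P)
    (n : Fin (m + ℓ) → ℤ) (ξ : Fin (m + ℓ) → L) : ceFormula nabla m ℓ d Ω n ξ =
      splitSum (ceTerm nabla m d Ω) (List.ofFn fun i => (n i, ξ i)) := by
  have h1 : unshuffleSum m ℓ n ξ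
      (fun n₁ ξ₁ ξ₂ => (d * ∑ i, n₁ i).negOnePow • nabla.conn m ξ₁ (Ω ξ₂)) =
      splitSum (fun l₁ l₂ => (d * dg l₁).negOnePow • lf (nabla.conn m) l₁ (lf Ω l₂))
        (List.ofFn fun i => (n i, ξ i)) := by
    refine unshuffleSum_eq_splitSum m ℓ n ξ _ _ (fun n₁ ξ₁ n₂ ξ₂ => ?_) fun l₁ l₂ _ hk => ?_
    · rw [lf_ofFn, lf_ofFn, dg_ofFn]
    · rw [lf_of_length_ne _ hk, LinearMap.zero_apply, smul_zero]
  have h2 : ceBracketSum 𝕏 m ℓ Ω n ξ =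
      splitSum (fun l₁ l₂ => lf Ω ((1 + dg l₁, lf (𝕏.X m) l₁) :: l₂))
        (List.ofFn fun i => (n i, ξ i)) := by
    cases ℓ with
    | zero =>
      simp only [lf_zero_cons, splitSum_zero]
      rfl
    | succ ℓ =>
      have h : m + 1 + ℓ = m + (ℓ + 1) := by omega
      have hc : (List.ofFn fun i => (n i, ξ i)) =
          List.ofFn fun i => ((n ∘ Fin.cast h) i, (ξ ∘ Fin.cast h) i) :=
        (List.ofFn_congr h fun i => (n (Fin.cast h i), ξ (Fin.cast h i))).symm
      rw [hc, ceBracketSum]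
      refine unshuffleSum_eq_splitSum (m + 1) ℓ _ _ _ _ (fun n₁ ξ₁ n₂ ξ₂ => ?_) fun l₁ l₂ _ hk => ?_
      · rw [lf_ofFn, cons_ofFn, lf_ofFn]
      · obtain ⟨φ, hφ⟩ := exists_linearMap_lf_cons Ω l₂
        rw [lf_of_length_ne _ hk, hφ, map_zero]
  rw [ceFormula, h1, h2, ← splitSum_smul, ← splitSum_sub]
  congr 1
  funext l₁ l₂
  rw [ceTerm, mul_one]

variable [GradedAlgebra 𝒜] [GradedCommutative 𝒜] [Decomposition ℒ] [SetLike.GradedSMul 𝒜 ℒ]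
  [SetLike.GradedSMul 𝒜 𝒲]

theorem exists_ceForm {ℓ : ℕ} {d : ℤ} (Ω : symForm 𝒜 ℒ 𝒲 ℓ d) :
    ∃ Ω' : symForm 𝒜 ℒ 𝒲 (m + ℓ) (1 + d), ∀ (n : Fin (m + ℓ) → ℤ) (ξ : Fin (m + ℓ) → L),
      (∀ i, ξ i ∈ ℒ (n i)) →
        Ω'.1 ξ = splitSum (ceTerm nabla m d Ω.1) (List.ofFn fun i => (n i, ξ i)) := by
  obtain ⟨Ω', h⟩ := exists_multilinearMap_of_slotLinear (ceTerm_slotLinear nabla m (d := d)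
    (Ω := Ω.1) (m + ℓ))
  have hs := ceTerm_swapSymm nabla m (d := d) Ω.2.2.1 (m + ℓ)
  refine ⟨⟨Ω', fun n ξ hξ => ?_, isGradedSymm_of_swapSymm hs h,
    isGradedMultilinear_of_list hs (fun e a e' ξ l ha hξ hl =>
      ceTerm_smul_cons nabla m Ω.2 ha hξ hl) h⟩, h⟩
  rw [h n ξ hξ]
  simpa only [dg_ofFn] using ceTerm_mem nabla m Ω.2.1 ((homog_ofFn ℒ).2 hξ)

theorem exists_isCEOperator : ∃ D : Module.End K (Sym 𝒜 ℒ 𝒲), IsCEOperator nabla m D := by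
  choose f hf using fun (p : ℕ × ℤ) (Ω : symForm 𝒜 ℒ 𝒲 p.1 p.2) => exists_ceForm nabla m Ω
  let g : ∀ p : ℕ × ℤ, symForm 𝒜 ℒ 𝒲 p.1 p.2 →ₗ[K] symForm 𝒜 ℒ 𝒲 (m + p.1) (1 + p.2) := fun p =>
    { toFun := f p
      map_add' := fun Ω Ω' => Subtype.ext <| multilinear_ext ℒ fun n ξ hξ => by
        rw [hf p _ n ξ hξ]
        refine Eq.trans ?_ (congrArg₂ (· + ·) (hf p Ω n ξ hξ) (hf p Ω' n ξ hξ)).symm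
        rw [← splitSum_add]
        congr 1
        funext l₁ l₂
        exact ceTerm_add nabla m l₁ l₂
      map_smul' := fun c Ω => Subtype.ext <| multilinear_ext ℒ fun n ξ hξ => by
        rw [hf p _ n ξ hξ]
        refine Eq.trans ?_ (congrArg (c • ·) (hf p Ω n ξ hξ)).symm
        simp only [← splitSum_smul]
        congr 1
        funext l₁ l₂
        exact ceTerm_smul nabla m c l₁ l₂ }
  refine ⟨symLift fun p => formOf 𝒜 ℒ 𝒲 (m + p.1) (1 + p.2) ∘ₗ g p, fun ℓ d Ω =>
    ⟨f (ℓ, d) Ω, symLift_formOf _ ℓ d Ω, fun n ξ hξ => ?_⟩⟩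
  rw [ceFormula_eq_splitSum, hf (ℓ, d) Ω n ξ hξ]

variable {nabla m}

theorem IsCEOperator.unique {D D' : Module.End K (Sym 𝒜 ℒ 𝒲)} (hD : IsCEOperator nabla m D)
    (hD' : IsCEOperator nabla m D') : D' = D := by
  refine sym_ext fun ℓ d Ω => ?_
  obtain ⟨Ω₁, h₁, e₁⟩ := hD ℓ d Ω
  obtain ⟨Ω₂, h₂, e₂⟩ := hD' ℓ d Ω
  rw [h₁, h₂]
  exact formOf_congr _ _ _ rfl (multilinear_ext ℒ fun n ξ hξ => by rw [e₁ n ξ hξ, e₂ n ξ hξ])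

theorem IsCEOperator.realizes {D : Module.End K (Sym 𝒜 ℒ 𝒲)} (hD : IsCEOperator nabla m D) :
    Realizes D 1 (lf (nabla.conn m)) (lf (𝕏.X m)) where
  X_mem l hl := lf_mem (𝕏.X_degree m) hl
  mem d x hx := by
    refine symPart_induction (C := fun x => D x ∈ symPart 𝒜 ℒ 𝒲 (1 + d)) ?_ (by simp) ?_ hx
    · intro ℓ Ω
      obtain ⟨Ω', h, -⟩ := hD ℓ d Ω
      rw [h]
      exact formOf_mem _ _ _
    · intro x y hx hy
      rw [map_add]
      exact add_mem hx hy
  ev_eq d x l hx hl := by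
    rw [← splitSum_smul, ← splitSum_sub]
    refine symPart_induction (C := fun x => ev (D x) l = splitSum (fun l₁ l₂ =>
      (d * dg l₁).negOnePow • lf (nabla.conn m) l₁ (ev x l₂) -
        (d * 1).negOnePow • ev x ((1 + dg l₁, lf (𝕏.X m) l₁) :: l₂)) l) ?_ ?_ ?_ hx
    · intro ℓ Ω
      obtain ⟨Ω', h, e⟩ := hD ℓ d Ω
      rw [h, ev_formOf, ev_formOf]
      change _ = splitSum (ceTerm nabla m d Ω.1) l
      -- On lists of any other length both sides vanish. The formula has to hold in all lengths,
      -- since `x` may have components with different numbers of entries.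
      by_cases hk : l.length = m + ℓ
      · obtain ⟨n, ξ, rfl⟩ := exists_eq_ofFn hk
        rw [lf_ofFn, e n ξ ((homog_ofFn ℒ).1 hl), ceFormula_eq_splitSum]
      · rw [lf_of_length_ne _ hk, splitSum_congr (G' := fun _ _ => 0) hl fun l₁ l₂ _ _ _ h =>
          ceTerm_eq_zero nabla m (by omega), splitSum_zero]
    · simp [splitSum_zero]
    · intro x y hx hy
      rw [map_add, map_add, Pi.add_apply, hx, hy, ← splitSum_add]
      congr 1
      funext l₁ l₂
      simp only [map_add, Pi.add_apply, smul_add]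
      abel

end CEOperator

/-! ### The bracket on the symmetric algebra -/

section LastSlot

variable {K S R : Type*} [Field K] [Ring S] [Algebra K S] [Ring R] [Algebra K R]
  {ℳ : ℤ → Submodule K S} {k : ℕ} {δ : ℤ} {F : List (ℤ × S) → S}

theorem SwapSymm.append_singleton {M N : Type*} [AddCommGroup M] [Module K M] [AddCommGroup N]
    [Module K N] {ℳ : ℤ → Submodule K M} {f : List (ℤ × M) → N} (hf : SwapSymm ℳ k f) {h : ℤ × M}
    (hh : h.2 ∈ ℳ h.1) {l : List (ℤ × M)} (hk : l.length + 1 = k) (hl : Homog ℳ l) :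
    f (l ++ [h]) = (h.1 * dg l).negOnePow • f (h :: l) := by
  simpa using hf.move_front hh l [] (by simpa using hk) hl (by simp)

theorem SwapSymm.cons_eq {M N : Type*} [AddCommGroup M] [Module K M] [AddCommGroup N]
    [Module K N] {ℳ : ℤ → Submodule K M} {f : List (ℤ × M) → N} (hf : SwapSymm ℳ k f) {h : ℤ × M}
    (hh : h.2 ∈ ℳ h.1) {l : List (ℤ × M)} (hk : l.length + 1 = k) (hl : Homog ℳ l) :
    f (h :: l) = (h.1 * dg l).negOnePow • f (l ++ [h]) := by
  rw [hf.append_singleton hh hk hl, smul_smul, ← Int.negOnePow_add,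
    negOnePow_congr (n := 0) (by grind), Int.negOnePow_zero, one_smul]

variable [SetLike.GradedMonoid ℳ]

theorem IsMultiDer.leib_last (hF : IsMultiDer ℳ (AlgHom.id K S) k δ F) {d e : ℤ} {x y : S}
    {l : List (ℤ × S)} (hk : l.length + 1 = k) (hx : x ∈ ℳ d) (hy : y ∈ ℳ e) (hl : Homog ℳ l) :
    F (l ++ [(d + e, x * y)]) = ((δ + dg l) * d).negOnePow • (x * F (l ++ [(e, y)])) +
      F (l ++ [(d, x)]) * y := by
  rw [hF.symm.append_singleton (h := (d + e, x * y)) (SetLike.GradedMul.mul_mem hx hy) hk hl,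
    hF.symm.append_singleton (h := (e, y)) hy hk hl, hF.symm.append_singleton (h := (d, x)) hx hk hl,
    hF.leib d x e y l hk hx hy hl]
  simp only [smul_add, smul_smul, ← Int.negOnePow_add, mul_smul_comm, smul_mul_assoc,
    AlgHom.id_apply]
  refine congrArg₂ _ (negOnePow_smul_congr ?_) (negOnePow_smul_congr ?_) <;> grind

theorem isMultiDer_of_leib_last (lin : SlotLinear ℳ k F) (symm : SwapSymm ℳ k F)
    (h : ∀ d e x y l, l.length + 1 = k → x ∈ ℳ d → y ∈ ℳ e → Homog ℳ l →
      F (l ++ [(d + e, x * y)]) = ((δ + dg l) * d).negOnePow • (x * F (l ++ [(e, y)])) +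
        F (l ++ [(d, x)]) * y) : IsMultiDer ℳ (AlgHom.id K S) k δ F where
  lin := lin
  symm := symm
  leib d x e y l hk hx hy hl := by
    rw [symm.cons_eq (h := (d + e, x * y)) (SetLike.GradedMul.mul_mem hx hy) hk hl,
      symm.cons_eq (h := (e, y)) hy hk hl, symm.cons_eq (h := (d, x)) hx hk hl,
      h d e x y l hk hx hy hl]
    simp only [smul_add, smul_smul, ← Int.negOnePow_add, mul_smul_comm, smul_mul_assoc,
      AlgHom.id_apply]
    refine congrArg₂ _ (negOnePow_smul_congr ?_) (negOnePow_smul_congr ?_) <;> grind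

/-- In `IsTensorBracket.leibniz` the factor `w` is arbitrary, whereas functions of lists control
only homogeneous entries. -/
theorem leibniz_of_homogeneous [Decomposition ℳ] (φ : S →ₗ[K] S) {c : ℤˣ} {v : S}
    (h : ∀ j w, w ∈ ℳ j → φ (v * w) = c • (v * φ w) + φ v * w) (w : S) :
    φ (v * w) = c • (v * φ w) + φ v * w := by
  induction w using Decomposition.inductionOn ℳ with
  | zero => simp
  | add x y hx hy =>
    rw [mul_add, map_add, hx, hy, map_add, mul_add, mul_add, smul_add]
    abel
  | @homogeneous j w => exact h j w w.2

end LastSlot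

section TensorBracket

variable {K A L : Type*} [Field K] [Ring A] [Algebra K A] [AddCommGroup L] [Module K L]
  [Module A L] {𝒜 : ℤ → Submodule K A} {ℒ : ℤ → Submodule K L}

theorem liftL_ofFn {S : Type*} [Ring S] [Algebra K S] (iL : L →ₗ[K] S) {k : ℕ} (n : Fin k → ℤ)
    (ξ : Fin k → L) :
    liftL iL (List.ofFn fun i => (n i, ξ i)) = List.ofFn fun i => (n i, iL (ξ i)) := by
  simp [liftL, List.map_ofFn, Function.comp_def]

theorem exists_perm_zero_one {k : ℕ} {i j : Fin (k + 2)} (h : i ≠ j) :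
    ∃ σ : Perm (Fin (k + 2)), σ 0 = i ∧ σ 1 = j := by
  have hx : Equiv.swap 0 i j ≠ 0 := by
    rw [Ne, Equiv.swap_apply_eq_iff, Equiv.swap_apply_left]
    exact h.symm
  refine ⟨Equiv.swap 0 i * Equiv.swap 1 (Equiv.swap 0 i j), ?_, ?_⟩
  · rw [Equiv.Perm.mul_apply, Equiv.swap_apply_of_ne_of_ne (by simp) hx.symm,
      Equiv.swap_apply_left]
  · rw [Equiv.Perm.mul_apply, Equiv.swap_apply_left, Equiv.swap_apply_self]

variable [GradedAlgebra 𝒜] [GradedCommutative 𝒜] [Decomposition ℒ] [SetLike.GradedSMul 𝒜 ℒ]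
  {𝕏 : LRInfinity 𝒜 ℒ} {m : ℕ}

local notation "𝒮" => genDeg 𝒜 ℒ (ofA 𝒜 ℒ) (ofL 𝒜 ℒ)

/-- Needed for `IsTensorBracket.vanish`, whose entries from `A` need not be homogeneous: their
components again come from `A`. -/
theorem exists_decompose_ofA (a : A) (e : ℤ) :
    ∃ b ∈ 𝒜 e, (decompose (𝒮) (ofA 𝒜 ℒ a) e : SymAlg 𝒜 ℒ) = ofA 𝒜 ℒ b := by
  induction a using Decomposition.inductionOn 𝒜 with
  | zero => exact ⟨0, zero_mem _, by simp⟩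
  | @homogeneous i a =>
    have ha : ofA 𝒜 ℒ (a : A) ∈ (𝒮) i := ofA_mem_genDeg a.2
    by_cases h : i = e
    · subst h
      exact ⟨a, a.2, decompose_of_mem_same _ ha⟩
    · exact ⟨0, zero_mem _, by rw [decompose_of_mem_ne _ ha h, map_zero]⟩
  | add x y hx hy =>
    obtain ⟨b, hb, h⟩ := hx
    obtain ⟨b', hb', h'⟩ := hy
    exact ⟨b + b', add_mem hb hb', by rw [map_add, decompose_add, DirectSum.add_apply, Submodule.coe_add, h, h', map_add]⟩

namespace IsTensorBracket

variable {Λ : MultilinearMap K (fun _ : Fin (m + 1) => SymAlg 𝒜 ℒ) (SymAlg 𝒜 ℒ)}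

theorem isMultiDer (h : IsTensorBracket 𝕏 m Λ) :
    IsMultiDer (𝒮) (AlgHom.id K (SymAlg 𝒜 ℒ)) (m + 1) 1 (lf Λ) := by
  have hs : IsGradedSymm (𝒮) Λ := h.symm
  refine isMultiDer_of_leib_last (lf_slotLinear Λ) (lf_swapSymm hs) fun d e x y l hk hx hy hl => ?_
  obtain ⟨n, u, rfl⟩ := exists_eq_ofFn (k := m) (l := l) (by omega)
  simp only [ofFn_append_singleton, lf_ofFn, dg_ofFn]
  exact h.leibniz n u ((homog_ofFn (𝒮)).1 hl) d x y hx

theorem lf_liftL (h : IsTensorBracket 𝕏 m Λ) {g : List (ℤ × L)} (hk : g.length = m + 1) :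
    lf Λ (liftL (ofL 𝒜 ℒ) g) = ofL 𝒜 ℒ (lf (𝕏.X m) g) := by
  obtain ⟨n, ξ, rfl⟩ := exists_eq_ofFn hk
  rw [liftL_ofFn, lf_ofFn, lf_ofFn, h.bracket]

theorem lf_ofA_cons_liftL (h : IsTensorBracket 𝕏 m Λ) {e : ℤ} {a : A} (ha : a ∈ 𝒜 e)
    {g : List (ℤ × L)} (hg : Homog ℒ g) (hk : g.length = m) :
    lf Λ ((e, ofA 𝒜 ℒ a) :: liftL (ofL 𝒜 ℒ) g) =
      (e * dg g).negOnePow • ofA 𝒜 ℒ (lf (𝕏.σ m) g a) := by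
  have hgs : Homog (𝒮) (liftL (ofL 𝒜 ℒ) g) := hg.liftL
  have ha' : ofA 𝒜 ℒ a ∈ (𝒮) e := ofA_mem_genDeg ha
  rw [h.isMultiDer.symm.cons_eq (h := (e, ofA 𝒜 ℒ a)) ha' (by simp [hk]) hgs, dg_liftL]
  obtain ⟨n, ξ, rfl⟩ := exists_eq_ofFn hk
  rw [liftL_ofFn, ofFn_append_singleton, lf_ofFn, lf_ofFn, h.anchor]

theorem lf_ofA_ofA (h : IsTensorBracket 𝕏 m Λ) (e e' : ℤ) (a b : A)
    (r : List (ℤ × SymAlg 𝒜 ℒ)) :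
    lf Λ ((e, ofA 𝒜 ℒ a) :: (e', ofA 𝒜 ℒ b) :: r) = 0 := by
  by_cases hk : r.length + 2 = m + 1
  · obtain ⟨m, rfl⟩ : ∃ j, m = j + 1 := ⟨r.length, by omega⟩
    obtain ⟨n, u, rfl⟩ := exists_eq_ofFn (k := m) (l := r) (by omega)
    rw [cons_ofFn, cons_ofFn, lf_ofFn]
    exact h.vanish _ 0 1 (by simp) ⟨a, rfl⟩ ⟨b, rfl⟩
  · exact lf_of_length_ne _ (by simpa using hk)

theorem unique {Λ' : MultilinearMap K (fun _ : Fin (m + 1) => SymAlg 𝒜 ℒ) (SymAlg 𝒜 ℒ)}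
    (h : IsTensorBracket 𝕏 m Λ) (h' : IsTensorBracket 𝕏 m Λ') : Λ' = Λ := by
  refine multilinear_ext (𝒮) fun n u hu => ?_
  have := h'.isMultiDer.ext_gens h.isMultiDer (l := List.ofFn fun i => (n i, u i))
    (fun g _ hk => by rw [h.lf_liftL hk, h'.lf_liftL hk])
    (fun e a g ha hg hk => by
      rw [h.lf_ofA_cons_liftL ha hg (by omega), h'.lf_ofA_cons_liftL ha hg (by omega)])
    (fun e a e' b r _ _ _ _ => by rw [h.lf_ofA_ofA, h'.lf_ofA_ofA])
    ((homog_ofFn (𝒮)).2 hu) (by simp)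
  rwa [lf_ofFn, lf_ofFn] at this

end IsTensorBracket

theorem IsExtension.eq_zero_of_ofA_ofA {k : ℕ} {δ : ℤ} {Z : List (ℤ × L) → SymAlg 𝒜 ℒ}
    {T : ℤ → A → List (ℤ × L) → SymAlg 𝒜 ℒ} {F : List (ℤ × SymAlg 𝒜 ℒ) → SymAlg 𝒜 ℒ}
    (hF : IsExtension 𝒜 ℒ (ofA 𝒜 ℒ) (ofL 𝒜 ℒ) (k + 2) δ Z T F) {e e' : ℤ} {a b : A} (ha : a ∈ 𝒜 e)
    (hb : b ∈ 𝒜 e') {r : List (ℤ × SymAlg 𝒜 ℒ)} (hr : Homog (𝒮) r) (hk : r.length = k) :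
    F ((e, ofA 𝒜 ℒ a) :: (e', ofA 𝒜 ℒ b) :: r) = 0 := by
  have h1 := (hF.der.cons (h := (e, ofA 𝒜 ℒ a)) (ofA_mem_genDeg ha)).cons
    (h := (e', ofA 𝒜 ℒ b)) (ofA_mem_genDeg hb)
  exact h1.ext_of_genList IsMultiDer.zero
    (fun l hl hk => hF.onAA e a e' b l ha hb hl (by omega)) hr hk

variable (𝕏 m) in
theorem exists_isTensorBracket :
    ∃ Λ : MultilinearMap K (fun _ : Fin (m + 1) => SymAlg 𝒜 ℒ) (SymAlg 𝒜 ℒ),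
      IsTensorBracket 𝕏 m Λ := by
  obtain ⟨F, hF⟩ := exists_isExtension _ _ _ _
    (𝕏.isGenData m (iA := ofA 𝒜 ℒ) (iL := ofL 𝒜 ℒ))
  obtain ⟨Λ, hΛ⟩ := exists_multilinearMap_of_slotLinear hF.der.lin
  have symm : IsGradedSymm (𝒮) Λ := isGradedSymm_of_swapSymm hF.der.symm hΛ
  refine ⟨Λ, fun n u hu => ?_, symm, fun n u hu e v w hv => ?_, fun ξ => ?_, fun ξ a => ?_,
    fun u i j hij hi hj => ?_⟩
  · rw [hΛ n u hu]
    have h1 := hF.mem _ ((homog_ofFn (𝒮)).2 hu) (by simp)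
    rw [dg_ofFn] at h1
    exact h1
  · have hu' : Homog (𝒮) (List.ofFn fun i => (n i, u i)) := (homog_ofFn (𝒮)).2 hu
    have hs : ∀ (e : ℤ) (v : SymAlg 𝒜 ℒ), v ∈ (𝒮) e → Λ.curryRight u v =
        F (List.ofFn (fun i => (n i, u i)) ++ [(e, v)]) := by
      intro e v hv
      have h1 : Homog (𝒮) (List.ofFn (fun i => (n i, u i)) ++ [(e, v)]) := by
        rw [homog_append, homog_cons]
        exact ⟨hu', hv, homog_nil _⟩
      rw [ofFn_append_singleton] at h1 ⊢
      exact hΛ _ _ ((homog_ofFn (𝒮)).1 h1)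
    refine leibniz_of_homogeneous (ℳ := 𝒮) (Λ.curryRight u) (fun j w hw => ?_) w
    rw [hs e v hv, hs j w hw, hs (e + j) _ (SetLike.GradedMul.mul_mem hv hw),
      hF.der.leib_last (by simp) hv hw hu', dg_ofFn]
  -- The elements of `L` are not homogeneous here, so the two sides are compared as multilinear maps
  -- on `L`, which are determined by homogeneous arguments.
  · have : Λ.compLinearMap (fun _ => ofL 𝒜 ℒ) = (ofL 𝒜 ℒ).compMultilinearMap (𝕏.X m) := by
      refine multilinear_ext ℒ fun n ξ hξ => ?_
      have h1 := hF.onL (List.ofFn fun i => (n i, ξ i)) ((homog_ofFn ℒ).2 hξ) (by simp)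
      rw [liftL_ofFn, lf_ofFn, ← hΛ n _ fun i => ofL_mem_genDeg (hξ i)] at h1
      exact h1
    exact congrArg (fun f => f ξ) this
  · change Λ.curryRight (fun i => ofL 𝒜 ℒ (ξ i)) (ofA 𝒜 ℒ a) = ofA 𝒜 ℒ (𝕏.σ m ξ a)
    induction a using Decomposition.inductionOn 𝒜 with
    | zero => simp only [map_zero]
    | add x y hx hy => simp only [map_add, hx, hy]
    | @homogeneous e a =>
      have : ((LinearMap.applyₗ (ofA 𝒜 ℒ (a : A))).compMultilinearMap
          Λ.curryRight).compLinearMap (fun _ => ofL 𝒜 ℒ) =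
          (ofA 𝒜 ℒ ∘ₗ LinearMap.applyₗ (a : A)).compMultilinearMap (𝕏.σ m) := by
        refine multilinear_ext ℒ fun n ξ hξ => ?_
        have hg : Homog ℒ (List.ofFn fun i => (n i, ξ i)) := (homog_ofFn ℒ).2 hξ
        have h1 := hF.onA e a _ a.2 hg (by simp)
        have ha : ofA 𝒜 ℒ (a : A) ∈ (𝒮) e := ofA_mem_genDeg a.2
        have hgs : Homog (𝒮) (liftL (ofL 𝒜 ℒ) (List.ofFn fun i => (n i, ξ i))) := hg.liftL
        have h2 := hF.der.symm.append_singleton (h := (e, ofA 𝒜 ℒ (a : A))) ha (by simp) hgs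
        have h3 : Homog (𝒮) (liftL (ofL 𝒜 ℒ) (List.ofFn fun i => (n i, ξ i)) ++
            [(e, ofA 𝒜 ℒ (a : A))]) := by
          rw [homog_append, homog_cons]
          exact ⟨hgs, ha, homog_nil _⟩
        rw [h1, smul_smul, ← Int.negOnePow_add, dg_liftL, negOnePow_congr (n := 0) (by grind),
          Int.negOnePow_zero, one_smul, lf_ofFn] at h2
        rw [liftL_ofFn, ofFn_append_singleton] at h2 h3
        rw [← hΛ _ _ ((homog_ofFn (𝒮)).1 h3)] at h2
        exact h2
      exact congrArg (fun f => f ξ) this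
  -- A bracket with a single entry has no two distinct slots. Otherwise all entries are decomposed
  -- into components, and in each resulting term a permutation brings the two entries from `A` to
  -- the front.
  · match m, Λ, hΛ, symm, hF, u, i, j, hij, hi, hj with
    | 0, _, _, _, _, _, i, j, hij, _, _ => omega
    | m + 1, Λ, hΛ, symm, hF, u, i, j, hij, ⟨a, ha⟩, ⟨b, hb⟩ =>
      classical
      have hu : u = fun k => ∑ j ∈ (decompose (𝒮) (u k)).support, (decompose (𝒮) (u k) j : SymAlg 𝒜 ℒ) :=
        funext fun k => (sum_support_decompose (𝒮) (u k)).symm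
      rw [hu, MultilinearMap.map_sum_finset]
      refine Finset.sum_eq_zero fun n _ => ?_
      have hv : ∀ k, (decompose (𝒮) (u k) (n k) : SymAlg 𝒜 ℒ) ∈ (𝒮) (n k) :=
        fun k => SetLike.coe_mem _
      obtain ⟨a', ha', hi'⟩ := exists_decompose_ofA (𝒜 := 𝒜) (ℒ := ℒ) a (n i)
      obtain ⟨b', hb', hj'⟩ := exists_decompose_ofA (𝒜 := 𝒜) (ℒ := ℒ) b (n j)
      rw [ha] at hi'
      rw [hb] at hj'
      obtain ⟨σ, rfl, rfl⟩ := exists_perm_zero_one hij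
      have h1 := symm n _ hv σ
      rw [hΛ (fun k => n (σ k)) _ fun k => hv (σ k), List.ofFn_succ, List.ofFn_succ, Fin.succ_zero_eq_one,
        hi', hj', hF.eq_zero_of_ofA_ofA ha' hb' ((homog_ofFn (𝒮)).2 fun k => hv (σ k.succ.succ))
          (by simp)] at h1
      exact (smul_eq_zero_iff_eq _).1 h1.symm

end TensorBracket

/-! ### Nested commutators of the Chevalley-Eilenberg operator with insertions -/

section NestedCommutators

variable {K A L P : Type*} [Field K] [Ring A] [Algebra K A] [AddCommGroup L] [Module K L]
  [Module A L] [AddCommGroup P] [Module K P] [Module A P] [IsScalarTower K A P]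
  {𝒜 : ℤ → Submodule K A} {ℒ : ℤ → Submodule K L} {𝒲 : ℤ → Submodule K P}
  [GradedAlgebra 𝒜] [GradedCommutative 𝒜] [Decomposition ℒ] [SetLike.GradedSMul 𝒜 ℒ]
  [SetLike.GradedSMul 𝒜 𝒲]

local notation "𝒮" => genDeg 𝒜 ℒ (ofA 𝒜 ℒ) (ofL 𝒜 ℒ)

theorem insertion_ofA (a : A) : insertion 𝒜 ℒ 𝒲 (ofA 𝒜 ℒ a) = insertA 𝒜 ℒ 𝒲 a := by
  refine (RingQuot.liftAlgHom_mkAlgHom_apply K _ _ _).trans ?_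
  simp

theorem insertion_ofL (ξ : L) : insertion 𝒜 ℒ 𝒲 (ofL 𝒜 ℒ ξ) = insertL 𝒜 ℒ 𝒲 ξ := by
  refine (RingQuot.liftAlgHom_mkAlgHom_apply K _ _ _).trans ?_
  simp

theorem nest_zero {S V : Type*} [Ring S] [Algebra K S] [AddCommGroup V] [Module K V]
    (ρ : S →ₐ[K] Module.End K V) (δ : ℤ) (l : List (ℤ × S)) : nest ρ 0 δ l = 0 := by
  simpa using nest_smul (ρ := ρ) (0 : K) 0 δ l

theorem Realizes.nest_liftL {F : Module.End K (Sym 𝒜 ℒ 𝒲)} {δ : ℤ}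
    {N : List (ℤ × L) → P →ₗ[K] P} {X : List (ℤ × L) → L} (hF : Realizes F δ N X)
    {g : List (ℤ × L)} (hg : Homog ℒ g) :
    Realizes (nest (insertion 𝒜 ℒ 𝒲) F δ (liftL (ofL 𝒜 ℒ) g)) (δ + dg g)
      (fun l => (g.length : ℤ).negOnePow • N (g ++ l))
      (fun l => (g.length : ℤ).negOnePow • X (g ++ l)) := by
  induction g generalizing F δ N X with
  | nil => simpa [nest] using hF
  | cons h g ih =>
    rw [homog_cons] at hg
    have := ih (hF.comm_insertL hg.1) hg.2
    rw [← insertion_ofL, add_assoc] at this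
    simpa [nest, Int.negOnePow_succ] using this

variable {𝕏 : LRInfinity 𝒜 ℒ} {nabla : LeftConnection 𝕏 𝒲} {m : ℕ}
  {D : Module.End K (Sym 𝒜 ℒ 𝒲)}

/-- The connection takes `m` entries, so it vanishes once `m + 1` are absorbed, while the bracket is
then saturated. The sign `(-1)^{m+1}` of the commutators combines with the minus sign of
`Realizes.eq_insertL`. -/
theorem IsCEOperator.nest_liftL (hD : IsCEOperator nabla m D) {g : List (ℤ × L)} (hg : Homog ℒ g)
    (hk : g.length = m + 1) : nest (insertion 𝒜 ℒ 𝒲) D 1 (liftL (ofL 𝒜 ℒ) g) =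
      (m : ℤ).negOnePow • insertL 𝒜 ℒ 𝒲 (lf (𝕏.X m) g) := by
  rw [(hD.realizes.nest_liftL hg).eq_insertL
    (fun l _ => by rw [lf_of_length_ne _ (by simp; omega), smul_zero])
    (fun h l _ => by rw [lf_of_length_ne _ (by simp; omega), smul_zero]), hk, List.append_nil,
    Units.smul_def, map_zsmul, ← Units.smul_def]
  simp [Int.negOnePow_succ]

/-- By the Leibniz rule of the connection, its failure to be `A`-linear is multiplication by the
anchor. -/
theorem IsCEOperator.comm_insertA (hD : IsCEOperator nabla m D) {e : ℤ} {a : A} (ha : a ∈ 𝒜 e) :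
    Realizes (gradedComm 1 e D (insertA 𝒜 ℒ 𝒲 a)) (1 + e)
      (fun l => (e * dg l).negOnePow • Algebra.lsmul K K P (lf (𝕏.σ m) l a)) fun _ => 0 := by
  refine hD.realizes.comm_insertA ha fun l hl p => ?_
  rw [nabla.lf_leibniz m hl ha, add_sub_cancel_left]
  rfl

theorem IsCEOperator.nest_ofA_cons_liftL (hD : IsCEOperator nabla m D) {e : ℤ} {a : A}
    (ha : a ∈ 𝒜 e) {g : List (ℤ × L)} (hg : Homog ℒ g) (hk : g.length = m) :
    nest (insertion 𝒜 ℒ 𝒲) D 1 ((e, ofA 𝒜 ℒ a) :: liftL (ofL 𝒜 ℒ) g) =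
      (m : ℤ).negOnePow • (e * dg g).negOnePow • insertA 𝒜 ℒ 𝒲 (lf (𝕏.σ m) g a) := by
  -- `Realizes.eq_insertA` identifies the operator with a single multiplication, so the signs are
  -- absorbed into the element of `A`.
  have hb : ((m : ℤ) + e * dg g).negOnePow • lf (𝕏.σ m) g a ∈ 𝒜 (1 + e + dg g) := by
    rw [Units.smul_def, add_right_comm]
    exact zsmul_mem (lf_op_mem (𝕏.σ_degree m) hg ha) _
  rw [nest, insertion_ofA, ((hD.comm_insertA ha).nest_liftL hg).eq_insertA hb (fun p => ?_)
    (fun h l _ => ?_) (fun l _ => smul_zero _)]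
  · rw [Units.smul_def, map_zsmul, ← Units.smul_def, Int.negOnePow_add, mul_smul]
  · rw [hk, List.append_nil, Int.negOnePow_add, mul_smul]
    simp only [Units.smul_def, LinearMap.smul_apply, Algebra.lsmul_coe, smul_assoc]
  · rw [lf_of_length_ne _ (by simp; omega), LinearMap.zero_apply, map_zero, smul_zero, smul_zero]

/-- After one entry from `A`, the operators on `P` are multiplications by elements of `A`; these
supercommute with `b`, so nothing is left to measure. -/
theorem IsCEOperator.comm_insertA_insertA (hD : IsCEOperator nabla m D) {e e' : ℤ} {a b : A}
    (ha : a ∈ 𝒜 e) (hb : b ∈ 𝒜 e') : gradedComm (1 + e) e'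
      (gradedComm 1 e D (insertA 𝒜 ℒ 𝒲 a)) (insertA 𝒜 ℒ 𝒲 b) = 0 := by
  refine ((hD.comm_insertA ha).comm_insertA (N' := fun _ => 0) hb fun l hl p => ?_).eq_zero
    (fun _ _ => rfl) fun _ _ => rfl
  have hc : lf (𝕏.σ m) l a * b = ((1 + dg l + e) * e').negOnePow • (b * lf (𝕏.σ m) l a) :=
    GradedCommutative.comm (lf_op_mem (𝕏.σ_degree m) hl ha) hb
  have h1 : lf (𝕏.σ m) l a • b • p = ((1 + e + dg l) * e').negOnePow • b • lf (𝕏.σ m) l a • p := by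
    rw [smul_smul, hc, add_right_comm, Units.smul_def, smul_assoc, ← Units.smul_def, mul_smul]
  simp only [Units.smul_def, LinearMap.smul_apply, Algebra.lsmul_coe, LinearMap.zero_apply]
  simp only [← Units.smul_def, h1]
  simp only [smul_comm (e * dg l).negOnePow, sub_self, smul_zero]

/-- Both sides are multiderivations along `insertion`, so the three computations on generators (no,
one or two entries from `A`) decide. -/
theorem IsCEOperator.nest_eq (hD : IsCEOperator nabla m D)
    {Λ : MultilinearMap K (fun _ : Fin (m + 1) => SymAlg 𝒜 ℒ) (SymAlg 𝒜 ℒ)}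
    (hΛ : IsTensorBracket 𝕏 m Λ) {l : List (ℤ × SymAlg 𝒜 ℒ)} (hl : Homog (𝒮) l)
    (hk : l.length = m + 1) : nest (insertion 𝒜 ℒ 𝒲) D 1 l =
      (m : ℤ).negOnePow • insertion 𝒜 ℒ 𝒲 (lf Λ l) := by
  refine (isMultiDer_nest (ℳ := 𝒮) (ρ := insertion 𝒜 ℒ 𝒲) D 1 (m + 1)).ext_gens
    ((hΛ.isMultiDer.map (insertion 𝒜 ℒ 𝒲)).negOnePow_smul m) (fun g hg hk => ?_)
    (fun e a g ha hg hk => ?_) (fun e a e' b r ha hb _ _ => ?_) hl hk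
  · rw [hD.nest_liftL hg hk, hΛ.lf_liftL hk, insertion_ofL]
  · rw [hD.nest_ofA_cons_liftL ha hg (by omega), hΛ.lf_ofA_cons_liftL ha hg (by omega), ← insertion_ofA]
    rcases Int.units_eq_one_or (e * dg g).negOnePow with h | h <;> simp [h]
  · rw [nest, nest, insertion_ofA, insertion_ofA, hD.comm_insertA_insertA ha hb, nest_zero,
      hΛ.lf_ofA_ofA, map_zero, smul_zero]

theorem IsCEOperator.nestedComm_eq (hD : IsCEOperator nabla m D)
    {Λ : MultilinearMap K (fun _ : Fin (m + 1) => SymAlg 𝒜 ℒ) (SymAlg 𝒜 ℒ)}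
    (hΛ : IsTensorBracket 𝕏 m Λ) {n : Fin (m + 1) → ℤ} {u : Fin (m + 1) → SymAlg 𝒜 ℒ}
    (hu : ∀ i, u i ∈ symDeg 𝒜 ℒ (n i)) :
    nestedComm D 1 (m + 1) n (fun i => insertion 𝒜 ℒ 𝒲 (u i)) =
      (m : ℤ).negOnePow • insertion 𝒜 ℒ 𝒲 (Λ u) := by
  rw [nestedComm_eq_nest, hD.nest_eq hΛ ((homog_ofFn (𝒮)).2 hu) (by simp), lf_ofFn]

/-- The commutator with `m + 1` insertions is itself an insertion up to sign, of the degree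
predicted by `IsTensorBracket.degree`, and therefore supercommutes with one more. -/
theorem IsCEOperator.isDiffOp (hD : IsCEOperator nabla m D)
    {Λ : MultilinearMap K (fun _ : Fin (m + 1) => SymAlg 𝒜 ℒ) (SymAlg 𝒜 ℒ)}
    (hΛ : IsTensorBracket 𝕏 m Λ) :
    IsDiffOp (symDeg 𝒜 ℒ) (insertion 𝒜 ℒ 𝒲) D 1 (m + 1) := by
  intro n u hu
  rw [nestedComm, hD.nestedComm_eq hΛ fun i => hu i.castSucc]
  have h1 : Λ (fun i => u i.castSucc) ∈ (𝒮) (1 + ∑ i : Fin (m + 1), n i.castSucc) :=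
    hΛ.degree _ _ fun i => hu i.castSucc
  have h2 := map_mul_comm (insertion 𝒜 ℒ 𝒲) h1 (hu (Fin.last (m + 1)))
  rw [gradedComm, smul_mul_assoc, mul_smul_comm, h2, smul_comm, sub_self]

end NestedCommutators
end SHLR

theorem mainTheorem3 {K A L P : Type*} [Field K] [CharZero K]
    [Ring A] [Algebra K A] (𝒜 : ℤ → Submodule K A) [GradedAlgebra 𝒜] [SHLR.GradedCommutative 𝒜]
    [AddCommGroup L] [Module K L] [Module A L] [IsScalarTower K A L] (ℒ : ℤ → Submodule K L)
    [DirectSum.Decomposition ℒ] [SetLike.GradedSMul 𝒜 ℒ]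
    [AddCommGroup P] [Module K P] [Module A P] [IsScalarTower K A P] (𝒲 : ℤ → Submodule K P)
    [DirectSum.Decomposition 𝒲] [SetLike.GradedSMul 𝒜 𝒲]
    (𝕏 : SHLR.LRInfinity 𝒜 ℒ) (nabla : SHLR.LeftConnection 𝕏 𝒲) (m : ℕ) :
    ∃ (Λ : MultilinearMap K (fun _ : Fin (m + 1) => SHLR.SymAlg 𝒜 ℒ) (SHLR.SymAlg 𝒜 ℒ))
      (D : Module.End K (SHLR.Sym 𝒜 ℒ 𝒲)),
      (SHLR.IsTensorBracket 𝕏 m Λ ∧ ∀ Λ', SHLR.IsTensorBracket 𝕏 m Λ' → Λ' = Λ) ∧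
      (SHLR.IsCEOperator nabla m D ∧ ∀ D', SHLR.IsCEOperator nabla m D' → D' = D) ∧
      (∀ (n : Fin (m + 1) → ℤ) (u : Fin (m + 1) → SHLR.SymAlg 𝒜 ℒ),
        (∀ i, u i ∈ SHLR.symDeg 𝒜 ℒ (n i)) →
        SHLR.nestedComm D 1 (m + 1) n (fun i => SHLR.insertion 𝒜 ℒ 𝒲 (u i)) =
          -((-1 : ℤ) ^ (m + 1) • SHLR.insertion 𝒜 ℒ 𝒲 (Λ u))) ∧
      SHLR.IsDiffOp (SHLR.symDeg 𝒜 ℒ) (SHLR.insertion 𝒜 ℒ 𝒲) D 1 (m + 1) := by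
  obtain ⟨Λ, hΛ⟩ := SHLR.exists_isTensorBracket 𝕏 m
  obtain ⟨D, hD⟩ := SHLR.exists_isCEOperator nabla m
  refine ⟨Λ, D, ⟨hΛ, fun _ => hΛ.unique⟩, ⟨hD, fun _ => hD.unique⟩, fun n u hu => ?_,
    hD.isDiffOp hΛ⟩
  rw [hD.nestedComm_eq hΛ hu]
  -- `(-1)^m = -(-1)^{m+1}`, in the two notations for the sign.
  rcases Nat.even_or_odd m with h | h
  · rw [Int.negOnePow_even _ (by exact_mod_cast h), h.add_one.neg_one_pow]
    simp
  · rw [Int.negOnePow_odd _ (by exact_mod_cast h), h.add_one.neg_one_pow]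
    simp
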